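/- **Setting.** A *mesh* consists of finitely many nondegenerate triangles, or of finitely many nondegenerate convex quadrilaterals, in the plane (vertices numbered counterclockwise), together with the list of its nodes ordered by age (oldest first). Let $\mathcal T_0$ be an initial mesh that is *conforming* (two different elements are disjoint or meet in a common node or a common edge), consisting of triangles only or of quadrilaterals only, and let $\mathcal N_0$ be its set of nodes. A *red refinement* of an element divides a triangle into four by joining the edge midpoints, and a quadrilateral into four by joining the midpoints of opposite edges. A *red refinement $\mathcal T$ of $\mathcal T_0$* is a mesh obtained by finitely many steps, in each of which an arbitrary set of elements is red-refined and the new nodes are appended to the list of nodes (in any order); for triangles it is required that, whenever a triangle is refined, its three vertices are older than its three edge midpoints. Hanging nodes are allowed. An edge is *irregular* if a hanging node (a node that is not an endpoint of the edge) lies in it; *direct neighbours* are elements with a common edge. **CoarsenR$(\mathcal T,\mathcal T_{\rm mark})$** consists of four steps. 1. *Admissible.* Quadrilaterals: number the vertices $v_1,\dots,v_4$ of each element so that $v_1$ is the oldest. If a node $c\notin\mathcal N_0$ is the third vertex of exactly four elements, the set of elements with vertex $c$ is an admissible quartet. Triangles: assign to each edge the oldest node among the oldest vertices of the elements that have this edge.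 A triangle without nodes in $\mathcal N_0$ whose three edges are not all assigned the same node is a middle element; a middle element that has exactly three direct neighbours forms an admissible quartet with them. 2. *Mark.* Keep the admissible quartets that contain an element of $\mathcal T_{\rm mark}$; call the result $\mathcal A$. 3. *Closure.* Remove from $\mathcal A$ the quartets that have an element with an irregular edge. Then (always for quadrilaterals; for triangles only if the 2-Neighbor Rule is in use) repeat until nothing changes: give weight $2$ to a stencil node of $Q\in\mathcal A$ if it is a hanging node, a boundary node, or shared by the stencils of two quartets in $\mathcal A$, and weight $1$ otherwise; remove all $Q$ whose total weight is at most $5$ (quadrilaterals) or at most $4$ (triangles). The stencil consists of the three vertices of the middle element for triangles, and of the middle node, whose weight is always $0$, and the four nodes joined to it by edges for quadrilaterals. 4. *Update.* Replace each quartet in $\mathcal A$ by its parent, the element of which it is the red refinement, and delete the nodes that are no longer vertices. **Theorem (Coarsening).** Let $\mathcal T$ be an arbitrary red refinement of $\mathcal T_0$, for triangles with or without use of the 2-Neighbor Rule. (a) If $\mathcal T\ne\mathcal T_0$, then the set of quartets that is passed to *Update* in CoarsenR$(\mathcal T,\mathcal T)$ is nonempty. (b) If $\mathcal T^{(0)}=\mathcal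 T$ and $\mathcal T^{(i+1)}=\text{CoarsenR}(\mathcal T^{(i)},\mathcal T^{(i)})$ for all $i$, then $\mathcal T^{(M)}=\mathcal T_0$ for some $M\in\mathbb N_0$. (c) The same as (b) holds for conforming meshes obtained from $\mathcal T_0$ by red-green refinement (triangles or quadrilaterals) or by red-blue refinement (quadrilaterals), i.e. by repeatedly applying *Recoarsen*, red refinement as above, and *Regularize*, if CoarsenR is replaced by CoarsenRG or CoarsenRB. These procedures apply *Recoarsen* (replace each green or blue pattern by its parent element and drop markings of its elements), CoarsenR (for triangles with the 2-Neighbor Rule), and *Regularize*. In the red-green case, *Regularize* divides each element with hanging nodes by the green pattern that matches them: a triangle with one bisected edge into two triangles; a quadrilateral into three triangles (one bisected edge), four triangles (two adjacent bisected edges) or two quadrilaterals (two opposite bisected edges). In the red-blue case, *Regularize* treats elements with irregular edges one after the other until no hanging nodes are left: a red element is either divided into three quadrilaterals by a blue pattern (its midpoint is joined with the midpoints of two adjacent edges and with the vertex opposite to the common vertex of these edges) or red-refined, and for an element of a blue pattern the parent of the pattern is red-refined instead. The order and the choices are arbitrary: sequences of such outputs of CoarsenRB exist, and every one of them reaches $\mathcal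 T_0$. -/

import Mathlib

namespace AdaptMesh

noncomputable section

open scoped Classical

/-! ### Elements and meshes -/

/-- Points of the plane. -/
abbrev Pt : Type := ℝ × ℝ

/-- An element (triangle or quadrilateral), given by its vertices in counterclockwise order, up to
cyclic permutation. -/
abbrev Elem : Type := Cycle Pt

/-- A mesh: its nodes, listed from the oldest to the newest, and its elements. -/
@[ext] structure Mesh where
  nodes : List Pt
  elems : Set Elem

/-- The closed polygonal region `conv(v₁, …, vₖ)` covered by an element. -/
def hull (K : Elem) : Set Pt := convexHull ℝ {v | v ∈ K}

/-- `b` follows `a` in the counterclockwise order of the vertices of `K`. -/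
def HasSide (K : Elem) (a b : Pt) : Prop :=
  ∃ l : List Pt, K = ((a :: b :: l : List Pt) : Cycle Pt)

/-- The segment with endpoints `a`, `b` is an edge of `K`. -/
def HasEdge (K : Elem) (a b : Pt) : Prop := HasSide K a b ∨ HasSide K b a

/-- Twice the signed area of the triangle `a b c`. -/
def cross (a b c : Pt) : ℝ :=
  (b.1 - a.1) * (c.2 - a.2) - (b.2 - a.2) * (c.1 - a.1)

/-- Nondegenerate, counterclockwise triangle. -/
def IsTriangle (K : Elem) : Prop :=
  ∃ a b c : Pt, K = ([a, b, c] : List Pt) ∧ 0 < cross a b c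

/-- Nondegenerate, counterclockwise (strictly) convex quadrilateral. -/
def IsQuad (K : Elem) : Prop :=
  ∃ a b c d : Pt, K = ([a, b, c, d] : List Pt) ∧
    0 < cross a b c ∧ 0 < cross b c d ∧ 0 < cross c d a ∧ 0 < cross d a b

/-- The node list has no repetitions and consists of the vertices of the elements. -/
def NodesOK (T : Mesh) : Prop :=
  T.nodes.Nodup ∧ ∀ v : Pt, v ∈ T.nodes ↔ ∃ K ∈ T.elems, v ∈ K

/-- Two different elements are disjoint, or meet in a common node, or meet in a common edge. -/
def Conforming (T : Mesh) : Prop :=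
  ∀ K ∈ T.elems, ∀ L ∈ T.elems, K ≠ L →
    hull K ∩ hull L = ∅ ∨
    (∃ v : Pt, v ∈ K ∧ v ∈ L ∧ hull K ∩ hull L = {v}) ∨
    (∃ a b : Pt, HasEdge K a b ∧ HasEdge L a b ∧ hull K ∩ hull L = segment ℝ a b)

/-- A conforming initial triangulation all of whose elements have the given shape. -/
def IsInitialMesh (shape : Elem → Prop) (T : Mesh) : Prop :=
  T.elems.Finite ∧ NodesOK T ∧ (∀ K ∈ T.elems, shape K) ∧ Conforming T

/-- `a` is a strictly older node than `b`: it comes earlier in the (repetition-free) list of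
nodes. -/
def Older (T : Mesh) (a b : Pt) : Prop := List.Sublist [a, b] T.nodes

/-- `v` is a hanging node: a node of the mesh that lies on an edge of some element without being
an endpoint of that edge. -/
def IsHanging (T : Mesh) (v : Pt) : Prop :=
  v ∈ T.nodes ∧ ∃ K ∈ T.elems, ∃ a b : Pt, HasEdge K a b ∧ v ∈ openSegment ℝ a b

/-- `K` has an irregular edge, i.e. an edge with a hanging node on it. -/
def HasIrregularEdge (T : Mesh) (K : Elem) : Prop :=
  ∃ a b : Pt, HasEdge K a b ∧ ∃ v ∈ T.nodes, v ∈ openSegment ℝ a b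

/-- There are no hanging nodes. -/
def IsRegular (T : Mesh) : Prop := ∀ v : Pt, ¬ IsHanging T v

/-- `v` lies on the boundary of the domain covered by the mesh. -/
def IsBoundary (T : Mesh) (v : Pt) : Prop := v ∈ frontier (⋃ K ∈ T.elems, hull K)

/-- Two different elements are direct neighbours if they have a common edge. -/
def DirectNeighbor (K L : Elem) : Prop :=
  K ≠ L ∧ ∃ a b : Pt, HasEdge K a b ∧ HasEdge L a b

/-! ### Red refinement -/

/-- The point in which the two segments joining the midpoints of opposite edges of the
quadrilateral `a b c d` meet (they bisect each other). -/
def quadCenter (a b c d : Pt) : Pt := midpoint ℝ (midpoint ℝ a b) (midpoint ℝ c d)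

/-- The four children of a red-refined triangle (three corner elements and the middle element) or
quadrilateral (four corner elements). As `P` is a cyclic list, `a` runs through all its vertices. -/
def redChildren (P : Elem) : Set Elem :=
  {K | ∃ a b c : Pt, P = ([a, b, c] : List Pt) ∧
    (K = ([a, midpoint ℝ a b, midpoint ℝ c a] : List Pt) ∨
     K = ([midpoint ℝ a b, midpoint ℝ b c, midpoint ℝ c a] : List Pt))} ∪
  {K | ∃ a b c d : Pt, P = ([a, b, c, d] : List Pt) ∧
    K = ([a, midpoint ℝ a b, quadCenter a b c d, midpoint ℝ d a] : List Pt)}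

/-- `T'` results from `T` by red-refining the elements in `R`; new nodes are appended at the end of
the list of nodes, in any order. -/
def RedRefineSet (R : Set Elem) (T T' : Mesh) : Prop :=
  R ⊆ T.elems ∧ T'.elems = (T.elems \ R) ∪ (⋃ P ∈ R, redChildren P) ∧
    T.nodes <+: T'.nodes ∧ NodesOK T'

/-- One step of red refinement of quadrilaterals, with an arbitrary set of refined elements. -/
def QuadStep (T T' : Mesh) : Prop := ∃ R : Set Elem, RedRefineSet R T T'

/-- One step of red refinement of triangles, with an arbitrary set of refined elements. The three
vertices of a refined triangle stem from an older generation than the three edge midpoints. -/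
def TriStep (T T' : Mesh) : Prop :=
  ∃ R : Set Elem, RedRefineSet R T T' ∧
    ∀ P ∈ R, ∀ p ∈ P, ∀ a b : Pt, HasEdge P a b → Older T' p (midpoint ℝ a b)

/-- `T` is obtained from `S` by finitely many steps of red refinement. -/
def RedRefinement (step : Mesh → Mesh → Prop) (S T : Mesh) : Prop := Relation.ReflTransGen step S T

/-! ### The step Admissible -/

/-- `a` is the oldest vertex of `K`. -/
def IsOldest (T : Mesh) (K : Elem) (a : Pt) : Prop := a ∈ K ∧ ∀ b ∈ K, b ≠ a → Older T a b

/-- `c` is the third vertex of the quadrilateral `K` when its counterclockwise numbering starts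
with the oldest vertex. -/
def IsThird (T : Mesh) (K : Elem) (c : Pt) : Prop :=
  ∃ a b d : Pt, K = ([a, b, c, d] : List Pt) ∧ IsOldest T K a

/-- Admissible quartets of a quadrilateral mesh; `N₀` is the set of nodes of the initial mesh. -/
def admissibleQuad (N₀ : Set Pt) (T : Mesh) : Set (Set Elem) :=
  {Q | ∃ c : Pt, (∃ K ∈ T.elems, IsThird T K c) ∧
    {K | K ∈ T.elems ∧ IsThird T K c}.ncard = 4 ∧ c ∉ N₀ ∧ Q = {K | K ∈ T.elems ∧ c ∈ K}}

/-- `v` is the node assigned to the edge `a b`: the oldest one among the oldest vertices of the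
elements that have this edge. -/
def IsEdgeOldest (T : Mesh) (a b v : Pt) : Prop :=
  (∃ K ∈ T.elems, HasEdge K a b ∧ IsOldest T K v) ∧
    ∀ K ∈ T.elems, HasEdge K a b → ∀ w : Pt, IsOldest T K w → w = v ∨ Older T v w

/-- The triangles that are recognized as middle elements: the nodes assigned to the three edges are
not all the same, and no vertex belongs to the initial mesh. -/
def middleElems (N₀ : Set Pt) (T : Mesh) : Set Elem :=
  {K | K ∈ T.elems ∧ (¬ ∃ v : Pt, ∀ a b : Pt, HasEdge K a b → IsEdgeOldest T a b v) ∧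
    ∀ v ∈ K, v ∉ N₀}

/-- Admissible quartets of a triangular mesh. -/
def admissibleTri (N₀ : Set Pt) (T : Mesh) : Set (Set Elem) :=
  {Q | ∃ K ∈ middleElems N₀ T, {L | L ∈ T.elems ∧ DirectNeighbor K L}.ncard = 3 ∧
    Q = {K} ∪ {L | L ∈ T.elems ∧ DirectNeighbor K L}}

/-! ### The step Mark -/

/-- Keep the quartets that contain at least one marked element. -/
def markQuartets (A : Set (Set Elem)) (marked : Set Elem) : Set (Set Elem) :=
  {Q | Q ∈ A ∧ ∃ K ∈ marked, K ∈ Q}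

/-! ### The step Closure -/

/-- Remove the quartets that have an element with an irregular edge. -/
def unblocked (T : Mesh) (A : Set (Set Elem)) : Set (Set Elem) :=
  {Q | Q ∈ A ∧ ∀ K ∈ Q, ¬ HasIrregularEdge T K}

/-- Repeat `f`, starting from `A`, until it does not change anything any more. -/
def untilStable (f : Set (Set Elem) → Set (Set Elem)) (A : Set (Set Elem)) : Set (Set Elem) :=
  f^[sInf {n : ℕ | f^[n + 1] A = f^[n] A}] A

/-- `v` is the middle node of the quartet `Q` of quadrilaterals: the node common to all of them. -/
def IsMiddleNode (Q : Set Elem) (v : Pt) : Prop := ∀ K ∈ Q, v ∈ K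

/-- The nodes of the five-point stencil of a quartet of quadrilaterals: the middle node and the
nodes that are joined to it by an edge. -/
def stencilQuad (Q : Set Elem) : Set Pt :=
  {v | IsMiddleNode Q v ∨ ∃ c : Pt, IsMiddleNode Q c ∧ ∃ K ∈ Q, HasEdge K c v}

/-- The nodes of the middle element of a quartet of triangles, the middle element being the one
that is a direct neighbour of the three others. -/
def stencilTri (Q : Set Elem) : Set Pt :=
  {v | ∃ K ∈ Q, (∀ L ∈ Q, L ≠ K → DirectNeighbor K L) ∧ v ∈ K}

/-- `v` is shared by the stencils of two quartets in `A`. -/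
def IsShared (stencil : Set Elem → Set Pt) (A : Set (Set Elem)) (v : Pt) : Prop :=
  ∃ Q₁ ∈ A, ∃ Q₂ ∈ A, Q₁ ≠ Q₂ ∧ v ∈ stencil Q₁ ∧ v ∈ stencil Q₂

/-- Weight of a stencil node `v` of a quartet `Q` of quadrilaterals. -/
def weightQuad (T : Mesh) (A : Set (Set Elem)) (Q : Set Elem) (v : Pt) : ℕ :=
  if IsMiddleNode Q v then 0
  else if IsHanging T v ∨ IsBoundary T v ∨ IsShared stencilQuad A v then 2
  else 1

/-- Weight of a node `v` of the middle element of a quartet of triangles. -/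
def weightTri (T : Mesh) (A : Set (Set Elem)) (v : Pt) : ℕ :=
  if IsHanging T v ∨ IsBoundary T v ∨ IsShared stencilTri A v then 2 else 1

/-- One pass of the loop that ensures the 3-Neighbor Rule. -/
def passQuad (T : Mesh) (A : Set (Set Elem)) : Set (Set Elem) :=
  {Q | Q ∈ A ∧ ¬ (∑ᶠ v ∈ stencilQuad Q, weightQuad T A Q v) ≤ 5}

/-- One pass of the loop that ensures the 2-Neighbor Rule. -/
def passTri (T : Mesh) (A : Set (Set Elem)) : Set (Set Elem) :=
  {Q | Q ∈ A ∧ ¬ (∑ᶠ v ∈ stencilTri Q, weightTri T A v) ≤ 4}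

def closureQuad (T : Mesh) (A : Set (Set Elem)) : Set (Set Elem) :=
  untilStable (passQuad T) (unblocked T A)

/-- `rule` tells whether the 2-Neighbor Rule is in use. -/
def closureTri (rule : Bool) (T : Mesh) (A : Set (Set Elem)) : Set (Set Elem) :=
  if rule then untilStable (passTri T) (unblocked T A) else unblocked T A

/-! ### The step Update and the procedure CoarsenR -/

/-- Drop from the list of nodes all points that are no vertices of elements in `E`. -/
def keepNodes (l : List Pt) (E : Set Elem) : List Pt := l.filter (fun v => decide (∃ K ∈ E, v ∈ K))

/-- Replace every quartet in `A` by its parent element, i.e. by the element whose red refinement it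
is. -/
def update (T : Mesh) (A : Set (Set Elem)) : Mesh where
  nodes := keepNodes T.nodes ((T.elems \ ⋃₀ A) ∪ {P | redChildren P ∈ A})
  elems := (T.elems \ ⋃₀ A) ∪ {P | redChildren P ∈ A}

/-- The set of quartets that CoarsenR passes to Update, for quadrilateral meshes. -/
def quartetsQuad (N₀ : Set Pt) (T : Mesh) (marked : Set Elem) : Set (Set Elem) :=
  closureQuad T (markQuartets (admissibleQuad N₀ T) marked)

/-- The set of quartets that CoarsenR passes to Update, for triangular meshes. -/
def quartetsTri (rule : Bool) (N₀ : Set Pt) (T : Mesh) (marked : Set Elem) : Set (Set Elem) :=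
  closureTri rule T (markQuartets (admissibleTri N₀ T) marked)

/-- CoarsenR for quadrilateral meshes. -/
def coarsenQuad (N₀ : Set Pt) (T : Mesh) (marked : Set Elem) : Mesh :=
  update T (quartetsQuad N₀ T marked)

/-- CoarsenR for triangular meshes. -/
def coarsenTri (rule : Bool) (N₀ : Set Pt) (T : Mesh) (marked : Set Elem) : Mesh :=
  update T (quartetsTri rule N₀ T marked)

/-! ### Red-green and red-blue meshes -/

/-- A mesh stored in blocks: the red (unpatterned) elements, and the green or blue patterns, each
of which is the set of elements into which one element has been divided. -/
@[ext] structure BlockMesh where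
  nodes : List Pt
  red : Set Elem
  patterns : Set (Set Elem)

/-- Forget the distinction between red elements and elements of patterns. -/
def BlockMesh.toMesh (T : BlockMesh) : Mesh where
  nodes := T.nodes
  elems := T.red ∪ ⋃₀ T.patterns

/-- A mesh as a block mesh without patterns. -/
def Mesh.toBlock (T : Mesh) : BlockMesh where
  nodes := T.nodes
  red := T.elems
  patterns := ∅

/-- `IsGreenTri P H G`: the pattern `G` is the green refinement of the triangle `P` that bisects
the edge with midpoint in `H`. -/
def IsGreenTri (P : Elem) (H : Set Pt) (G : Set Elem) : Prop :=
  ∃ a b c m : Pt, P = ([a, b, c] : List Pt) ∧ m = midpoint ℝ a b ∧ H = {m} ∧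
    G = {(([a, m, c] : List Pt) : Elem), (([m, b, c] : List Pt) : Elem)}

/-- `IsGreenQuad P H G`: the pattern `G` is a green refinement of the quadrilateral `P`, with `H`
the set of edge midpoints that it uses: one midpoint (three triangles), two midpoints of adjacent
edges (four triangles), or two midpoints of opposite edges (two quadrilaterals). -/
def IsGreenQuad (P : Elem) (H : Set Pt) (G : Set Elem) : Prop :=
  ∃ a b c d m : Pt, P = ([a, b, c, d] : List Pt) ∧ m = midpoint ℝ a b ∧
    ((H = {m} ∧
        G = {(([a, m, d] : List Pt) : Elem), (([m, b, c] : List Pt) : Elem),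
          (([m, c, d] : List Pt) : Elem)}) ∨
     (∃ n : Pt, n = midpoint ℝ b c ∧ H = {m, n} ∧
        G = {(([m, b, n] : List Pt) : Elem), (([a, m, d] : List Pt) : Elem),
          (([n, c, d] : List Pt) : Elem), (([m, n, d] : List Pt) : Elem)}) ∨
     (∃ n : Pt, n = midpoint ℝ c d ∧ H = {m, n} ∧
        G = {(([a, m, n, d] : List Pt) : Elem), (([m, b, c, n] : List Pt) : Elem)}))

/-- `IsBlue P G`: the pattern `G` is a blue refinement of the quadrilateral `P` into three
quadrilaterals: the midpoint of `P` is joined with the midpoints of two adjacent edges `a b` and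
`b c` and with the node `d` opposite to their common node `b`. -/
def IsBlue (P : Elem) (G : Set Elem) : Prop :=
  ∃ a b c d m n z : Pt, P = ([a, b, c, d] : List Pt) ∧
    m = midpoint ℝ a b ∧ n = midpoint ℝ b c ∧ z = quadCenter a b c d ∧
    G = {(([m, b, n, z] : List Pt) : Elem), (([n, c, d, z] : List Pt) : Elem),
      (([a, m, z, d] : List Pt) : Elem)}

/-- The step Recoarsen: replace every pattern by its parent element. The relation `isPattern P G`
says that `G` is a pattern of `P`. -/
def recoarsen (isPattern : Elem → Set Elem → Prop) (T : BlockMesh) : Mesh where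
  nodes := keepNodes T.nodes (T.red ∪ {P | ∃ G ∈ T.patterns, isPattern P G})
  elems := T.red ∪ {P | ∃ G ∈ T.patterns, isPattern P G}

/-- The hanging nodes on the edges of `K`. -/
def hangingOn (T : Mesh) (K : Elem) : Set Pt :=
  {v | v ∈ T.nodes ∧ ∃ a b : Pt, HasEdge K a b ∧ v ∈ openSegment ℝ a b}

/-- The step Regularize of the red-green strategies: every element with hanging nodes is divided
by the green pattern that matches them. -/
def regularizeGreen (green : Elem → Set Pt → Set Elem → Prop) (S : Mesh) : BlockMesh where
  nodes := S.nodes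
  red := {K | K ∈ S.elems ∧ ¬ ∃ G : Set Elem, green K (hangingOn S K) G}
  patterns := {G | ∃ K ∈ S.elems, green K (hangingOn S K) G}

/-- CoarsenRG. Markings of green elements are dropped. The parameter `coarsen` is CoarsenR for the
shape of the mesh, and `green` the relation for its green patterns. -/
def coarsenGreen (green : Elem → Set Pt → Set Elem → Prop)
    (coarsen : Mesh → Set Elem → Mesh) (T : BlockMesh) (marked : Set Elem) : BlockMesh :=
  regularizeGreen green
    (coarsen (recoarsen (fun P G => ∃ H : Set Pt, green P H G) T) (marked ∩ T.red))

/-- `T'` is obtained from `T` by other elements, new nodes being appended in any order. -/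
def AppendsNodes (T T' : BlockMesh) : Prop := T.nodes <+: T'.nodes ∧ NodesOK T'.toMesh

/-- One step of the closing of a quadrilateral mesh by blue patterns. Some element with an
irregular edge is treated: a red element is divided by a blue pattern or red-refined; an element
of a blue pattern is not refined further, but its parent element is red-refined instead. -/
def BlueStep (T T' : BlockMesh) : Prop :=
  AppendsNodes T T' ∧
  ((∃ K ∈ T.red, HasIrregularEdge T.toMesh K ∧
      ((∃ G : Set Elem, IsBlue K G ∧ T'.red = T.red \ {K} ∧ T'.patterns = T.patterns ∪ {G}) ∨
       (T'.red = (T.red \ {K}) ∪ redChildren K ∧ T'.patterns = T.patterns))) ∨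
   (∃ G ∈ T.patterns, ∃ P : Elem, IsBlue P G ∧ (∃ K ∈ G, HasIrregularEdge T.toMesh K) ∧
      T'.red = T.red ∪ redChildren P ∧ T'.patterns = T.patterns \ {G}))

/-- The step Regularize of the red-blue strategy: `T` is a possible result of closing `S` by blue
patterns until there are no hanging nodes any more. The order in which the elements are treated
and the choice between the blue and red patterns is left open. -/
def RegularizeBlue (S : Mesh) (T : BlockMesh) : Prop :=
  Relation.ReflTransGen BlueStep S.toBlock T ∧ IsRegular T.toMesh

/-- CoarsenRB: `T'` is a possible result for the input `T`, `marked`. Markings of blue elements are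
dropped. -/
def CoarsenBlue (N₀ : Set Pt) (T : BlockMesh) (marked : Set Elem) (T' : BlockMesh) : Prop :=
  RegularizeBlue (coarsenQuad N₀ (recoarsen IsBlue T) (marked ∩ T.red)) T'

/-- Conforming meshes obtained from the initial mesh `T₀` by repeatedly recoarsening the patterns,
red-refining, and regularizing with patterns. -/
inductive ClosedRefinement (step : Mesh → Mesh → Prop) (isPattern : Elem → Set Elem → Prop)
    (regularize : Mesh → BlockMesh → Prop) (T₀ : Mesh) : BlockMesh → Prop
  | init : ClosedRefinement step isPattern regularize T₀ T₀.toBlock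
  | refine (T : BlockMesh) (S : Mesh) (T' : BlockMesh) :
      ClosedRefinement step isPattern regularize T₀ T →
      RedRefinement step (recoarsen isPattern T) S →
      regularize S T' → IsRegular T'.toMesh →
      ClosedRefinement step isPattern regularize T₀ T'

/-- Conforming meshes obtained from `T₀` by red-green refinement. -/
def GreenRefinement (step : Mesh → Mesh → Prop) (green : Elem → Set Pt → Set Elem → Prop)
    (T₀ : Mesh) (T : BlockMesh) : Prop :=
  ClosedRefinement step (fun P G => ∃ H : Set Pt, green P H G)
    (fun S T' => T' = regularizeGreen green S) T₀ T

/-- Conforming meshes obtained from `T₀` by red-blue refinement. -/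
def BlueRefinement (T₀ : Mesh) (T : BlockMesh) : Prop :=
  ClosedRefinement QuadStep IsBlue RegularizeBlue T₀ T

end

end AdaptMesh

open AdaptMesh

/-!
Let `E` be the set of elements of the initial mesh and let `level E k` be its `k`-fold uniform red
refinement. Each `level E k` is conforming (`Grid.level`), so that an edge midpoint or a center that
is created on one level belongs to no coarser level. Every element therefore has a well-defined
level and parent, and a red refinement is the set of leaves of the forest whose inner elements are
the refined elements (`Leaves`, `RedTree`).

The age of the nodes makes this forest visible to CoarsenR. In a child at a corner, the corner is
older than the edge midpoints and the center of the parent (`TriOrder`, `QuadOrder`). Hence the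
third vertex of a quadrilateral that does not belong to the initial mesh is the center of its
parent, and among the children of a triangle exactly the middle one passes the test on the nodes
assigned to its edges. The admissible quartets are thus precisely the quartets of leaves with a
common parent (`admissibleTri_eq`, `admissibleQuad_eq`).

The children of a refined element `P` on the highest level are leaves without irregular edges. The
stencil of their quartet consists of the midpoints of the edges of `P` (and its center). By
conformity of the level of `P`, a midpoint that is not on the boundary of the domain is either a
hanging node of a coarser leaf, or the neighbour of `P` across this edge is refined as well
(`Leaves.hanging_or_boundary_or_neighbor`). As long as all quartets on the highest level are
present, all these midpoints have weight `2`, so that no pass of the closure removes one of these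
quartets (`top_mem_quartetsTri`, `top_mem_quartetsQuad`). CoarsenR therefore removes at least the
highest level of the forest, and preserves the order of the nodes, and after finitely many steps the
initial mesh is reached.

For red-green meshes, a pattern determines its parent element, because the vertices of a convex
element are the extreme points of its hull, and hence Recoarsen undoes Regularize
(`GreenRule.recoarsen_regularizeGreen`). For red-blue meshes, Regularize only divides elements with
irregular edges and parents of blue patterns, none of which are on the highest level
(`BlueTree.step`); the same bound shows that Regularize can be completed by red refinements alone
(`BlueTree.exists_regular`). As elements on the highest level are never divided by a pattern, their
markings are kept, and the arguments for CoarsenR apply.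
-/

namespace AdaptMesh

open scoped Classical

/-! ### Cycles with three and four vertices -/

/-- The triangle with vertices `a b c`. -/
abbrev tri (a b c : Pt) : Elem := ([a, b, c] : List Pt)

/-- The quadrilateral with vertices `a b c d`. -/
abbrev quad (a b c d : Pt) : Elem := ([a, b, c, d] : List Pt)

theorem tri_eq_iff {a b c x y z : Pt} : tri a b c = tri x y z ↔
    (x = a ∧ y = b ∧ z = c) ∨ (x = b ∧ y = c ∧ z = a) ∨ (x = c ∧ y = a ∧ z = b) := by
  rw [Cycle.coe_eq_coe, List.isRotated_iff_mod]
  constructor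
  · rintro ⟨n, hn, h⟩
    simp only [List.length_cons, List.length_nil] at hn
    interval_cases n <;> simp [List.rotate] at h <;> obtain ⟨rfl, rfl, rfl⟩ := h <;> simp
  · rintro (⟨rfl, rfl, rfl⟩ | ⟨rfl, rfl, rfl⟩ | ⟨rfl, rfl, rfl⟩)
    · exact ⟨0, by simp, by simp [List.rotate]⟩
    · exact ⟨1, by simp, by simp [List.rotate]⟩
    · exact ⟨2, by simp, by simp [List.rotate]⟩

theorem quad_eq_iff {a b c d x y z w : Pt} : quad a b c d = quad x y z w ↔
    (x = a ∧ y = b ∧ z = c ∧ w = d) ∨ (x = b ∧ y = c ∧ z = d ∧ w = a) ∨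
    (x = c ∧ y = d ∧ z = a ∧ w = b) ∨ (x = d ∧ y = a ∧ z = b ∧ w = c) := by
  rw [Cycle.coe_eq_coe, List.isRotated_iff_mod]
  constructor
  · rintro ⟨n, hn, h⟩
    simp only [List.length_cons, List.length_nil] at hn
    interval_cases n <;> simp [List.rotate] at h <;> obtain ⟨rfl, rfl, rfl, rfl⟩ := h <;> simp
  · rintro (⟨rfl, rfl, rfl, rfl⟩ | ⟨rfl, rfl, rfl, rfl⟩ | ⟨rfl, rfl, rfl, rfl⟩ |
      ⟨rfl, rfl, rfl, rfl⟩)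
    · exact ⟨0, by simp, by simp [List.rotate]⟩
    · exact ⟨1, by simp, by simp [List.rotate]⟩
    · exact ⟨2, by simp, by simp [List.rotate]⟩
    · exact ⟨3, by simp, by simp [List.rotate]⟩

theorem tri_rotate (a b c : Pt) : tri b c a = tri a b c :=
  tri_eq_iff.2 (Or.inr (Or.inr ⟨rfl, rfl, rfl⟩))

theorem quad_rotate (a b c d : Pt) : quad b c d a = quad a b c d :=
  quad_eq_iff.2 (Or.inr (Or.inr (Or.inr ⟨rfl, rfl, rfl, rfl⟩)))

theorem tri_ne_quad {a b c x y z w : Pt} : tri a b c ≠ quad x y z w := by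
  intro h
  have := congrArg Cycle.length h
  simp at this

@[simp] theorem mem_tri {a b c v : Pt} : v ∈ tri a b c ↔ v = a ∨ v = b ∨ v = c := by
  simp [tri]

@[simp] theorem mem_quad {a b c d v : Pt} : v ∈ quad a b c d ↔ v = a ∨ v = b ∨ v = c ∨ v = d := by
  simp [quad]

theorem hasSide_tri {a b c p q : Pt} : HasSide (tri a b c) p q ↔
    (p = a ∧ q = b) ∨ (p = b ∧ q = c) ∨ (p = c ∧ q = a) := by
  constructor
  · rintro ⟨l, h⟩
    have hl : l.length = 1 := by
      have := congrArg Cycle.length h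
      simp at this
      omega
    obtain ⟨r, rfl⟩ := List.length_eq_one_iff.1 hl
    rcases tri_eq_iff.1 h with h | h | h <;> tauto
  · rintro (⟨rfl, rfl⟩ | ⟨rfl, rfl⟩ | ⟨rfl, rfl⟩)
    · exact ⟨[c], rfl⟩
    · exact ⟨[a], (tri_rotate _ _ _).symm⟩
    · exact ⟨[b], tri_rotate _ _ _⟩

theorem hasSide_quad {a b c d p q : Pt} : HasSide (quad a b c d) p q ↔
    (p = a ∧ q = b) ∨ (p = b ∧ q = c) ∨ (p = c ∧ q = d) ∨ (p = d ∧ q = a) := by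
  constructor
  · rintro ⟨l, h⟩
    have hl : l.length = 2 := by
      have := congrArg Cycle.length h
      simp at this
      omega
    obtain ⟨r, s, rfl⟩ := List.length_eq_two.1 hl
    rcases quad_eq_iff.1 h with h | h | h | h <;> tauto
  · rintro (⟨rfl, rfl⟩ | ⟨rfl, rfl⟩ | ⟨rfl, rfl⟩ | ⟨rfl, rfl⟩)
    · exact ⟨[c, d], rfl⟩
    · exact ⟨[d, a], (quad_rotate _ _ _ _).symm⟩
    · exact ⟨[a, b], quad_eq_iff.2 (by tauto)⟩
    · exact ⟨[b, c], quad_rotate _ _ _ _⟩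

theorem HasEdge.symm {K : Elem} {a b : Pt} (h : HasEdge K a b) : HasEdge K b a := Or.symm h

theorem HasSide.left_mem {K : Elem} {a b : Pt} (h : HasSide K a b) : a ∈ K := by
  obtain ⟨l, rfl⟩ := h; simp

theorem HasSide.right_mem {K : Elem} {a b : Pt} (h : HasSide K a b) : b ∈ K := by
  obtain ⟨l, rfl⟩ := h; simp

theorem HasEdge.left_mem {K : Elem} {a b : Pt} (h : HasEdge K a b) : a ∈ K :=
  h.elim HasSide.left_mem HasSide.right_mem

theorem HasEdge.right_mem {K : Elem} {a b : Pt} (h : HasEdge K a b) : b ∈ K := h.symm.left_mem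

theorem redChildren_tri (a b c : Pt) : redChildren (tri a b c) =
    {tri a (midpoint ℝ a b) (midpoint ℝ c a), tri b (midpoint ℝ b c) (midpoint ℝ a b),
      tri c (midpoint ℝ c a) (midpoint ℝ b c),
      tri (midpoint ℝ a b) (midpoint ℝ b c) (midpoint ℝ c a)} := by
  ext K
  simp only [redChildren, Set.mem_union, Set.mem_ofPred_eq, Set.mem_insert_iff,
    Set.mem_singleton_iff]
  constructor
  · rintro (⟨x, y, z, h, h'⟩ | ⟨x, y, z, w, h, -⟩)
    · rcases tri_eq_iff.1 h with ⟨rfl, rfl, rfl⟩ | ⟨rfl, rfl, rfl⟩ | ⟨rfl, rfl, rfl⟩ <;>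
        rcases h' with rfl | rfl <;> simp [tri_rotate]
    · exact absurd h tri_ne_quad
  · rintro (rfl | rfl | rfl | rfl)
    · exact Or.inl ⟨a, b, c, rfl, Or.inl rfl⟩
    · exact Or.inl ⟨b, c, a, (tri_rotate _ _ _).symm, Or.inl rfl⟩
    · exact Or.inl ⟨c, a, b, tri_rotate _ _ _, Or.inl rfl⟩
    · exact Or.inl ⟨a, b, c, rfl, Or.inr rfl⟩

@[simp] theorem midpoint_fst (a b : Pt) : (midpoint ℝ a b).1 = (a.1 + b.1) / 2 := by
  simp [midpoint_eq_smul_add]; ring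

@[simp] theorem midpoint_snd (a b : Pt) : (midpoint ℝ a b).2 = (a.2 + b.2) / 2 := by
  simp [midpoint_eq_smul_add]; ring

@[simp] theorem quadCenter_fst (a b c d : Pt) :
    (quadCenter a b c d).1 = (a.1 + b.1 + c.1 + d.1) / 4 := by
  simp [quadCenter]; ring

@[simp] theorem quadCenter_snd (a b c d : Pt) :
    (quadCenter a b c d).2 = (a.2 + b.2 + c.2 + d.2) / 4 := by
  simp [quadCenter]; ring

theorem quadCenter_rotate (a b c d : Pt) : quadCenter b c d a = quadCenter a b c d := by
  ext <;> simp <;> ring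

theorem redChildren_quad (a b c d : Pt) : redChildren (quad a b c d) =
    {quad a (midpoint ℝ a b) (quadCenter a b c d) (midpoint ℝ d a),
      quad b (midpoint ℝ b c) (quadCenter a b c d) (midpoint ℝ a b),
      quad c (midpoint ℝ c d) (quadCenter a b c d) (midpoint ℝ b c),
      quad d (midpoint ℝ d a) (quadCenter a b c d) (midpoint ℝ c d)} := by
  have h1 := quadCenter_rotate a b c d
  have h2 := quadCenter_rotate b c d a
  have h3 := quadCenter_rotate c d a b
  ext K
  simp only [redChildren, Set.mem_union, Set.mem_ofPred_eq, Set.mem_insert_iff,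
    Set.mem_singleton_iff]
  constructor
  · rintro (⟨x, y, z, h, -⟩ | ⟨x, y, z, w, h, rfl⟩)
    · exact absurd h.symm tri_ne_quad
    · rcases quad_eq_iff.1 h with ⟨rfl, rfl, rfl, rfl⟩ | ⟨rfl, rfl, rfl, rfl⟩ |
        ⟨rfl, rfl, rfl, rfl⟩ | ⟨rfl, rfl, rfl, rfl⟩ <;> simp [h1, h2, h3]
  · rintro (rfl | rfl | rfl | rfl)
    · exact Or.inr ⟨a, b, c, d, rfl, rfl⟩
    · exact Or.inr ⟨b, c, d, a, (quad_rotate _ _ _ _).symm, by rw [h1]⟩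
    · exact Or.inr ⟨c, d, a, b, quad_eq_iff.2 (by tauto), by rw [h2, h1]⟩
    · exact Or.inr ⟨d, a, b, c, quad_rotate _ _ _ _, by rw [h3, h2, h1]⟩

/-! ### Convex elements and their edges -/

theorem cross_comb (a b x y : Pt) {s t : ℝ} (h : s + t = 1) :
    cross a b (s • x + t • y) = s * cross a b x + t * cross a b y := by
  obtain rfl : s = 1 - t := by linarith
  simp [cross]; ring

theorem cross_swap (a b x : Pt) : cross b a x = -cross a b x := by
  simp [cross]; ring

@[simp] theorem cross_self_left (a b : Pt) : cross a b a = 0 := by simp [cross]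

@[simp] theorem cross_self_right (a b : Pt) : cross a b b = 0 := by simp [cross]; ring

theorem vertex_mem_hull {K : Elem} {v : Pt} (h : v ∈ K) : v ∈ hull K :=
  subset_convexHull ℝ _ h

theorem segment_subset_hull {K : Elem} {p q : Pt} (hp : p ∈ hull K) (hq : q ∈ hull K) :
    segment ℝ p q ⊆ hull K :=
  (convex_convexHull ℝ _).segment_subset hp hq

theorem hull_subset {K : Elem} {s : Set Pt} (hs : Convex ℝ s) (h : ∀ v ∈ K, v ∈ s) : hull K ⊆ s :=
  convexHull_min h hs

theorem convex_cross_nonneg (a b : Pt) : Convex ℝ {x | 0 ≤ cross a b x} := by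
  intro x hx y hy s t hs ht hst
  simp only [Set.mem_ofPred_eq] at *
  rw [cross_comb _ _ _ _ hst]
  positivity

theorem convex_cross_pos (a b : Pt) : Convex ℝ {x | 0 < cross a b x} := by
  intro x hx y hy s t hs ht hst
  simp only [Set.mem_ofPred_eq] at *
  rw [cross_comb _ _ _ _ hst]
  rcases hs.eq_or_lt with rfl | hs
  · obtain rfl : t = 1 := by linarith
    simpa using hy
  · have : 0 ≤ t * cross a b y := mul_nonneg ht hy.le
    nlinarith [mul_pos hs hx]

theorem cross_hull_nonneg {K : Elem} {a b x : Pt} (h : ∀ v ∈ K, 0 ≤ cross a b v)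
    (hx : x ∈ hull K) : 0 ≤ cross a b x :=
  hull_subset (convex_cross_nonneg a b) h hx

theorem cross_hull_pos {K : Elem} {a b x : Pt} (h : ∀ v ∈ K, 0 < cross a b v)
    (hx : x ∈ hull K) : 0 < cross a b x :=
  hull_subset (convex_cross_pos a b) h hx

theorem cross_segment {a b x : Pt} (hx : x ∈ segment ℝ a b) : cross a b x = 0 := by
  obtain ⟨s, t, hs, ht, hst, rfl⟩ := hx
  rw [cross_comb _ _ _ _ hst]; simp

/-- An element on one side of a line meets this line in the segment spanned by its vertices on the
line. -/
theorem mem_segment_of_cross_eq_zero {K : Elem} {a b p q x : Pt} (h : ∀ v ∈ K, 0 ≤ cross a b v)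
    (h0 : ∀ v ∈ K, cross a b v = 0 → v = p ∨ v = q) (hp : cross a b p = 0) (hq : cross a b q = 0)
    (hx : x ∈ hull K) (hx0 : cross a b x = 0) : x ∈ segment ℝ p q := by
  have hseg : ∀ y ∈ segment ℝ p q, cross a b y = 0 := by
    rintro y ⟨s, t, hs, ht, hst, rfl⟩
    rw [cross_comb _ _ _ _ hst]; simp [hp, hq]
  have hconv : Convex ℝ ({y | 0 < cross a b y} ∪ segment ℝ p q) := by
    intro y hy z hz s t hs ht hst
    have key : ∀ y z : Pt, ∀ s t : ℝ, 0 ≤ s → 0 ≤ t → s + t = 1 → 0 < cross a b y →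
        (0 ≤ cross a b z) → z ∈ ({y | 0 < cross a b y} ∪ segment ℝ p q) →
        s • y + t • z ∈ ({y | 0 < cross a b y} ∪ segment ℝ p q) := by
      intro y z s t hs ht hst hy hz hz'
      rcases hs.eq_or_lt with rfl | hs
      · obtain rfl : t = 1 := by linarith
        simpa using hz'
      · left
        simp only [Set.mem_ofPred_eq]
        rw [cross_comb _ _ _ _ hst]
        have := mul_pos hs hy
        have := mul_nonneg ht hz
        linarith
    have nn : ∀ y ∈ ({y | 0 < cross a b y} ∪ segment ℝ p q), 0 ≤ cross a b y := by
      rintro y (hy | hy)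
      · exact le_of_lt hy
      · rw [hseg y hy]
    rcases id hy with hy' | hy'
    · exact key y z s t hs ht hst hy' (nn z hz) hz
    · rcases id hz with hz' | hz'
      · rw [add_comm]
        exact key z y t s ht hs (by linarith) hz' (nn y hy) hy
      · exact Or.inr (convex_segment p q hy' hz' hs ht hst)
  have : x ∈ ({y | 0 < cross a b y} ∪ segment ℝ p q) := by
    refine hull_subset hconv (fun v hv => ?_) hx
    rcases (h v hv).eq_or_lt with h1 | h1
    · rcases h0 v hv h1.symm with rfl | rfl
      · exact Or.inr (left_mem_segment ℝ _ _)
      · exact Or.inr (right_mem_segment ℝ _ _)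
    · exact Or.inl h1
  rcases this with h1 | h1
  · exact absurd hx0 (ne_of_gt h1)
  · exact h1

/-- A strictly convex polygon, described by its sides: all other vertices lie strictly to the left
of a side. -/
structure IsConvexElem (K : Elem) : Prop where
  side_ne : ∀ {a b}, HasSide K a b → a ≠ b
  side_pos : ∀ {a b}, HasSide K a b → ∀ v ∈ K, v ≠ a → v ≠ b → 0 < cross a b v
  exists_side : ∀ {a}, a ∈ K → ∃ b, HasSide K a b
  exists_third : ∀ {a b}, HasSide K a b → ∃ v ∈ K, v ≠ a ∧ v ≠ b
  exists_mem : ∃ v, v ∈ K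

theorem ne_of_cross_pos {a b c : Pt} (h : 0 < cross a b c) : a ≠ b ∧ b ≠ c ∧ c ≠ a := by
  refine ⟨?_, ?_, ?_⟩ <;> rintro rfl <;> simp [cross] at h
  linarith

theorem IsTriangle.convex {K : Elem} (h : IsTriangle K) : IsConvexElem K := by
  obtain ⟨a, b, c, rfl, h⟩ := h
  obtain ⟨h1, h2, h3⟩ := ne_of_cross_pos h
  have e1 : cross b c a = cross a b c := by simp [cross]; ring
  have e2 : cross c a b = cross a b c := by simp [cross]; ring
  refine ⟨?_, ?_, ?_, ?_, a, by simp⟩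
  · intro p q hs
    rcases hasSide_tri.1 hs with ⟨rfl, rfl⟩ | ⟨rfl, rfl⟩ | ⟨rfl, rfl⟩ <;> assumption
  · intro p q hs v hv hvp hvq
    rcases hasSide_tri.1 hs with ⟨rfl, rfl⟩ | ⟨rfl, rfl⟩ | ⟨rfl, rfl⟩ <;>
      rcases mem_tri.1 hv with rfl | rfl | rfl <;> first
        | exact absurd rfl hvp
        | exact absurd rfl hvq
        | linarith
  · intro p hp
    rcases mem_tri.1 hp with rfl | rfl | rfl
    · exact ⟨b, hasSide_tri.2 (by tauto)⟩
    · exact ⟨c, hasSide_tri.2 (by tauto)⟩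
    · exact ⟨a, hasSide_tri.2 (by tauto)⟩
  · intro p q hs
    rcases hasSide_tri.1 hs with ⟨rfl, rfl⟩ | ⟨rfl, rfl⟩ | ⟨rfl, rfl⟩
    · exact ⟨c, by simp, h3, h2.symm⟩
    · exact ⟨a, by simp, h1, h3.symm⟩
    · exact ⟨b, by simp, h2, h1.symm⟩

theorem IsQuad.convex {K : Elem} (h : IsQuad K) : IsConvexElem K := by
  obtain ⟨a, b, c, d, rfl, ha, hb, hc, hd⟩ := h
  obtain ⟨h1, h2, h3⟩ := ne_of_cross_pos ha
  obtain ⟨h4, h5, h6⟩ := ne_of_cross_pos hb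
  obtain ⟨h7, h8, h9⟩ := ne_of_cross_pos hc
  have e1 : cross a b d = cross d a b := by simp [cross]; ring
  have e2 : cross b c a = cross a b c := by simp [cross]; ring
  have e3 : cross c d b = cross b c d := by simp [cross]; ring
  have e4 : cross d a c = cross c d a := by simp [cross]; ring
  refine ⟨?_, ?_, ?_, ?_, a, by simp⟩
  · intro p q hs
    rcases hasSide_quad.1 hs with ⟨rfl, rfl⟩ | ⟨rfl, rfl⟩ | ⟨rfl, rfl⟩ | ⟨rfl, rfl⟩ <;> assumption
  · intro p q hs v hv hvp hvq
    rcases hasSide_quad.1 hs with ⟨rfl, rfl⟩ | ⟨rfl, rfl⟩ | ⟨rfl, rfl⟩ | ⟨rfl, rfl⟩ <;>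
      rcases mem_quad.1 hv with rfl | rfl | rfl | rfl <;> first
        | exact absurd rfl hvp
        | exact absurd rfl hvq
        | linarith
  · intro p hp
    rcases mem_quad.1 hp with rfl | rfl | rfl | rfl
    · exact ⟨b, hasSide_quad.2 (by tauto)⟩
    · exact ⟨c, hasSide_quad.2 (by tauto)⟩
    · exact ⟨d, hasSide_quad.2 (by tauto)⟩
    · exact ⟨a, hasSide_quad.2 (by tauto)⟩
  · intro p q hs
    rcases hasSide_quad.1 hs with ⟨rfl, rfl⟩ | ⟨rfl, rfl⟩ | ⟨rfl, rfl⟩ | ⟨rfl, rfl⟩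
    · exact ⟨c, by simp, h3, h2.symm⟩
    · exact ⟨a, by simp, h1, h3.symm⟩
    · exact ⟨b, by simp, h4, h6.symm⟩
    · exact ⟨c, by simp, h7, h9.symm⟩

namespace IsConvexElem

variable {K : Elem}

theorem side_nonneg (hK : IsConvexElem K) {a b : Pt} (h : HasSide K a b) {v : Pt} (hv : v ∈ K) :
    0 ≤ cross a b v := by
  by_cases h1 : v = a
  · simp [h1]
  by_cases h2 : v = b
  · simp [h2]
  exact (hK.side_pos h v hv h1 h2).le

theorem side_zero (hK : IsConvexElem K) {a b : Pt} (h : HasSide K a b) {v : Pt} (hv : v ∈ K)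
    (h0 : cross a b v = 0) : v = a ∨ v = b := by
  by_contra! h1
  exact absurd h0 (hK.side_pos h v hv h1.1 h1.2).ne'

theorem side_hull_nonneg (hK : IsConvexElem K) {a b : Pt} (h : HasSide K a b) {x : Pt}
    (hx : x ∈ hull K) : 0 ≤ cross a b x :=
  cross_hull_nonneg (fun _ hv => hK.side_nonneg h hv) hx

theorem edge_ne (hK : IsConvexElem K) {a b : Pt} (h : HasEdge K a b) : a ≠ b :=
  h.elim (fun h => hK.side_ne h) (fun h => (hK.side_ne h).symm)

theorem exists_edge (hK : IsConvexElem K) {a : Pt} (h : a ∈ K) : ∃ b, HasEdge K a b :=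
  (hK.exists_side h).imp fun _ => Or.inl

end IsConvexElem

theorem ne_of_mem_openSegment {a b x : Pt} (hab : a ≠ b) (hx : x ∈ openSegment ℝ a b) :
    x ≠ a ∧ x ≠ b := by
  constructor
  · rintro rfl; exact hab (left_mem_openSegment_iff.1 hx)
  · rintro rfl; exact hab (right_mem_openSegment_iff.1 hx)

theorem mem_openSegment_of_ne {a b x : Pt} (hx : x ∈ segment ℝ a b) (ha : x ≠ a) (hb : x ≠ b) :
    x ∈ openSegment ℝ a b :=
  mem_openSegment_of_ne_left_right ha.symm hb.symm hx

namespace IsConvexElem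

variable {K : Elem}

/-- A vertex of a convex element is not an inner point of one of its edges. -/
theorem openEdge_not_mem (hK : IsConvexElem K) {a b x : Pt} (h : HasEdge K a b)
    (hx : x ∈ openSegment ℝ a b) : x ∉ K := by
  obtain ⟨ha, hb⟩ := ne_of_mem_openSegment (hK.edge_ne h) hx
  intro hxK
  have h0 := cross_segment (openSegment_subset_segment ℝ a b hx)
  rcases h with h | h
  · exact absurd h0 (hK.side_pos h x hxK ha hb).ne'
  · have := hK.side_pos h x hxK hb ha
    rw [cross_swap] at this
    linarith

/-- Two edges of a convex element that share an inner point of one of them are the same. -/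
theorem edge_unique (hK : IsConvexElem K) {a b a' b' x : Pt} (h : HasEdge K a b)
    (h' : HasEdge K a' b') (hx : x ∈ openSegment ℝ a b) (hx' : x ∈ segment ℝ a' b') :
    (a' = a ∧ b' = b) ∨ (a' = b ∧ b' = a) := by
  wlog hs : HasSide K a b generalizing a b
  · have := this h.symm (by rwa [openSegment_symm]) (h.resolve_left hs)
    tauto
  obtain ⟨hxa, hxb⟩ := ne_of_mem_openSegment (hK.edge_ne h) hx
  have h0 := cross_segment (openSegment_subset_segment ℝ a b hx)
  obtain ⟨s, t, hs0, ht0, hst, rfl⟩ := hx'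
  rw [cross_comb _ _ _ _ hst] at h0
  have h1 := mul_nonneg hs0 (hK.side_nonneg hs h'.left_mem)
  have h2 := mul_nonneg ht0 (hK.side_nonneg hs h'.right_mem)
  have h3 : s * cross a b a' = 0 := by linarith
  have h4 : t * cross a b b' = 0 := by linarith
  have ha' : a' = a ∨ a' = b := by
    rcases mul_eq_zero.1 h3 with rfl | h3
    · obtain rfl : t = 1 := by linarith
      exfalso
      rcases hK.side_zero hs h'.right_mem (by simpa using h4) with rfl | rfl
      · exact hxa (by simp)
      · exact hxb (by simp)
    · exact hK.side_zero hs h'.left_mem h3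
  have hb' : b' = a ∨ b' = b := by
    rcases mul_eq_zero.1 h4 with rfl | h4
    · obtain rfl : s = 1 := by linarith
      exfalso
      rcases hK.side_zero hs h'.left_mem (by simpa using h3) with rfl | rfl
      · exact hxa (by simp)
      · exact hxb (by simp)
    · exact hK.side_zero hs h'.right_mem h4
  have := hK.edge_ne h'
  rcases ha' with rfl | rfl <;> rcases hb' with rfl | rfl <;> tauto

/-- A convex element is not contained in a segment. -/
theorem not_hull_subset_segment (hK : IsConvexElem K) (p q : Pt) : ¬ hull K ⊆ segment ℝ p q := by
  intro hsub
  obtain ⟨a, ha⟩ := hK.exists_mem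
  obtain ⟨b, hab⟩ := hK.exists_side ha
  obtain ⟨c, hc, hca, hcb⟩ := hK.exists_third hab
  have hpos := hK.side_pos hab c hc hca hcb
  obtain ⟨s, t, -, -, hst, ea⟩ := hsub (vertex_mem_hull ha)
  obtain ⟨s', t', -, -, hst', eb⟩ := hsub (vertex_mem_hull hab.right_mem)
  obtain ⟨s'', t'', -, -, hst'', ec⟩ := hsub (vertex_mem_hull hc)
  have : cross a b c = 0 := by
    obtain rfl : s = 1 - t := by linarith
    obtain rfl : s' = 1 - t' := by linarith
    obtain rfl : s'' = 1 - t'' := by linarith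
    rw [← ea, ← eb, ← ec]
    simp [cross]; ring
  linarith

theorem hull_nonempty (hK : IsConvexElem K) : (hull K).Nonempty := by
  obtain ⟨a, ha⟩ := hK.exists_mem
  exact ⟨a, vertex_mem_hull ha⟩

/-- From a point of an edge one leaves a convex element at once in the direction of the outer
normal. -/
theorem exists_outside (hK : IsConvexElem K) {a b x : Pt} (h : HasEdge K a b)
    (hx : x ∈ segment ℝ a b) : ∃ u : Pt, ∀ t : ℝ, 0 < t → x + t • u ∉ hull K := by
  wlog hs : HasSide K a b generalizing a b
  · exact this h.symm (by rwa [segment_symm]) (h.resolve_left hs)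
  -- the outer normal of the side `a b`
  refine ⟨(b.2 - a.2, a.1 - b.1), fun t ht hmem => ?_⟩
  have h1 := hK.side_hull_nonneg hs hmem
  have h0 := cross_segment hx
  have hne := hK.edge_ne h
  have e : cross a b (x + t • (b.2 - a.2, a.1 - b.1)) =
      cross a b x - t * ((b.1 - a.1) ^ 2 + (b.2 - a.2) ^ 2) := by
    simp [cross]; ring
  rw [e, h0] at h1
  have hp : 0 < (b.1 - a.1) ^ 2 + (b.2 - a.2) ^ 2 := by
    by_contra! hle
    have h2 : b.1 - a.1 = 0 := by nlinarith [sq_nonneg (b.1 - a.1), sq_nonneg (b.2 - a.2)]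
    have h3 : b.2 - a.2 = 0 := by nlinarith [sq_nonneg (b.1 - a.1), sq_nonneg (b.2 - a.2)]
    exact hne (Prod.ext (by linarith) (by linarith))
  nlinarith [mul_pos ht hp]

end IsConvexElem

theorem finite_vertices (K : Elem) : {v | v ∈ K}.Finite := by
  induction K using Cycle.induction_on with
  | nil => simp
  | cons a l _ => simpa using (List.finite_toSet (a :: l))

theorem isClosed_hull (K : Elem) : IsClosed (hull K) :=
  ((finite_vertices K).isCompact_convexHull (𝕜 := ℝ)).isClosed

/-! ### Red refinement of conforming families -/

/-- Two elements are disjoint, or meet in a common vertex, or meet in a common edge. -/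
def Fits (K L : Elem) : Prop :=
  hull K ∩ hull L = ∅ ∨
    (∃ v : Pt, v ∈ K ∧ v ∈ L ∧ hull K ∩ hull L = {v}) ∨
    (∃ a b : Pt, HasEdge K a b ∧ HasEdge L a b ∧ hull K ∩ hull L = segment ℝ a b)

theorem Fits.symm {K L : Elem} (h : Fits K L) : Fits L K := by
  rw [Fits, Set.inter_comm]
  rcases h with h | ⟨v, h1, h2, h⟩ | ⟨a, b, h1, h2, h⟩
  · exact Or.inl h
  · exact Or.inr (Or.inl ⟨v, h2, h1, h⟩)
  · exact Or.inr (Or.inr ⟨a, b, h2, h1, h⟩)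

/-- The facts about triangles and quadrilaterals and their red refinements on which the coarsening
theorem rests. The field `face` describes how a child meets an edge of its parent. -/
structure RedShape (shape : Elem → Prop) : Prop where
  convex : ∀ {K}, shape K → IsConvexElem K
  child : ∀ {P K}, shape P → K ∈ redChildren P → shape K
  hull_child : ∀ {P K}, shape P → K ∈ redChildren P → hull K ⊆ hull P
  vertex_child : ∀ {P v}, shape P → v ∈ P → ∃ K ∈ redChildren P, v ∈ K
  exists_midpoint : ∀ {P K}, shape P → K ∈ redChildren P →
    ∃ a b, HasEdge P a b ∧ midpoint ℝ a b ∈ K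
  midpoint_child : ∀ {P a b}, shape P → HasEdge P a b → ∃ K ∈ redChildren P, midpoint ℝ a b ∈ K
  face : ∀ {P K a b}, shape P → HasEdge P a b → K ∈ redChildren P →
    hull K ∩ segment ℝ a b = ∅ ∨
    (midpoint ℝ a b ∈ K ∧ hull K ∩ segment ℝ a b = {midpoint ℝ a b}) ∨
    (HasEdge K a (midpoint ℝ a b) ∧ hull K ∩ segment ℝ a b = segment ℝ a (midpoint ℝ a b)) ∨
    (HasEdge K (midpoint ℝ a b) b ∧ hull K ∩ segment ℝ a b = segment ℝ (midpoint ℝ a b) b)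
  fits : ∀ {P K L}, shape P → K ∈ redChildren P → L ∈ redChildren P → K ≠ L → Fits K L
  finite_children : ∀ {P}, shape P → (redChildren P).Finite
  injective : ∀ {P P'}, shape P → redChildren P' = redChildren P → P' = P

theorem midpoint_mem_openSegment {a b : Pt} : midpoint ℝ a b ∈ openSegment ℝ a b := by
  refine ⟨1 / 2, 1 / 2, by norm_num, by norm_num, by norm_num, ?_⟩
  ext <;> simp <;> ring

theorem midpoint_segment_inter {a b : Pt} (hab : a ≠ b) :
    segment ℝ a (midpoint ℝ a b) ∩ segment ℝ (midpoint ℝ a b) b = {midpoint ℝ a b} := by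
  ext x
  simp only [Set.mem_inter_iff, Set.mem_singleton_iff]
  constructor
  · rintro ⟨⟨s, t, hs, ht, hst, rfl⟩, ⟨s', t', hs', ht', hst', h⟩⟩
    obtain rfl : s = 1 - t := by linarith
    obtain rfl : t' = 1 - s' := by linarith
    have hc : (1 - t) + (1 - s') = 0 := by
      by_contra hne
      apply hab
      have h1 := congrArg Prod.fst h
      have h2 := congrArg Prod.snd h
      simp at h1 h2
      have e1 : ((1 - t) + (1 - s')) * (a.1 - b.1) = 0 := by linarith
      have e2 : ((1 - t) + (1 - s')) * (a.2 - b.2) = 0 := by linarith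
      ext
      · linarith [(mul_eq_zero.1 e1).resolve_left hne]
      · linarith [(mul_eq_zero.1 e2).resolve_left hne]
    obtain rfl : t = 1 := by linarith
    simp
  · rintro rfl
    exact ⟨right_mem_segment ℝ _ _, left_mem_segment ℝ _ _⟩

theorem left_notMem_midpoint_segment {a b : Pt} (hab : a ≠ b) :
    a ∉ segment ℝ (midpoint ℝ a b) b := by
  intro h
  have : a ∈ segment ℝ a (midpoint ℝ a b) ∩ segment ℝ (midpoint ℝ a b) b :=
    ⟨left_mem_segment ℝ _ _, h⟩
  rw [midpoint_segment_inter hab] at this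
  have h2 := ne_of_mem_openSegment hab (midpoint_mem_openSegment (a := a) (b := b))
  exact h2.1 this.symm

namespace RedShape

variable {shape : Elem → Prop}

/-- A vertex of the parent that lies in a child is a vertex of this child. -/
theorem vertex_of_mem_hull (hs : RedShape shape) {P K : Elem} (hP : shape P)
    (hK : K ∈ redChildren P) {v : Pt} (hv : v ∈ P) (hvK : v ∈ hull K) : v ∈ K := by
  obtain ⟨b, hb⟩ := (hs.convex hP).exists_edge hv
  have hne := (hs.convex hP).edge_ne hb
  have hmem : v ∈ hull K ∩ segment ℝ v b := ⟨hvK, left_mem_segment ℝ _ _⟩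
  have h2 := ne_of_mem_openSegment hne (midpoint_mem_openSegment (a := v) (b := b))
  rcases hs.face hP hb hK with h | ⟨-, h⟩ | ⟨h', -⟩ | ⟨-, h⟩
  · rw [h] at hmem; exact absurd hmem (Set.notMem_empty _)
  · rw [h] at hmem; exact absurd hmem.symm h2.1
  · exact h'.left_mem
  · rw [h] at hmem; exact absurd hmem (left_notMem_midpoint_segment hne)

/-- Uniform red refinement of a conforming family yields a conforming family. -/
theorem fits_children (hs : RedShape shape) {E : Set Elem} (hE : ∀ P ∈ E, shape P)
    (hfit : ∀ K ∈ E, ∀ L ∈ E, K ≠ L → Fits K L) :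
    ∀ K ∈ ⋃ P ∈ E, redChildren P, ∀ L ∈ ⋃ P ∈ E, redChildren P, K ≠ L → Fits K L := by
  intro K hK L hL hne
  simp only [Set.mem_iUnion] at hK hL
  obtain ⟨P, hP, hK⟩ := hK
  obtain ⟨P', hP', hL⟩ := hL
  have sP := hE P hP
  have sP' := hE P' hP'
  by_cases hPP : P = P'
  · subst hPP
    exact hs.fits sP hK hL hne
  have hsub : hull K ∩ hull L ⊆ hull P ∩ hull P' :=
    Set.inter_subset_inter (hs.hull_child sP hK) (hs.hull_child sP' hL)
  rcases hfit P hP P' hP' hPP with h | ⟨v, hv, hv', h⟩ | ⟨a, b, h1, h2, h⟩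
  · left
    rw [h] at hsub
    exact Set.subset_empty_iff.1 hsub
  · rw [h] at hsub
    rcases Set.subset_singleton_iff_eq.1 hsub with h' | h'
    · exact Or.inl h'
    · have : v ∈ hull K ∩ hull L := by rw [h']; rfl
      exact Or.inr (Or.inl ⟨v, hs.vertex_of_mem_hull sP hK hv this.1,
        hs.vertex_of_mem_hull sP' hL hv' this.2, h'⟩)
  · have hab := (hs.convex sP).edge_ne h1
    set m := midpoint ℝ a b with hm
    have e : hull K ∩ hull L = (hull K ∩ segment ℝ a b) ∩ (hull L ∩ segment ℝ a b) := by
      ext x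
      constructor
      · intro hx
        have := hsub hx
        rw [h] at this
        exact ⟨⟨hx.1, this⟩, hx.2, this⟩
      · rintro ⟨hx, hx'⟩
        exact ⟨hx.1, hx'.1⟩
    have i1 := midpoint_segment_inter hab
    rw [← hm] at i1
    have m1 : m ∈ segment ℝ a m := right_mem_segment ℝ _ _
    have m2 : m ∈ segment ℝ m b := left_mem_segment ℝ _ _
    have point : m ∈ K → m ∈ L → hull K ∩ hull L = {m} → Fits K L :=
      fun p q r => Or.inr (Or.inl ⟨m, p, q, r⟩)
    rcases hs.face sP h1 hK with hk | ⟨k1, hk⟩ | ⟨k1, hk⟩ | ⟨k1, hk⟩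
    · left; rw [e, hk, Set.empty_inter]
    all_goals
      rcases hs.face sP' h2 hL with hl | ⟨l1, hl⟩ | ⟨l1, hl⟩ | ⟨l1, hl⟩
      · left; rw [e, hl, Set.inter_empty]
      all_goals rw [← hm] at hk hl k1 l1; rw [hk, hl] at e
    · exact point k1 l1 (by rw [e, Set.inter_self])
    · exact point k1 l1.right_mem (by rw [e, Set.inter_eq_left]; simpa using m1)
    · exact point k1 l1.left_mem (by rw [e, Set.inter_eq_left]; simpa using m2)
    · exact point k1.right_mem l1 (by rw [e, Set.inter_eq_right]; simpa using m1)
    · exact Or.inr (Or.inr ⟨a, m, k1, l1, by rw [e, Set.inter_self]⟩)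
    · exact point k1.right_mem l1.left_mem (by rw [e, i1])
    · exact point k1.left_mem l1 (by rw [e, Set.inter_eq_right]; simpa using m2)
    · exact point k1.left_mem l1.right_mem (by rw [e, Set.inter_comm, i1])
    · exact Or.inr (Or.inr ⟨m, b, k1, l1, by rw [e, Set.inter_self]⟩)

end RedShape

/-! ### Elements on one or both sides of a line -/

theorem hull_inter_segment {K : Elem} {a b p q : Pt} (h : ∀ v ∈ K, 0 ≤ cross a b v)
    (h0 : ∀ v ∈ K, cross a b v = 0 → v = p ∨ v = q) (hp : p ∈ K) (hq : q ∈ K)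
    (hp' : p ∈ segment ℝ a b) (hq' : q ∈ segment ℝ a b) :
    hull K ∩ segment ℝ a b = segment ℝ p q := by
  apply Set.Subset.antisymm
  · rintro x ⟨hx, hx'⟩
    exact mem_segment_of_cross_eq_zero h h0 (cross_segment hp') (cross_segment hq') hx
      (cross_segment hx')
  · exact Set.subset_inter (segment_subset_hull (vertex_mem_hull hp) (vertex_mem_hull hq))
      ((convex_segment a b).segment_subset hp' hq')

theorem hull_inter_segment_empty {K : Elem} {a b : Pt} (h : ∀ v ∈ K, 0 < cross a b v) :
    hull K ∩ segment ℝ a b = ∅ := by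
  ext x
  simp only [Set.mem_inter_iff, Set.mem_empty_iff_false, iff_false, not_and]
  intro hx hx'
  exact absurd (cross_segment hx') (cross_hull_pos h hx).ne'

theorem fits_of_edge {K L : Elem} {p q : Pt} (hK : HasEdge K p q) (hL : HasEdge L p q)
    (h : ∀ v ∈ K, 0 ≤ cross p q v) (h' : ∀ v ∈ L, cross p q v ≤ 0)
    (h0 : ∀ v ∈ K, cross p q v = 0 → v = p ∨ v = q) : Fits K L := by
  refine Or.inr (Or.inr ⟨p, q, hK, hL, ?_⟩)
  apply Set.Subset.antisymm
  · rintro x ⟨hx, hx'⟩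
    have h1 := cross_hull_nonneg h hx
    have h2 : 0 ≤ cross q p x :=
      cross_hull_nonneg (fun v hv => by rw [cross_swap]; linarith [h' v hv]) hx'
    rw [cross_swap] at h2
    exact mem_segment_of_cross_eq_zero h h0 (by simp) (by simp) hx (by linarith)
  · exact Set.subset_inter
      (segment_subset_hull (vertex_mem_hull hK.left_mem) (vertex_mem_hull hK.right_mem))
      (segment_subset_hull (vertex_mem_hull hL.left_mem) (vertex_mem_hull hL.right_mem))

theorem fits_of_vertex {K L : Elem} {a b p : Pt} (hK : p ∈ K) (hL : p ∈ L)
    (hp : cross a b p = 0)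
    (h : ∀ v ∈ K, 0 ≤ cross a b v) (h' : ∀ v ∈ L, cross a b v ≤ 0)
    (h0 : ∀ v ∈ K, cross a b v = 0 → v = p) : Fits K L := by
  refine Or.inr (Or.inl ⟨p, hK, hL, ?_⟩)
  apply Set.Subset.antisymm
  · rintro x ⟨hx, hx'⟩
    have h1 := cross_hull_nonneg h hx
    have h2 : 0 ≤ cross b a x :=
      cross_hull_nonneg (fun v hv => by rw [cross_swap]; linarith [h' v hv]) hx'
    rw [cross_swap] at h2
    have := mem_segment_of_cross_eq_zero h (fun v hv hv0 => Or.inl (h0 v hv hv0)) hp hp hx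
      (by linarith : cross a b x = 0)
    simpa using this
  · rintro x rfl
    exact ⟨vertex_mem_hull hK, vertex_mem_hull hL⟩

theorem cross_midpoint (a b x y : Pt) :
    cross a b (midpoint ℝ x y) = (cross a b x + cross a b y) / 2 := by
  simp [cross]; ring

theorem cross_quadCenter (a b x y z w : Pt) : cross a b (quadCenter x y z w) =
    (cross a b x + cross a b y + cross a b z + cross a b w) / 4 := by
  simp [quadCenter, cross_midpoint]; ring

theorem midpoint_mem_hull {K : Elem} {p q : Pt} (hp : p ∈ hull K) (hq : q ∈ hull K) :
    midpoint ℝ p q ∈ hull K :=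
  segment_subset_hull hp hq (openSegment_subset_segment ℝ _ _ midpoint_mem_openSegment)

/-! ### An element is determined by its hull and its orientation -/

/-- The vertices of a convex element are extreme points of its hull. -/
theorem IsConvexElem.mem_extremePoints {K : Elem} (hK : IsConvexElem K) {v : Pt} (hv : v ∈ K) :
    v ∈ (hull K).extremePoints ℝ := by
  obtain ⟨b, hb⟩ := hK.exists_side hv
  have hne := hK.side_ne hb
  rw [_root_.mem_extremePoints]
  refine ⟨vertex_mem_hull hv, fun x hx y hy hxy => ?_⟩
  obtain ⟨s, t, hs, ht, hst, e⟩ := hxy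
  have hx0 := hK.side_hull_nonneg hb hx
  have hy0 := hK.side_hull_nonneg hb hy
  have h0 : s * cross v b x + t * cross v b y = 0 := by
    rw [← cross_comb _ _ _ _ hst, e]; simp
  have h1 : s * cross v b x = 0 := by
    linarith [mul_nonneg hs.le hx0, mul_nonneg ht.le hy0]
  have h2 : t * cross v b y = 0 := by
    linarith [mul_nonneg hs.le hx0, mul_nonneg ht.le hy0]
  have h3 := (mul_eq_zero.1 h1).resolve_left hs.ne'
  have h4 := (mul_eq_zero.1 h2).resolve_left ht.ne'
  have face : ∀ u ∈ hull K, cross v b u = 0 → u ∈ segment ℝ v b := fun u hu hu0 =>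
    mem_segment_of_cross_eq_zero (fun w hw => hK.side_nonneg hb hw)
      (fun w hw => hK.side_zero hb hw) (by simp) (by simp) hu hu0
  obtain ⟨p, q, hp, hq, hpq, rfl⟩ := face x hx h3
  obtain ⟨p', q', hp', hq', hpq', rfl⟩ := face y hy h4
  obtain rfl : p = 1 - q := by linarith
  obtain rfl : p' = 1 - q' := by linarith
  obtain rfl : s = 1 - t := by linarith
  have hz : (1 - t) * q + t * q' = 0 := by
    by_contra hc
    apply hne
    have e1 := congrArg Prod.fst e
    have e2 := congrArg Prod.snd e
    simp at e1 e2
    have e3 : ((1 - t) * q + t * q') * (v.1 - b.1) = 0 := by linarith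
    have e4 : ((1 - t) * q + t * q') * (v.2 - b.2) = 0 := by linarith
    ext
    · linarith [(mul_eq_zero.1 e3).resolve_left hc]
    · linarith [(mul_eq_zero.1 e4).resolve_left hc]
  have g1 := mul_nonneg hs.le hq
  have g2 := mul_nonneg ht.le hq'
  have hq0 := (mul_eq_zero.1 (by linarith : (1 - t) * q = 0)).resolve_left hs.ne'
  have hq0' := (mul_eq_zero.1 (by linarith : t * q' = 0)).resolve_left ht.ne'
  subst hq0 hq0'
  simp

theorem IsConvexElem.mem_of_hull {K L : Elem} (hK : IsConvexElem K)
    (h1 : ∀ v ∈ L, v ∈ hull K) (h2 : ∀ v ∈ K, v ∈ hull L) {v : Pt} (hv : v ∈ K) : v ∈ L := by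
  have e : hull K = hull L := Set.Subset.antisymm (hull_subset (convex_convexHull ℝ _) h2)
    (hull_subset (convex_convexHull ℝ _) h1)
  have := hK.mem_extremePoints hv
  rw [e, hull] at this
  exact extremePoints_convexHull_subset (A := {v | v ∈ L}) this

theorem isTriangle_tri {a b c : Pt} : IsTriangle (tri a b c) ↔ 0 < cross a b c := by
  refine ⟨?_, fun h => ⟨a, b, c, rfl, h⟩⟩
  rintro ⟨x, y, z, h, h'⟩
  rcases tri_eq_iff.1 h with ⟨rfl, rfl, rfl⟩ | ⟨rfl, rfl, rfl⟩ | ⟨rfl, rfl, rfl⟩ <;>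
    simp only [cross] at * <;> linarith

theorem isQuad_quad {a b c d : Pt} : IsQuad (quad a b c d) ↔
    0 < cross a b c ∧ 0 < cross b c d ∧ 0 < cross c d a ∧ 0 < cross d a b := by
  refine ⟨?_, fun h => ⟨a, b, c, d, rfl, h⟩⟩
  rintro ⟨x, y, z, w, h, h'⟩
  rcases quad_eq_iff.1 h with ⟨rfl, rfl, rfl, rfl⟩ | ⟨rfl, rfl, rfl, rfl⟩ | ⟨rfl, rfl, rfl, rfl⟩ |
    ⟨rfl, rfl, rfl, rfl⟩ <;> tauto

theorem tri_eq_of_hull {a b c x y z : Pt} (h : 0 < cross a b c) (h' : 0 < cross x y z)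
    (h1 : ∀ v ∈ tri x y z, v ∈ hull (tri a b c)) (h2 : ∀ v ∈ tri a b c, v ∈ hull (tri x y z)) :
    tri x y z = tri a b c := by
  have hK := (isTriangle_tri.2 h).convex
  have ha := mem_tri.1 (hK.mem_of_hull h1 h2 (v := a) (by simp))
  have hb := mem_tri.1 (hK.mem_of_hull h1 h2 (v := b) (by simp))
  have hc := mem_tri.1 (hK.mem_of_hull h1 h2 (v := c) (by simp))
  obtain ⟨n1, n2, n3⟩ := ne_of_cross_pos h
  rcases ha with rfl | rfl | rfl <;> rcases hb with rfl | rfl | rfl <;>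
    first
    | exact absurd rfl n1
    | rcases hc with rfl | rfl | rfl <;>
      first
      | exact absurd rfl n2
      | exact absurd rfl n3
      | (rw [tri_eq_iff]; simp; done)
      | (exfalso; simp only [cross] at h h'; linarith)

/-- A cyclic list of four points that has the same hull as a convex quadrilateral is equal to it as
soon as three of its angles have the right orientation. -/
theorem quad_eq_of_hull {a b c d x y z w : Pt} (h : IsQuad (quad a b c d))
    (g1 : 0 < cross x y z) (g2 : 0 < cross y z w ∨ 0 < cross y z w + cross z w x)
    (g3 : 0 < cross w x y)
    (h1 : ∀ v ∈ quad x y z w, v ∈ hull (quad a b c d))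
    (h2 : ∀ v ∈ quad a b c d, v ∈ hull (quad x y z w)) :
    quad x y z w = quad a b c d := by
  have hK := h.convex
  have ha := mem_quad.1 (hK.mem_of_hull h1 h2 (v := a) (by simp))
  have hb := mem_quad.1 (hK.mem_of_hull h1 h2 (v := b) (by simp))
  have hc := mem_quad.1 (hK.mem_of_hull h1 h2 (v := c) (by simp))
  have hd := mem_quad.1 (hK.mem_of_hull h1 h2 (v := d) (by simp))
  obtain ⟨k1, k2, k3, k4⟩ := isQuad_quad.1 h
  obtain ⟨n1, n2, n3⟩ := ne_of_cross_pos k1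
  obtain ⟨n4, n5, n6⟩ := ne_of_cross_pos k2
  obtain ⟨n7, n8, n9⟩ := ne_of_cross_pos k3
  clear h h1 h2 hK
  rcases ha with rfl | rfl | rfl | rfl <;> rcases hb with rfl | rfl | rfl | rfl <;>
    first
    | exact absurd rfl n1
    | rcases hc with rfl | rfl | rfl | rfl <;>
      first
      | exact absurd rfl n2
      | exact absurd rfl n3
      | rcases hd with rfl | rfl | rfl | rfl <;>
        first
        | exact absurd rfl n5
        | exact absurd rfl n6
        | exact absurd rfl n8
        | (rw [quad_eq_iff]; simp; done)
        | (exfalso; simp only [cross] at k1 k2 k3 k4 g1 g2 g3; rcases g2 with g2 | g2 <;> linarith)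

/-! ### Triangles -/

theorem IsTriangle.exists_of_side {K : Elem} (h : IsTriangle K) {a b : Pt} (hs : HasSide K a b) :
    ∃ c, K = tri a b c ∧ 0 < cross a b c := by
  obtain ⟨x, y, z, rfl, hp⟩ := h
  rcases hasSide_tri.1 hs with ⟨rfl, rfl⟩ | ⟨rfl, rfl⟩ | ⟨rfl, rfl⟩
  · exact ⟨z, rfl, hp⟩
  · exact ⟨x, (tri_rotate _ _ _).symm, by simp only [cross] at *; linarith⟩
  · exact ⟨y, tri_rotate _ _ _, by simp only [cross] at *; linarith⟩

theorem cross_rotate {a b c : Pt} : cross b c a = cross a b c := by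
  simp only [cross]; ring

theorem fits_tri_corners {a b c : Pt} (h : 0 < cross a b c) :
    Fits (tri a (midpoint ℝ a b) (midpoint ℝ c a)) (tri b (midpoint ℝ b c) (midpoint ℝ a b)) := by
  -- the line through the common vertex that is parallel to the edge `c a`
  have e : ∀ v, cross (midpoint ℝ a b) (midpoint ℝ a b + c - a) v =
      (c.1 - a.1) * (v.2 - (a.2 + b.2) / 2) - (c.2 - a.2) * (v.1 - (a.1 + b.1) / 2) := by
    intro v; simp [cross]; ring
  simp only [cross] at h
  refine fits_of_vertex (a := midpoint ℝ a b) (b := midpoint ℝ a b + c - a)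
    (p := midpoint ℝ a b) (by simp) (by simp) (by simp) ?_ ?_ ?_
  · intro v hv
    rw [e]
    rcases mem_tri.1 hv with rfl | rfl | rfl <;> simp <;> linarith
  · intro v hv
    rw [e]
    rcases mem_tri.1 hv with rfl | rfl | rfl <;> simp <;> linarith
  · intro v hv h0
    rw [e] at h0
    rcases mem_tri.1 hv with rfl | rfl | rfl
    · linarith
    · rfl
    · simp at h0; linarith

theorem fits_tri_middle {a b c : Pt} (h : 0 < cross a b c) :
    Fits (tri a (midpoint ℝ a b) (midpoint ℝ c a))
      (tri (midpoint ℝ a b) (midpoint ℝ b c) (midpoint ℝ c a)) := by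
  refine fits_of_edge (p := midpoint ℝ a b) (q := midpoint ℝ c a)
    (Or.inl (hasSide_tri.2 (by simp))) (Or.inr (hasSide_tri.2 (by simp))) ?_ ?_ ?_
  · intro v hv
    rcases mem_tri.1 hv with rfl | rfl | rfl <;> simp [cross] at * <;> linarith
  · intro v hv
    rcases mem_tri.1 hv with rfl | rfl | rfl <;> simp [cross] at * <;> linarith
  · intro v hv h0
    rcases mem_tri.1 hv with rfl | rfl | rfl
    · simp [cross] at *; linarith
    · exact Or.inl rfl
    · exact Or.inr rfl

theorem face_tri {a b c : Pt} (h : 0 < cross a b c) {K : Elem} (hK : K ∈ redChildren (tri a b c)) :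
    hull K ∩ segment ℝ a b = ∅ ∨
    (midpoint ℝ a b ∈ K ∧ hull K ∩ segment ℝ a b = {midpoint ℝ a b}) ∨
    (HasEdge K a (midpoint ℝ a b) ∧ hull K ∩ segment ℝ a b = segment ℝ a (midpoint ℝ a b)) ∨
    (HasEdge K (midpoint ℝ a b) b ∧ hull K ∩ segment ℝ a b = segment ℝ (midpoint ℝ a b) b) := by
  have hm : midpoint ℝ a b ∈ segment ℝ a b :=
    openSegment_subset_segment ℝ _ _ midpoint_mem_openSegment
  rw [redChildren_tri] at hK
  rcases hK with rfl | rfl | rfl | rfl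
  · refine Or.inr (Or.inr (Or.inl ⟨Or.inl (hasSide_tri.2 (by simp)), ?_⟩))
    refine hull_inter_segment ?_ ?_ (by simp) (by simp) (left_mem_segment ℝ _ _) hm
    · intro v hv
      rcases mem_tri.1 hv with rfl | rfl | rfl <;> simp [cross_midpoint]
      linarith
    · intro v hv h0
      rcases mem_tri.1 hv with rfl | rfl | rfl
      all_goals
        first
        | exact Or.inl rfl
        | exact Or.inr rfl
        | (simp [cross_midpoint] at h0; linarith)
  · refine Or.inr (Or.inr (Or.inr ⟨Or.inl (hasSide_tri.2 (by simp)), ?_⟩))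
    refine hull_inter_segment ?_ ?_ (by simp) (by simp) hm (right_mem_segment ℝ _ _)
    · intro v hv
      rcases mem_tri.1 hv with rfl | rfl | rfl <;> simp [cross_midpoint]
      linarith
    · intro v hv h0
      rcases mem_tri.1 hv with rfl | rfl | rfl
      all_goals
        first
        | exact Or.inl rfl
        | exact Or.inr rfl
        | (simp [cross_midpoint] at h0; linarith)
  · refine Or.inl (hull_inter_segment_empty ?_)
    intro v hv
    rcases mem_tri.1 hv with rfl | rfl | rfl <;> (try simp [cross_midpoint]) <;> linarith
  · refine Or.inr (Or.inl ⟨by simp, ?_⟩)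
    rw [hull_inter_segment (p := midpoint ℝ a b) (q := midpoint ℝ a b) ?_ ?_ (by simp) (by simp)
      hm hm]
    · simp
    · intro v hv
      rcases mem_tri.1 hv with rfl | rfl | rfl <;> simp [cross_midpoint] <;> linarith
    · intro v hv h0
      rcases mem_tri.1 hv with rfl | rfl | rfl
      · simp
      · simp [cross_midpoint] at *; linarith
      · simp [cross_midpoint] at *; linarith

theorem cross_pos_of_child_tri {a b c : Pt} (h : 0 < cross a b c) {K : Elem}
    (hK : K ∈ redChildren (tri a b c)) : IsTriangle K := by
  rw [redChildren_tri] at hK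
  rcases hK with rfl | rfl | rfl | rfl <;> rw [isTriangle_tri] <;> simp [cross] at * <;> linarith

theorem exists_tri_or_quad_of_mem_redChildren {P K : Elem} (h : K ∈ redChildren P) :
    (∃ a b c, P = tri a b c) ∨ (∃ a b c d, P = quad a b c d) := by
  rcases h with ⟨a, b, c, h, -⟩ | ⟨a, b, c, d, h, -⟩
  · exact Or.inl ⟨a, b, c, h⟩
  · exact Or.inr ⟨a, b, c, d, h⟩

theorem hull_child_tri {a b c : Pt} {K : Elem} (hK : K ∈ redChildren (tri a b c)) :
    hull K ⊆ hull (tri a b c) := by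
  have ha : a ∈ hull (tri a b c) := vertex_mem_hull (by simp)
  have hb : b ∈ hull (tri a b c) := vertex_mem_hull (by simp)
  have hc : c ∈ hull (tri a b c) := vertex_mem_hull (by simp)
  have h1 := midpoint_mem_hull ha hb
  have h2 := midpoint_mem_hull hb hc
  have h3 := midpoint_mem_hull hc ha
  rw [redChildren_tri] at hK
  refine hull_subset (convex_convexHull ℝ _) fun v hv => ?_
  rcases hK with rfl | rfl | rfl | rfl <;> rcases mem_tri.1 hv with rfl | rfl | rfl <;> assumption

theorem vertex_child_tri {a b c v : Pt} (hv : v ∈ tri a b c) :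
    ∃ K ∈ redChildren (tri a b c), v ∈ K := by
  rw [redChildren_tri]
  rcases mem_tri.1 hv with rfl | rfl | rfl
  · exact ⟨_, Or.inl rfl, by simp⟩
  · exact ⟨_, Or.inr (Or.inl rfl), by simp⟩
  · exact ⟨_, Or.inr (Or.inr (Or.inl rfl)), by simp⟩

theorem redShape_tri : RedShape IsTriangle where
  convex h := h.convex
  child := by
    rintro P K ⟨a, b, c, rfl, h⟩ hK
    exact cross_pos_of_child_tri h hK
  hull_child := by
    rintro P K ⟨a, b, c, rfl, -⟩ hK
    exact hull_child_tri hK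
  vertex_child := by
    rintro P v ⟨a, b, c, rfl, -⟩ hv
    exact vertex_child_tri hv
  exists_midpoint := by
    rintro P K ⟨a, b, c, rfl, -⟩ hK
    rw [redChildren_tri] at hK
    have e1 : HasEdge (tri a b c) a b := Or.inl (hasSide_tri.2 (by simp))
    have e2 : HasEdge (tri a b c) b c := Or.inl (hasSide_tri.2 (by simp))
    rcases hK with rfl | rfl | rfl | rfl
    · exact ⟨a, b, e1, by simp⟩
    · exact ⟨a, b, e1, by simp⟩
    · exact ⟨b, c, e2, by simp⟩
    · exact ⟨a, b, e1, by simp⟩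
  midpoint_child := by
    rintro P a b hP hab
    wlog hs : HasSide P a b generalizing a b
    · rw [midpoint_comm]; exact this hab.symm (hab.resolve_left hs)
    obtain ⟨c, rfl, -⟩ := hP.exists_of_side hs
    exact ⟨_, by rw [redChildren_tri]; exact Or.inl rfl, by simp⟩
  face := by
    intro P K a b hP hab hK
    rcases hab with hs | hs
    · obtain ⟨c, rfl, h⟩ := hP.exists_of_side hs
      exact face_tri h hK
    · obtain ⟨c, rfl, h⟩ := hP.exists_of_side hs
      rw [midpoint_comm, segment_symm ℝ a b]
      rcases face_tri h hK with h | h | ⟨h, h'⟩ | ⟨h, h'⟩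
      · exact Or.inl h
      · exact Or.inr (Or.inl h)
      · refine Or.inr (Or.inr (Or.inr ⟨h.symm, ?_⟩))
        rw [h', segment_symm]
      · refine Or.inr (Or.inr (Or.inl ⟨h.symm, ?_⟩))
        rw [h', segment_symm]
  fits := by
    rintro P K L ⟨a, b, c, rfl, h⟩ hK hL hne
    rw [redChildren_tri] at hK hL
    have h' : 0 < cross b c a := by rwa [cross_rotate]
    have h'' : 0 < cross c a b := by rwa [cross_rotate]
    have e := tri_rotate (midpoint ℝ a b) (midpoint ℝ b c) (midpoint ℝ c a)
    have e' := tri_rotate (midpoint ℝ b c) (midpoint ℝ c a) (midpoint ℝ a b)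
    have f1 := fits_tri_corners h
    have f2 := fits_tri_corners h'
    have f3 := fits_tri_corners h''
    have g1 := fits_tri_middle h
    have g2 := fits_tri_middle h'
    have g3 := fits_tri_middle h''
    rw [e] at g2
    rw [e', e] at g3
    rcases hK with rfl | rfl | rfl | rfl <;> rcases hL with rfl | rfl | rfl | rfl <;>
      first
      | exact absurd rfl hne
      | assumption
      | (apply Fits.symm; assumption)
  finite_children := by
    rintro P ⟨a, b, c, rfl, -⟩
    rw [redChildren_tri]
    exact Set.toFinite _
  injective := by
    rintro P P' ⟨a, b, c, rfl, h⟩ e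
    have hKa : tri a (midpoint ℝ a b) (midpoint ℝ c a) ∈ redChildren P' := by
      rw [e, redChildren_tri]; exact Or.inl rfl
    rcases exists_tri_or_quad_of_mem_redChildren hKa with ⟨x, y, z, rfl⟩ | ⟨x, y, z, w, rfl⟩
    · have hx : tri x (midpoint ℝ x y) (midpoint ℝ z x) ∈ redChildren (tri a b c) := by
        rw [← e, redChildren_tri]; exact Or.inl rfl
      have h' := isTriangle_tri.1 (cross_pos_of_child_tri h hx)
      refine tri_eq_of_hull h (by simp [cross] at *; linarith) ?_ ?_
      · intro v hv
        obtain ⟨K, hK, hvK⟩ := vertex_child_tri hv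
        rw [e] at hK
        exact hull_child_tri hK (vertex_mem_hull hvK)
      · intro v hv
        obtain ⟨K, hK, hvK⟩ := vertex_child_tri hv
        rw [← e] at hK
        exact hull_child_tri hK (vertex_mem_hull hvK)
    · exfalso
      rw [redChildren_quad] at hKa
      rcases hKa with h | h | h | h <;> exact tri_ne_quad h

/-! ### Quadrilaterals -/

theorem IsQuad.exists_of_side {K : Elem} (h : IsQuad K) {a b : Pt} (hs : HasSide K a b) :
    ∃ c d, K = quad a b c d ∧ IsQuad (quad a b c d) := by
  have h' := h
  obtain ⟨x, y, z, w, rfl, -⟩ := h'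
  have key : ∀ c d, quad x y z w = quad a b c d →
      ∃ c d, quad x y z w = quad a b c d ∧ IsQuad (quad a b c d) :=
    fun c d e => ⟨c, d, e, e ▸ h⟩
  rcases hasSide_quad.1 hs with ⟨rfl, rfl⟩ | ⟨rfl, rfl⟩ | ⟨rfl, rfl⟩ | ⟨rfl, rfl⟩
  · exact key z w rfl
  · exact key w x (quad_rotate _ _ _ _).symm
  · exact key x y (quad_eq_iff.2 (by tauto))
  · exact key y z (quad_rotate _ _ _ _)

theorem fits_quad_adjacent {a b c d : Pt} (h : IsQuad (quad a b c d)) :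
    Fits (quad a (midpoint ℝ a b) (quadCenter a b c d) (midpoint ℝ d a))
      (quad b (midpoint ℝ b c) (quadCenter a b c d) (midpoint ℝ a b)) := by
  obtain ⟨h1, h2, h3, h4⟩ := isQuad_quad.1 h
  simp only [cross] at h1 h2 h3 h4
  refine fits_of_edge (p := midpoint ℝ a b) (q := quadCenter a b c d)
    (Or.inl (hasSide_quad.2 (by simp))) (Or.inr (hasSide_quad.2 (by simp))) ?_ ?_ ?_
  · intro v hv
    rcases mem_quad.1 hv with rfl | rfl | rfl | rfl <;> simp [cross] <;> linarith
  · intro v hv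
    rcases mem_quad.1 hv with rfl | rfl | rfl | rfl <;> simp [cross] <;> linarith
  · intro v hv h0
    rcases mem_quad.1 hv with rfl | rfl | rfl | rfl
    all_goals
      first
      | exact Or.inl rfl
      | exact Or.inr rfl
      | (simp [cross] at h0; linarith)

theorem fits_quad_opposite {a b c d : Pt} (h : IsQuad (quad a b c d)) :
    Fits (quad a (midpoint ℝ a b) (quadCenter a b c d) (midpoint ℝ d a))
      (quad c (midpoint ℝ c d) (quadCenter a b c d) (midpoint ℝ b c)) := by
  obtain ⟨h1, h2, h3, h4⟩ := isQuad_quad.1 h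
  simp only [cross] at h1 h2 h3 h4
  -- the line through the center that is parallel to the diagonal `b d`
  have e : ∀ v, cross (quadCenter a b c d) (quadCenter a b c d + d - b) v =
      (d.1 - b.1) * (v.2 - (a.2 + b.2 + c.2 + d.2) / 4) -
        (d.2 - b.2) * (v.1 - (a.1 + b.1 + c.1 + d.1) / 4) := by
    intro v; simp [cross]; ring
  refine fits_of_vertex (a := quadCenter a b c d) (b := quadCenter a b c d + d - b)
    (p := quadCenter a b c d) (by simp) (by simp) (by simp) ?_ ?_ ?_
  · intro v hv
    rw [e]
    rcases mem_quad.1 hv with rfl | rfl | rfl | rfl <;> (try simp) <;> linarith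
  · intro v hv
    rw [e]
    rcases mem_quad.1 hv with rfl | rfl | rfl | rfl <;> (try simp) <;> linarith
  · intro v hv h0
    rw [e] at h0
    rcases mem_quad.1 hv with rfl | rfl | rfl | rfl
    all_goals
      first
      | rfl
      | ((try simp at h0); linarith)

theorem face_quad {a b c d : Pt} (h : IsQuad (quad a b c d)) {K : Elem}
    (hK : K ∈ redChildren (quad a b c d)) :
    hull K ∩ segment ℝ a b = ∅ ∨
    (midpoint ℝ a b ∈ K ∧ hull K ∩ segment ℝ a b = {midpoint ℝ a b}) ∨
    (HasEdge K a (midpoint ℝ a b) ∧ hull K ∩ segment ℝ a b = segment ℝ a (midpoint ℝ a b)) ∨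
    (HasEdge K (midpoint ℝ a b) b ∧ hull K ∩ segment ℝ a b = segment ℝ (midpoint ℝ a b) b) := by
  obtain ⟨h1, h2, h3, h4⟩ := isQuad_quad.1 h
  rw [cross_rotate.symm] at h4
  have hm : midpoint ℝ a b ∈ segment ℝ a b :=
    openSegment_subset_segment ℝ _ _ midpoint_mem_openSegment
  rw [redChildren_quad] at hK
  rcases hK with rfl | rfl | rfl | rfl
  · refine Or.inr (Or.inr (Or.inl ⟨Or.inl (hasSide_quad.2 (by simp)), ?_⟩))
    refine hull_inter_segment ?_ ?_ (by simp) (by simp) (left_mem_segment ℝ _ _) hm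
    · intro v hv
      rcases mem_quad.1 hv with rfl | rfl | rfl | rfl <;>
        (try simp [cross_midpoint, cross_quadCenter]) <;> linarith
    · intro v hv h0
      rcases mem_quad.1 hv with rfl | rfl | rfl | rfl
      all_goals
        first
        | exact Or.inl rfl
        | exact Or.inr rfl
        | (simp [cross_midpoint, cross_quadCenter] at h0; linarith)
  · refine Or.inr (Or.inr (Or.inr ⟨Or.inl (hasSide_quad.2 (by simp)), ?_⟩))
    refine hull_inter_segment ?_ ?_ (by simp) (by simp) hm (right_mem_segment ℝ _ _)
    · intro v hv
      rcases mem_quad.1 hv with rfl | rfl | rfl | rfl <;>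
        (try simp [cross_midpoint, cross_quadCenter]) <;> linarith
    · intro v hv h0
      rcases mem_quad.1 hv with rfl | rfl | rfl | rfl
      all_goals
        first
        | exact Or.inl rfl
        | exact Or.inr rfl
        | (simp [cross_midpoint, cross_quadCenter] at h0; linarith)
  all_goals
    refine Or.inl (hull_inter_segment_empty ?_)
    intro v hv
    rcases mem_quad.1 hv with rfl | rfl | rfl | rfl <;>
      (try simp [cross_midpoint, cross_quadCenter]) <;> linarith

theorem isQuad_child {a b c d : Pt} (h : IsQuad (quad a b c d)) {K : Elem}
    (hK : K ∈ redChildren (quad a b c d)) : IsQuad K := by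
  obtain ⟨h1, h2, h3, h4⟩ := isQuad_quad.1 h
  simp only [cross] at h1 h2 h3 h4
  rw [redChildren_quad] at hK
  rcases hK with rfl | rfl | rfl | rfl <;> rw [isQuad_quad] <;>
    refine ⟨?_, ?_, ?_, ?_⟩ <;> simp [cross] <;> linarith

theorem quadCenter_mem_hull (a b c d : Pt) : quadCenter a b c d ∈ hull (quad a b c d) :=
  midpoint_mem_hull
    (midpoint_mem_hull (vertex_mem_hull (by simp)) (vertex_mem_hull (by simp)))
    (midpoint_mem_hull (vertex_mem_hull (by simp)) (vertex_mem_hull (by simp)))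

theorem hull_child_quad {a b c d : Pt} {K : Elem} (hK : K ∈ redChildren (quad a b c d)) :
    hull K ⊆ hull (quad a b c d) := by
  have ha : a ∈ hull (quad a b c d) := vertex_mem_hull (by simp)
  have hb : b ∈ hull (quad a b c d) := vertex_mem_hull (by simp)
  have hc : c ∈ hull (quad a b c d) := vertex_mem_hull (by simp)
  have hd : d ∈ hull (quad a b c d) := vertex_mem_hull (by simp)
  have h1 := midpoint_mem_hull ha hb
  have h2 := midpoint_mem_hull hb hc
  have h3 := midpoint_mem_hull hc hd
  have h4 := midpoint_mem_hull hd ha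
  have h5 := quadCenter_mem_hull a b c d
  rw [redChildren_quad] at hK
  refine hull_subset (convex_convexHull ℝ _) fun v hv => ?_
  rcases hK with rfl | rfl | rfl | rfl <;> rcases mem_quad.1 hv with rfl | rfl | rfl | rfl <;>
    assumption

theorem vertex_child_quad {a b c d v : Pt} (hv : v ∈ quad a b c d) :
    ∃ K ∈ redChildren (quad a b c d), v ∈ K := by
  rw [redChildren_quad]
  rcases mem_quad.1 hv with rfl | rfl | rfl | rfl
  · exact ⟨_, Or.inl rfl, by simp⟩
  · exact ⟨_, Or.inr (Or.inl rfl), by simp⟩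
  · exact ⟨_, Or.inr (Or.inr (Or.inl rfl)), by simp⟩
  · exact ⟨_, Or.inr (Or.inr (Or.inr rfl)), by simp⟩

theorem redShape_quad : RedShape IsQuad where
  convex h := h.convex
  child := by
    intro P K h hK
    have h' := h
    obtain ⟨a, b, c, d, rfl, -⟩ := h'
    exact isQuad_child h hK
  hull_child := by
    rintro P K ⟨a, b, c, d, rfl, -⟩ hK
    exact hull_child_quad hK
  vertex_child := by
    rintro P v ⟨a, b, c, d, rfl, -⟩ hv
    exact vertex_child_quad hv
  exists_midpoint := by
    rintro P K ⟨a, b, c, d, rfl, -⟩ hK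
    rw [redChildren_quad] at hK
    have e1 : HasEdge (quad a b c d) a b := Or.inl (hasSide_quad.2 (by simp))
    have e2 : HasEdge (quad a b c d) c d := Or.inl (hasSide_quad.2 (by simp))
    rcases hK with rfl | rfl | rfl | rfl
    · exact ⟨a, b, e1, by simp⟩
    · exact ⟨a, b, e1, by simp⟩
    · exact ⟨c, d, e2, by simp⟩
    · exact ⟨c, d, e2, by simp⟩
  midpoint_child := by
    rintro P a b hP hab
    wlog hs : HasSide P a b generalizing a b
    · rw [midpoint_comm]; exact this hab.symm (hab.resolve_left hs)
    obtain ⟨c, d, rfl, -⟩ := hP.exists_of_side hs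
    exact ⟨_, by rw [redChildren_quad]; exact Or.inl rfl, by simp⟩
  face := by
    intro P K a b hP hab hK
    rcases hab with hs | hs
    · obtain ⟨c, d, rfl, h⟩ := hP.exists_of_side hs
      exact face_quad h hK
    · obtain ⟨c, d, rfl, h⟩ := hP.exists_of_side hs
      rw [midpoint_comm, segment_symm ℝ a b]
      rcases face_quad h hK with h | h | ⟨h, h'⟩ | ⟨h, h'⟩
      · exact Or.inl h
      · exact Or.inr (Or.inl h)
      · refine Or.inr (Or.inr (Or.inr ⟨h.symm, ?_⟩))
        rw [h', segment_symm]
      · refine Or.inr (Or.inr (Or.inl ⟨h.symm, ?_⟩))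
        rw [h', segment_symm]
  fits := by
    intro P K L h hK hL hne
    have h' := h
    obtain ⟨a, b, c, d, rfl, -⟩ := h'
    rw [redChildren_quad] at hK hL
    have h1 : IsQuad (quad b c d a) := by rwa [quad_rotate]
    have h2 : IsQuad (quad c d a b) := by rwa [quad_rotate]
    have h3 : IsQuad (quad d a b c) := by rwa [quad_rotate]
    have e1 := quadCenter_rotate a b c d
    have e2 := (quadCenter_rotate b c d a).trans e1
    have e3 := (quadCenter_rotate c d a b).trans e2
    have f1 := fits_quad_adjacent h
    have f2 := fits_quad_adjacent h1
    have f3 := fits_quad_adjacent h2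
    have f4 := fits_quad_adjacent h3
    have g1 := fits_quad_opposite h
    have g2 := fits_quad_opposite h1
    rw [e1] at f2 g2
    rw [e2] at f3
    rw [e3] at f4
    rcases hK with rfl | rfl | rfl | rfl <;> rcases hL with rfl | rfl | rfl | rfl <;>
      first
      | exact absurd rfl hne
      | assumption
      | (apply Fits.symm; assumption)
  finite_children := by
    rintro P ⟨a, b, c, d, rfl, -⟩
    rw [redChildren_quad]
    exact Set.toFinite _
  injective := by
    intro P P' h e
    have h' := h
    obtain ⟨a, b, c, d, rfl, -⟩ := h'
    have hKa : quad a (midpoint ℝ a b) (quadCenter a b c d) (midpoint ℝ d a) ∈ redChildren P' := by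
      rw [e, redChildren_quad]; exact Or.inl rfl
    rcases exists_tri_or_quad_of_mem_redChildren hKa with ⟨x, y, z, rfl⟩ | ⟨x, y, z, w, rfl⟩
    · exfalso
      rw [redChildren_tri] at hKa
      rcases hKa with h | h | h | h <;> exact tri_ne_quad h.symm
    · have hx : quad x (midpoint ℝ x y) (quadCenter x y z w) (midpoint ℝ w x) ∈
          redChildren (quad a b c d) := by
        rw [← e, redChildren_quad]; exact Or.inl rfl
      have hy : quad y (midpoint ℝ y z) (quadCenter x y z w) (midpoint ℝ x y) ∈
          redChildren (quad a b c d) := by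
        rw [← e, redChildren_quad]; exact Or.inr (Or.inl rfl)
      have hz : quad z (midpoint ℝ z w) (quadCenter x y z w) (midpoint ℝ y z) ∈
          redChildren (quad a b c d) := by
        rw [← e, redChildren_quad]; exact Or.inr (Or.inr (Or.inl rfl))
      have kx := (isQuad_quad.1 (isQuad_child h hx)).2.2.2
      have ky := (isQuad_quad.1 (isQuad_child h hy)).2.2.2
      have kz := (isQuad_quad.1 (isQuad_child h hz)).2.2.2
      refine quad_eq_of_hull h ?_ ?_ ?_ ?_ ?_
      · simp [cross] at ky ⊢; linarith
      · left; simp [cross] at kz ⊢; linarith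
      · simp [cross] at kx ⊢; linarith
      · intro v hv
        obtain ⟨K, hK, hvK⟩ := vertex_child_quad hv
        rw [e] at hK
        exact hull_child_quad hK (vertex_mem_hull hvK)
      · intro v hv
        obtain ⟨K, hK, hvK⟩ := vertex_child_quad hv
        rw [← e] at hK
        exact hull_child_quad hK (vertex_mem_hull hvK)

/-! ### The uniform red refinements of the initial mesh -/

/-- The elements that arise from `E` by `k` uniform red refinements. -/
def level (E : Set Elem) : ℕ → Set Elem
  | 0 => E
  | k + 1 => ⋃ P ∈ level E k, redChildren P

/-- The vertices of the elements in `S`. -/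
def verts (S : Set Elem) : Set Pt := {v | ∃ K ∈ S, v ∈ K}

/-- A finite conforming family of elements of a common shape. -/
structure Grid (shape : Elem → Prop) (E : Set Elem) : Prop where
  redShape : RedShape shape
  shape_mem : ∀ K ∈ E, shape K
  fits : ∀ K ∈ E, ∀ L ∈ E, K ≠ L → Fits K L
  finite : E.Finite

theorem mem_level_succ {E : Set Elem} {k : ℕ} {K : Elem} :
    K ∈ level E (k + 1) ↔ ∃ P ∈ level E k, K ∈ redChildren P := by
  simp [level]

theorem IsInitialMesh.grid {shape : Elem → Prop} {T : Mesh} (hs : RedShape shape)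
    (h : IsInitialMesh shape T) : Grid shape T.elems :=
  ⟨hs, h.2.2.1, h.2.2.2, h.1⟩

namespace Grid

variable {shape : Elem → Prop} {E : Set Elem}

/-- Every uniform refinement of a conforming family is conforming. -/
theorem level (G : Grid shape E) (k : ℕ) : Grid shape (level E k) := by
  induction k with
  | zero => exact G
  | succ k ih =>
    refine ⟨G.redShape, ?_, ?_, ?_⟩
    · intro K hK
      obtain ⟨P, hP, hK⟩ := mem_level_succ.1 hK
      exact G.redShape.child (ih.shape_mem P hP) hK
    · exact G.redShape.fits_children ih.shape_mem ih.fits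
    · exact ih.finite.biUnion fun P hP => G.redShape.finite_children (ih.shape_mem P hP)

theorem convex (G : Grid shape E) {K : Elem} (hK : K ∈ E) : IsConvexElem K :=
  G.redShape.convex (G.shape_mem K hK)

/-- In a conforming family, every element that contains an inner point of an edge has this edge. -/
theorem edge_of_mem_hull (G : Grid shape E) {K L : Elem} (hK : K ∈ E) (hL : L ∈ E) {a b x : Pt}
    (hab : HasEdge K a b) (hx : x ∈ openSegment ℝ a b) (hxL : x ∈ hull L) : HasEdge L a b := by
  by_cases hne : K = L
  · exact hne ▸ hab
  have hxK : x ∈ hull K := segment_subset_hull (vertex_mem_hull hab.left_mem)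
    (vertex_mem_hull hab.right_mem) (openSegment_subset_segment ℝ _ _ hx)
  have hmem : x ∈ hull K ∩ hull L := ⟨hxK, hxL⟩
  rcases G.fits K hK L hL hne with h | ⟨v, hv, -, h⟩ | ⟨p, q, h1, h2, h⟩
  · rw [h] at hmem; exact absurd hmem (Set.notMem_empty _)
  · rw [h] at hmem
    obtain rfl : x = v := hmem
    exact absurd hv ((G.convex hK).openEdge_not_mem hab hx)
  · rw [h] at hmem
    rcases (G.convex hK).edge_unique hab h1 hx hmem with ⟨rfl, rfl⟩ | ⟨rfl, rfl⟩
    · exact h2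
    · exact h2.symm

/-- A conforming family has no hanging nodes. -/
theorem not_mem_openEdge (G : Grid shape E) {K L : Elem} (hK : K ∈ E) (hL : L ∈ E) {a b v : Pt}
    (hab : HasEdge K a b) (hv : v ∈ L) : v ∉ openSegment ℝ a b := fun hx =>
  (G.convex hL).openEdge_not_mem (G.edge_of_mem_hull hK hL hab hx (vertex_mem_hull hv)) hx hv

theorem eq_of_hull_subset (G : Grid shape E) {K L : Elem} (hK : K ∈ E) (hL : L ∈ E) {M : Elem}
    (hM : IsConvexElem M) (h1 : hull M ⊆ hull K) (h2 : hull M ⊆ hull L) : K = L := by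
  by_contra hne
  have hsub := Set.subset_inter h1 h2
  rcases G.fits K hK L hL hne with h | ⟨v, -, -, h⟩ | ⟨p, q, -, -, h⟩
  · rw [h] at hsub
    exact (hM.hull_nonempty.mono hsub).ne_empty rfl
  · rw [h, ← segment_same ℝ v] at hsub
    exact hM.not_hull_subset_segment _ _ hsub
  · rw [h] at hsub
    exact hM.not_hull_subset_segment _ _ hsub

theorem verts_mono (G : Grid shape E) {i j : ℕ} (hij : i ≤ j) :
    verts (AdaptMesh.level E i) ⊆ verts (AdaptMesh.level E j) := by
  induction j, hij using Nat.le_induction with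
  | base => exact subset_rfl
  | succ j hj ih =>
    refine ih.trans ?_
    rintro v ⟨P, hP, hv⟩
    obtain ⟨K, hK, hvK⟩ := G.redShape.vertex_child ((G.level j).shape_mem P hP) hv
    exact ⟨K, mem_level_succ.2 ⟨P, hP, hK⟩, hvK⟩

theorem midpoint_mem_verts (G : Grid shape E) {k : ℕ} {P : Elem} (hP : P ∈ AdaptMesh.level E k)
    {a b : Pt} (hab : HasEdge P a b) : midpoint ℝ a b ∈ verts (AdaptMesh.level E (k + 1)) := by
  obtain ⟨K, hK, h⟩ := G.redShape.midpoint_child ((G.level k).shape_mem P hP) hab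
  exact ⟨K, mem_level_succ.2 ⟨P, hP, hK⟩, h⟩

/-- The edge midpoints of one level are new vertices of the next level. -/
theorem midpoint_notMem_verts (G : Grid shape E) {j k : ℕ} (hjk : j ≤ k) {P : Elem}
    (hP : P ∈ AdaptMesh.level E k) {a b : Pt} (hab : HasEdge P a b) :
    midpoint ℝ a b ∉ verts (AdaptMesh.level E j) := by
  intro h
  obtain ⟨L, hL, hv⟩ := G.verts_mono hjk h
  exact (G.level k).not_mem_openEdge hP hL hab hv midpoint_mem_openSegment

/-- Every element of positive level has a vertex that is new on this level, so that the levels are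
disjoint. -/
theorem level_unique (G : Grid shape E) {i j : ℕ} {K : Elem} (hi : K ∈ AdaptMesh.level E i)
    (hj : K ∈ AdaptMesh.level E j) : i = j := by
  wlog hij : i < j generalizing i j
  · rcases lt_trichotomy i j with h | h | h
    · exact absurd h hij
    · exact h
    · exact (this hj hi h).symm
  exfalso
  obtain ⟨k, rfl⟩ : ∃ k, j = k + 1 := ⟨j - 1, by omega⟩
  obtain ⟨P, hP, hK⟩ := mem_level_succ.1 hj
  obtain ⟨a, b, hab, hm⟩ := G.redShape.exists_midpoint ((G.level k).shape_mem P hP) hK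
  exact G.midpoint_notMem_verts (by omega : i ≤ k) hP hab ⟨K, hi, hm⟩

theorem parent_unique (G : Grid shape E) {i j : ℕ} {K P P' : Elem} (hP : P ∈ AdaptMesh.level E i)
    (hP' : P' ∈ AdaptMesh.level E j) (hK : K ∈ redChildren P) (hK' : K ∈ redChildren P') :
    P = P' := by
  have h1 : K ∈ AdaptMesh.level E (i + 1) := mem_level_succ.2 ⟨P, hP, hK⟩
  have h2 : K ∈ AdaptMesh.level E (j + 1) := mem_level_succ.2 ⟨P', hP', hK'⟩
  obtain rfl : i = j := by have := G.level_unique h1 h2; omega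
  exact (G.level i).eq_of_hull_subset hP hP' ((G.level (i + 1)).convex h1)
    (G.redShape.hull_child ((G.level i).shape_mem P hP) hK)
    (G.redShape.hull_child ((G.level i).shape_mem P' hP') hK')

/-- Elements with a common edge have the same level. -/
theorem level_eq_of_edge (G : Grid shape E) {i j : ℕ} {K L : Elem} (hK : K ∈ AdaptMesh.level E i)
    (hL : L ∈ AdaptMesh.level E j) {a b : Pt} (h1 : HasEdge K a b) (h2 : HasEdge L a b) :
    i = j := by
  wlog hij : i < j generalizing i j K L
  · rcases lt_trichotomy i j with h | h | h
    · exact absurd h hij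
    · exact h
    · exact (this hL hK h2 h1 h).symm
  exact absurd (G.verts_mono (by omega : i + 1 ≤ j) (G.midpoint_mem_verts hK h1))
    (G.midpoint_notMem_verts le_rfl hL h2)

end Grid

/-! ### Forests of refined elements -/

/-- `S` is the set of leaves of the red refinement in which `D` is the set of refined elements: `D`
consists of elements of the uniform refinements and contains the parents of its elements. -/
structure Leaves (E D S : Set Elem) : Prop where
  exists_level : ∀ P ∈ D, ∃ k, P ∈ level E k
  closed : ∀ P ∈ D, ∀ k, P ∈ level E (k + 1) → ∃ P' ∈ D, P' ∈ level E k ∧ P ∈ redChildren P'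
  eq : S = (E ∪ ⋃ P ∈ D, redChildren P) \ D

/-- All refined elements have a level less than `N`. -/
def HeightLE (E D : Set Elem) (N : ℕ) : Prop := ∀ P ∈ D, ∃ k < N, P ∈ level E k

theorem Leaves.init (E : Set Elem) : Leaves E ∅ E := ⟨by simp, by simp, by simp⟩

namespace Leaves

variable {shape : Elem → Prop} {E D S : Set Elem}

theorem mem_iff (h : Leaves E D S) {K : Elem} :
    K ∈ S ↔ (K ∈ E ∨ ∃ P ∈ D, K ∈ redChildren P) ∧ K ∉ D := by
  rw [h.eq]; simp

theorem notMem (h : Leaves E D S) {K : Elem} (hK : K ∈ S) : K ∉ D := (h.mem_iff.1 hK).2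

theorem level_of_mem (h : Leaves E D S) {K : Elem} (hK : K ∈ S) : ∃ k, K ∈ level E k := by
  rcases (h.mem_iff.1 hK).1 with h' | ⟨P, hP, h'⟩
  · exact ⟨0, h'⟩
  · obtain ⟨k, hk⟩ := h.exists_level P hP
    exact ⟨k + 1, mem_level_succ.2 ⟨P, hk, h'⟩⟩

theorem child_mem (h : Leaves E D S) {P K : Elem} (hP : P ∈ D) (hK : K ∈ redChildren P) :
    K ∈ S ∨ K ∈ D := by
  by_cases hD : K ∈ D
  · exact Or.inr hD
  · exact Or.inl (h.mem_iff.2 ⟨Or.inr ⟨P, hP, hK⟩, hD⟩)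

theorem parent_mem (G : Grid shape E) (h : Leaves E D S) {K : Elem} (hK : K ∈ S) {k : ℕ}
    (hk : K ∈ level E (k + 1)) : ∃ P ∈ D, P ∈ level E k ∧ K ∈ redChildren P := by
  rcases (h.mem_iff.1 hK).1 with h' | ⟨P, hP, h'⟩
  · have := G.level_unique (show K ∈ level E 0 from h') hk
    omega
  · obtain ⟨j, hj⟩ := h.exists_level P hP
    have := G.level_unique (mem_level_succ.2 ⟨P, hj, h'⟩) hk
    obtain rfl : j = k := by omega
    exact ⟨P, hP, hj, h'⟩

/-- All ancestors of a refined element are refined. -/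
theorem ancestor (G : Grid shape E) (h : Leaves E D S) {i j : ℕ} (hij : i ≤ j) {P : Elem}
    (hP : P ∈ D) (hj : P ∈ level E j) : ∃ A ∈ D, A ∈ level E i ∧ hull P ⊆ hull A := by
  induction j, hij using Nat.le_induction generalizing P with
  | base => exact ⟨P, hP, hj, subset_rfl⟩
  | succ j hij ih =>
    obtain ⟨P', hP', hl, hc⟩ := h.closed P hP j hj
    obtain ⟨A, hA, hAl, hsub⟩ := ih hP' hl
    exact ⟨A, hA, hAl, (G.redShape.hull_child ((G.level j).shape_mem P' hl) hc).trans hsub⟩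

theorem ancestor_of_leaf (G : Grid shape E) (h : Leaves E D S) {i j : ℕ} (hij : i < j) {L : Elem}
    (hL : L ∈ S) (hj : L ∈ level E j) : ∃ A ∈ D, A ∈ level E i ∧ hull L ⊆ hull A := by
  obtain ⟨k, rfl⟩ : ∃ k, j = k + 1 := ⟨j - 1, by omega⟩
  obtain ⟨P, hP, hl, hc⟩ := h.parent_mem G hL hj
  obtain ⟨A, hA, hAl, hsub⟩ := h.ancestor G (by omega : i ≤ k) hP hl
  exact ⟨A, hA, hAl, (G.redShape.hull_child ((G.level k).shape_mem P hl) hc).trans hsub⟩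

/-- Red refinement of a set of leaves. -/
theorem refine (G : Grid shape E) (h : Leaves E D S) {R : Set Elem} (hR : R ⊆ S) :
    Leaves E (D ∪ R) ((S \ R) ∪ ⋃ P ∈ R, redChildren P) := by
  have hlev : ∀ P ∈ D ∪ R, ∃ k, P ∈ level E k := by
    rintro P (hP | hP)
    · exact h.exists_level P hP
    · exact h.level_of_mem (hR hP)
  refine ⟨hlev, ?_, ?_⟩
  · rintro P (hP | hP) k hk
    · obtain ⟨P', hP', h'⟩ := h.closed P hP k hk
      exact ⟨P', Or.inl hP', h'⟩
    · obtain ⟨P', hP', h'⟩ := h.parent_mem G (hR hP) hk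
      exact ⟨P', Or.inl hP', h'⟩
  · have key : ∀ P ∈ R, ∀ K ∈ redChildren P, K ∉ D ∪ R := by
      intro P hP K hK hKD
      obtain ⟨k, hk⟩ := h.level_of_mem (hR hP)
      have hKl : K ∈ level E (k + 1) := mem_level_succ.2 ⟨P, hk, hK⟩
      have : ∃ P' ∈ D, P' ∈ level E k ∧ K ∈ redChildren P' := by
        rcases hKD with hKD | hKD
        · exact h.closed K hKD k hKl
        · exact h.parent_mem G (hR hKD) hKl
      obtain ⟨P', hP', hl, hc⟩ := this
      have := G.parent_unique hk hl hK hc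
      exact h.notMem (hR hP) (this ▸ hP')
    ext K
    simp only [Set.mem_union, Set.mem_sdiff, h.mem_iff, Set.mem_iUnion, exists_prop, not_or]
    constructor
    · rintro (⟨⟨h1, h2⟩, h3⟩ | ⟨P, hP, hK⟩)
      · refine ⟨?_, h2, h3⟩
        rcases h1 with h1 | ⟨P, hP, hK⟩
        · exact Or.inl h1
        · exact Or.inr ⟨P, Or.inl hP, hK⟩
      · have := key P hP K hK
        exact ⟨Or.inr ⟨P, Or.inr hP, hK⟩, fun h => this (Or.inl h), fun h => this (Or.inr h)⟩
    · rintro ⟨h1 | ⟨P, hP | hP, hK⟩, h2, h3⟩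
      · exact Or.inl ⟨⟨Or.inl h1, h2⟩, h3⟩
      · exact Or.inl ⟨⟨Or.inr ⟨P, hP, hK⟩, h2⟩, h3⟩
      · exact Or.inr ⟨P, hP, hK⟩

/-- Removal of the children of a set of refined elements all of whose children are leaves. -/
theorem coarsen (G : Grid shape E) (h : Leaves E D S) {C : Set Elem} (hC : C ⊆ D)
    (hCS : ∀ P ∈ C, redChildren P ⊆ S) :
    Leaves E (D \ C) ((S \ ⋃₀ (redChildren '' C)) ∪ C) := by
  have parent : ∀ P ∈ D, ∀ k, P ∈ level E (k + 1) →
      ∃ P' ∈ D \ C, P' ∈ level E k ∧ P ∈ redChildren P' := by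
    intro P hP k hk
    obtain ⟨P', hP', hl, hc⟩ := h.closed P hP k hk
    exact ⟨P', ⟨hP', fun hPC => h.notMem (hCS P' hPC hc) hP⟩, hl, hc⟩
  refine ⟨fun P hP => h.exists_level P hP.1, fun P hP => parent P hP.1, ?_⟩
  ext K
  simp only [Set.mem_union, Set.mem_sdiff, h.mem_iff, Set.mem_iUnion, exists_prop, Set.mem_sUnion,
    Set.mem_image, exists_exists_and_eq_and, not_exists, not_and, not_not]
  constructor
  · rintro (⟨⟨h1, h2⟩, h3⟩ | hK)
    · refine ⟨?_, fun h => absurd h h2⟩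
      rcases h1 with h1 | ⟨P, hP, hK⟩
      · exact Or.inl h1
      · exact Or.inr ⟨P, ⟨hP, fun hPC => h3 P hPC hK⟩, hK⟩
    · refine ⟨?_, fun _ => hK⟩
      obtain ⟨k, hk⟩ := h.exists_level K (hC hK)
      cases k with
      | zero => exact Or.inl hk
      | succ k =>
        obtain ⟨P', hP', -, hc⟩ := parent K (hC hK) k hk
        exact Or.inr ⟨P', hP', hc⟩
  · rintro ⟨h1, h2⟩
    by_cases hK : K ∈ C
    · exact Or.inr hK
    refine Or.inl ⟨⟨?_, fun h => hK (h2 h)⟩, ?_⟩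
    · rcases h1 with h1 | ⟨P, hP, hc⟩
      · exact Or.inl h1
      · exact Or.inr ⟨P, hP.1, hc⟩
    · intro P hPC hc
      obtain ⟨j, hj⟩ := h.exists_level P (hC hPC)
      rcases h1 with h1 | ⟨P', hP', hc'⟩
      · have := G.level_unique (show K ∈ level E 0 from h1) (mem_level_succ.2 ⟨P, hj, hc⟩)
        omega
      · obtain ⟨i, hi⟩ := h.exists_level P' hP'.1
        exact hP'.2 (G.parent_unique hi hj hc' hc ▸ hPC)

theorem level_le (G : Grid shape E) (h : Leaves E D S) {N : ℕ} (hN : HeightLE E D N) {K : Elem}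
    (hK : K ∈ S) : ∃ k ≤ N, K ∈ level E k := by
  obtain ⟨k, hk⟩ := h.level_of_mem hK
  refine ⟨k, ?_, hk⟩
  cases k with
  | zero => omega
  | succ k =>
    obtain ⟨P, hP, hl, -⟩ := h.parent_mem G hK hk
    obtain ⟨j, hj, hl'⟩ := hN P hP
    have := G.level_unique hl hl'
    omega

theorem verts_subset (G : Grid shape E) (h : Leaves E D S) {N : ℕ} (hN : HeightLE E D N) :
    verts S ⊆ verts (level E N) := by
  rintro v ⟨K, hK, hv⟩
  obtain ⟨k, hk, hl⟩ := h.level_le G hN hK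
  exact G.verts_mono hk ⟨K, hl, hv⟩

theorem finite (G : Grid shape E) (h : Leaves E D S) {N : ℕ} (hN : HeightLE E D N) : S.Finite := by
  have : (⋃ k ∈ Set.Iic N, level E k).Finite :=
    (Set.finite_Iic N).biUnion fun k _ => (G.level k).finite
  refine this.subset fun K hK => ?_
  obtain ⟨k, hk, hl⟩ := h.level_le G hN hK
  exact Set.mem_biUnion hk hl

/-- The vertices of refined elements are still vertices of leaves. -/
theorem mem_verts (G : Grid shape E) (h : Leaves E D S) {N : ℕ} (hN : HeightLE E D N) {K : Elem}
    (hK : K ∈ S ∨ K ∈ D) {v : Pt} (hv : v ∈ K) : v ∈ verts S := by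
  have key : ∀ n k, N ≤ n + k → ∀ K, (K ∈ S ∨ K ∈ D) → K ∈ level E k → v ∈ K → v ∈ verts S := by
    intro n
    induction n with
    | zero =>
      intro k hk K hK hl hv
      rcases hK with hK | hK
      · exact ⟨K, hK, hv⟩
      · obtain ⟨j, hj, hl'⟩ := hN K hK
        have := G.level_unique hl hl'
        omega
    | succ n ih =>
      intro k hk K hK hl hv
      rcases hK with hK | hK
      · exact ⟨K, hK, hv⟩
      · obtain ⟨K', hK', hv'⟩ := G.redShape.vertex_child ((G.level k).shape_mem K hl) hv
        exact ih (k + 1) (by omega) K' (h.child_mem hK hK') (mem_level_succ.2 ⟨K, hl, hK'⟩) hv'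
  obtain ⟨k, hk⟩ : ∃ k, K ∈ level E k := hK.elim h.level_of_mem (h.exists_level K)
  exact key N k (by omega) K hK hk hv

theorem mem_or_mem_of_base (h : Leaves E D S) {K : Elem} (hK : K ∈ E) : K ∈ S ∨ K ∈ D := by
  by_cases hD : K ∈ D
  · exact Or.inr hD
  · exact Or.inl (h.mem_iff.2 ⟨Or.inl hK, hD⟩)

/-- The children of a refined element of the highest level are leaves. -/
theorem children_subset (G : Grid shape E) (h : Leaves E D S) {k : ℕ} (hN : HeightLE E D (k + 1))
    {P : Elem} (hP : P ∈ D) (hk : P ∈ level E k) : redChildren P ⊆ S := by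
  intro K hK
  refine (h.child_mem hP hK).resolve_right fun hD => ?_
  obtain ⟨j, hj, hl⟩ := hN K hD
  have := G.level_unique hl (mem_level_succ.2 ⟨P, hk, hK⟩)
  omega

/-- A leaf that contains the midpoint of an edge of an element `P`, and has this midpoint as a
vertex, descends from a refined element with this edge. -/
theorem edge_of_midpoint_mem (G : Grid shape E) (h : Leaves E D S) {k : ℕ} {P L : Elem}
    (hk : P ∈ level E k) {a b : Pt} (hab : HasEdge P a b) (hL : L ∈ S)
    (hm : midpoint ℝ a b ∈ L) : ∃ A ∈ D, A ∈ level E k ∧ HasEdge A a b := by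
  obtain ⟨j, hj⟩ := h.level_of_mem hL
  have hkj : k < j := by
    by_contra! hle
    exact G.midpoint_notMem_verts hle hk hab ⟨L, hj, hm⟩
  obtain ⟨A, hA, hl, hsub⟩ := h.ancestor_of_leaf G hkj hL hj
  exact ⟨A, hA, hl, (G.level k).edge_of_mem_hull hk hl hab midpoint_mem_openSegment
    (hsub (vertex_mem_hull hm))⟩

end Leaves

/-! ### The nodes of a quartet on the highest level -/

/-- The midpoint of an edge of a refined element on the highest level is a boundary node or a
hanging node, or the neighbour across this edge is refined as well. This is why no quartet on the
highest level is removed by the closure. -/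
theorem Leaves.hanging_or_boundary_or_neighbor {shape : Elem → Prop} {E D : Set Elem} {T : Mesh}
    (G : Grid shape E) (h : Leaves E D T.elems) (hT : NodesOK T) {k : ℕ}
    (hN : HeightLE E D (k + 1)) {P : Elem} (hP : P ∈ D) (hk : P ∈ level E k) {a b : Pt}
    (hab : HasEdge P a b) :
    IsHanging T (midpoint ℝ a b) ∨ IsBoundary T (midpoint ℝ a b) ∨
      ∃ P' ∈ D, P' ∈ level E k ∧ P' ≠ P ∧ HasEdge P' a b := by
  set m := midpoint ℝ a b with hm
  have hmo : m ∈ openSegment ℝ a b := midpoint_mem_openSegment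
  have hcS := h.children_subset G hN hP hk
  have sP := (G.level k).shape_mem P hk
  obtain ⟨K, hK, hmK⟩ := G.redShape.midpoint_child sP hab
  by_cases hb : IsBoundary T m
  · exact Or.inr (Or.inl hb)
  -- some leaf on the other side of the edge contains the midpoint
  have hL : ∃ L ∈ T.elems, L ∉ redChildren P ∧ m ∈ hull L := by
    set U := ⋃ K ∈ T.elems, hull K with hU
    have hmU : m ∈ U := Set.mem_biUnion (hcS hK) (vertex_mem_hull hmK)
    have hint : m ∈ interior U := by
      by_contra hni
      exact hb ⟨subset_closure hmU, hni⟩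
    obtain ⟨u, hu⟩ := (G.redShape.convex sP).exists_outside hab
      (openSegment_subset_segment ℝ _ _ hmo)
    set U' := ⋃ L ∈ T.elems \ redChildren P, hull L with hU'
    have hclosed : IsClosed U' :=
      ((h.finite G hN).subset Set.sdiff_subset).isClosed_biUnion fun L _ => isClosed_hull L
    have htend : Filter.Tendsto (fun t : ℝ => m + t • u) (nhdsWithin 0 (Set.Ioi 0)) (nhds m) := by
      have : Continuous fun t : ℝ => m + t • u := by fun_prop
      have h0 := this.tendsto 0
      simp only [zero_smul, add_zero] at h0
      exact h0.mono_left nhdsWithin_le_nhds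
    have hev : ∀ᶠ t : ℝ in nhdsWithin 0 (Set.Ioi 0), m + t • u ∈ U' := by
      filter_upwards [htend.eventually (isOpen_interior.mem_nhds hint), self_mem_nhdsWithin]
        with t ht ht0
      obtain ⟨L, hL, hmem⟩ := Set.mem_iUnion₂.1 (interior_subset ht)
      refine Set.mem_biUnion ⟨hL, fun hLP => ?_⟩ hmem
      exact hu t ht0 (G.redShape.hull_child sP hLP hmem)
    have := hclosed.mem_of_tendsto htend hev
    obtain ⟨L, hL, hmem⟩ := Set.mem_iUnion₂.1 this
    exact ⟨L, hL.1, hL.2, hmem⟩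
  obtain ⟨L, hL, hLP, hmL⟩ := hL
  obtain ⟨j, hj, hl⟩ := h.level_le G hN hL
  rcases hj.eq_or_lt with rfl | hj
  · obtain ⟨P', hP', hl', hc⟩ := h.parent_mem G hL hl
    refine Or.inr (Or.inr ⟨P', hP', hl', ?_, ?_⟩)
    · rintro rfl; exact hLP hc
    · exact (G.level k).edge_of_mem_hull hk hl' hab hmo
        (G.redShape.hull_child ((G.level k).shape_mem P' hl') hc hmL)
  · left
    refine ⟨(hT.2 m).2 ⟨K, hcS hK, hmK⟩, L, hL, ?_⟩
    obtain ⟨A, hA, hAl, hsub⟩ := h.ancestor G (by omega : j ≤ k) hP hk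
    have hne : L ≠ A := fun e => h.notMem hL (e ▸ hA)
    have hmA : m ∈ hull A := hsub (midpoint_mem_hull (vertex_mem_hull hab.left_mem)
      (vertex_mem_hull hab.right_mem))
    have hmem : m ∈ hull L ∩ hull A := ⟨hmL, hmA⟩
    have hnv := G.midpoint_notMem_verts (by omega : j ≤ k) hk hab
    rw [← hm] at hnv
    rcases (G.level j).fits L hl A hAl hne with e | ⟨v, hv, -, e⟩ | ⟨p, q, h1, h2, e⟩
    · rw [e] at hmem; exact absurd hmem (Set.notMem_empty _)
    · rw [e] at hmem
      obtain rfl : m = v := hmem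
      exact absurd ⟨L, hl, hv⟩ hnv
    · rw [e] at hmem
      refine ⟨p, q, h1, mem_openSegment_of_ne hmem ?_ ?_⟩
      · intro e'; exact hnv ⟨L, hl, e' ▸ h1.left_mem⟩
      · intro e'; exact hnv ⟨L, hl, e' ▸ h1.right_mem⟩

/-- Elements on the highest level have no irregular edges. -/
theorem not_hasIrregularEdge {shape : Elem → Prop} {E : Set Elem} (G : Grid shape E) {T : Mesh}
    {N : ℕ} (hv : ∀ v ∈ T.nodes, v ∈ verts (level E N)) {K : Elem} (hK : K ∈ level E N) :
    ¬ HasIrregularEdge T K := by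
  rintro ⟨a, b, hab, v, hvT, hvo⟩
  obtain ⟨L, hL, hvL⟩ := hv v hvT
  exact (G.level N).not_mem_openEdge hK hL hab hvL hvo

/-! ### The order of the nodes -/

theorem not_sublist_pair_of_nodup {l : List Pt} (hl : l.Nodup) {a b : Pt}
    (h1 : List.Sublist [a, b] l) (h2 : List.Sublist [b, a] l) : False := by
  induction l with
  | nil => simp at h1
  | cons x l ih =>
    rw [List.nodup_cons] at hl
    rw [List.sublist_cons_iff] at h1 h2
    rcases h1 with h1 | ⟨r, hr, h1⟩
    · rcases h2 with h2 | ⟨r, hr, h2⟩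
      · exact ih hl.2 h1 h2
      · simp only [List.cons.injEq] at hr
        exact hl.1 (hr.1 ▸ h1.subset (by simp))
    · simp only [List.cons.injEq] at hr
      obtain ⟨rfl, rfl⟩ := hr
      rcases h2 with h2 | ⟨r, hr, h2⟩
      · exact hl.1 (h2.subset (by simp))
      · simp only [List.cons.injEq] at hr
        obtain ⟨rfl, rfl⟩ := hr
        exact hl.1 (h2.subset (by simp))

namespace Older

variable {T : Mesh} {a b : Pt}

theorem asymm (hT : NodesOK T) (h : Older T a b) (h' : Older T b a) : False :=
  not_sublist_pair_of_nodup hT.1 h h'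

theorem of_append {T' : Mesh} (h : Older T a b) (hp : T.nodes <+: T'.nodes) : Older T' a b :=
  List.Sublist.trans h hp.sublist

end Older

theorem sublist_append_pair {l r : List Pt} {a b : Pt} (ha : a ∈ l) (hb : b ∈ r) :
    List.Sublist [a, b] (l ++ r) :=
  List.Sublist.append (List.singleton_sublist.2 ha) (List.singleton_sublist.2 hb)

/-- Appended nodes are younger than all previous nodes. -/
theorem sublist_pair_of_prefix {l l' : List Pt} (hp : l <+: l') {a b : Pt} (ha : a ∈ l)
    (hb : b ∈ l') (hbl : b ∉ l) : List.Sublist [a, b] l' := by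
  obtain ⟨r, rfl⟩ := hp
  exact sublist_append_pair ha ((List.mem_append.1 hb).resolve_left hbl)

theorem IsOldest.unique {T : Mesh} (hT : NodesOK T) {K : Elem} {a b : Pt} (ha : IsOldest T K a)
    (hb : IsOldest T K b) : a = b := by
  by_contra hne
  exact (ha.2 b hb.1 (Ne.symm hne)).asymm hT (hb.2 a ha.1 hne)

theorem mem_keepNodes {l : List Pt} {E : Set Elem} {v : Pt} :
    v ∈ keepNodes l E ↔ v ∈ l ∧ v ∈ verts E := by
  simp [keepNodes, verts]

theorem nodup_keepNodes {l : List Pt} (E : Set Elem) (h : l.Nodup) : (keepNodes l E).Nodup :=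
  h.filter _

theorem nodesOK_keepNodes {l : List Pt} {E : Set Elem} (h : l.Nodup) (hE : ∀ v ∈ verts E, v ∈ l) :
    NodesOK ⟨keepNodes l E, E⟩ :=
  ⟨nodup_keepNodes E h, fun v => by rw [mem_keepNodes]; exact ⟨fun h => h.2, fun h => ⟨hE v h, h⟩⟩⟩

theorem sublist_keepNodes {l : List Pt} {E : Set Elem} {a b : Pt} (h : List.Sublist [a, b] l)
    (ha : a ∈ verts E) (hb : b ∈ verts E) : List.Sublist [a, b] (keepNodes l E) := by
  have := h.filter (fun v => decide (∃ K ∈ E, v ∈ K))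
  rwa [List.filter_eq_self.2] at this
  intro v hv
  rcases List.mem_pair.1 hv with rfl | rfl
  · exact decide_eq_true ha
  · exact decide_eq_true hb

theorem prefix_keepNodes {l l' : List Pt} {E : Set Elem} (h : l <+: l')
    (hE : ∀ v ∈ l, v ∈ verts E) :
    l <+: keepNodes l' E := by
  have := h.filter (fun v => decide (∃ K ∈ E, v ∈ K))
  rwa [List.filter_eq_self.2] at this
  intro v hv
  exact decide_eq_true (hE v hv)

theorem keepNodes_eq_self {T : Mesh} (hT : NodesOK T) : keepNodes T.nodes T.elems = T.nodes :=
  List.filter_eq_self.2 fun v hv => decide_eq_true ((hT.2 v).1 hv)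

/-! ### Red refinements of the initial mesh -/

/-- `T` is a red refinement of `T₀` (as far as elements and the set of nodes are concerned) with
the set `D` of refined elements, all of whose levels are less than `N`. -/
structure RedTree (T₀ T : Mesh) (D : Set Elem) (N : ℕ) : Prop where
  leaves : Leaves T₀.elems D T.elems
  height : HeightLE T₀.elems D N
  nodesOK : NodesOK T
  initial_nodes : T₀.nodes <+: T.nodes

namespace RedTree

variable {shape : Elem → Prop} {T₀ T : Mesh} {D : Set Elem} {N : ℕ}

theorem init (h : IsInitialMesh shape T₀) : RedTree T₀ T₀ ∅ 0 :=
  ⟨Leaves.init _, by intro P hP; exact absurd hP (Set.notMem_empty _), h.2.1, List.prefix_rfl⟩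

theorem node_mem_verts (G : Grid shape T₀.elems) (h : RedTree T₀ T D N) :
    ∀ v ∈ T.nodes, v ∈ verts (level T₀.elems N) := fun v hv =>
  h.leaves.verts_subset G h.height ((h.nodesOK.2 v).1 hv)

theorem height_refine (G : Grid shape T₀.elems) (h : RedTree T₀ T D N) {R : Set Elem}
    (hR : R ⊆ T.elems) : HeightLE T₀.elems (D ∪ R) (N + 1) := by
  rintro P (hP | hP)
  · obtain ⟨k, hk, hl⟩ := h.height P hP
    exact ⟨k, by omega, hl⟩
  · obtain ⟨k, hk, hl⟩ := h.leaves.level_le G h.height (hR hP)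
    exact ⟨k, by omega, hl⟩

theorem refine (G : Grid shape T₀.elems) (h : RedTree T₀ T D N) {R : Set Elem} {T' : Mesh}
    (hR : RedRefineSet R T T') : RedTree T₀ T' (D ∪ R) (N + 1) :=
  ⟨hR.2.1 ▸ h.leaves.refine G hR.1, h.height_refine G hR.1, hR.2.2.2,
    h.initial_nodes.trans hR.2.2.1⟩

theorem elems_eq (h : RedTree T₀ T D 0) : T.elems = T₀.elems := by
  have : D = ∅ := Set.eq_empty_of_forall_notMem fun P hP => by
    obtain ⟨k, hk, -⟩ := h.height P hP
    omega
  rw [h.leaves.eq, this]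
  simp

theorem eq_initial_of_elems_eq (h₀ : NodesOK T₀) (h : RedTree T₀ T D N)
    (e : T.elems = T₀.elems) : T = T₀ := by
  refine Mesh.ext ?_ e
  obtain ⟨r, hr⟩ := h.initial_nodes
  have hn := h.nodesOK.1
  rw [← hr, List.nodup_append] at hn
  have : r = [] := by
    rw [List.eq_nil_iff_forall_not_mem]
    intro v hv
    have h1 : v ∈ T.nodes := by rw [← hr]; exact List.mem_append_right _ hv
    have h2 : v ∈ T₀.nodes := (h₀.2 v).2 (e ▸ (h.nodesOK.2 v).1 h1)
    exact hn.2.2 v h2 v hv rfl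
  rw [← hr, this, List.append_nil]

/-- Coarsening a set of quartets that contains all quartets on the highest level. -/
theorem coarsen (G : Grid shape T₀.elems) (h₀ : NodesOK T₀) (h : RedTree T₀ T D N)
    {A : Set (Set Elem)} (hA : A ⊆ {Q | ∃ P ∈ D, redChildren P ⊆ T.elems ∧ Q = redChildren P})
    (htop : ∀ P ∈ D, ∀ k, k + 1 = N → P ∈ level T₀.elems k → redChildren P ∈ A) :
    ∃ D' ⊆ D, RedTree T₀ (update T A) D' (N - 1) := by
  set C : Set Elem := {P | redChildren P ∈ A} with hC
  have hCD : ∀ P ∈ C, P ∈ D ∧ redChildren P ⊆ T.elems := by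
    intro P hP
    obtain ⟨P', hP', hsub, e⟩ := hA hP
    obtain ⟨k, hk⟩ := h.leaves.exists_level P' hP'
    have := G.redShape.injective ((G.level k).shape_mem P' hk) e
    subst this
    exact ⟨hP', hsub⟩
  have himg : redChildren '' C = A := by
    apply Set.Subset.antisymm
    · rintro _ ⟨P, hP, rfl⟩
      exact hP
    · intro Q hQ
      obtain ⟨P, hP, hsub, rfl⟩ := hA hQ
      exact ⟨P, hQ, rfl⟩
  have hl := h.leaves.coarsen G (fun P hP => (hCD P hP).1) (fun P hP => (hCD P hP).2)
  rw [himg] at hl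
  have hh : HeightLE T₀.elems (D \ C) (N - 1) := by
    intro P hP
    obtain ⟨k, hk, hlev⟩ := h.height P hP.1
    refine ⟨k, ?_, hlev⟩
    by_contra hlt
    exact hP.2 (htop P hP.1 k (by omega) hlev)
  have hv : ∀ v ∈ verts ((T.elems \ ⋃₀ A) ∪ C), v ∈ T.nodes := by
    rintro v ⟨K, hK | hK, hv⟩
    · exact (h.nodesOK.2 v).2 ⟨K, hK.1, hv⟩
    · obtain ⟨k, hk⟩ := h.leaves.exists_level K (hCD K hK).1
      obtain ⟨L, hL, hvL⟩ := G.redShape.vertex_child ((G.level k).shape_mem K hk) hv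
      exact (h.nodesOK.2 v).2 ⟨L, (hCD K hK).2 hL, hvL⟩
  refine ⟨D \ C, Set.sdiff_subset, hl, hh, nodesOK_keepNodes h.nodesOK.1 hv, ?_⟩
  refine prefix_keepNodes h.initial_nodes fun v hv' => ?_
  obtain ⟨K, hK, hvK⟩ := (h₀.2 v).1 hv'
  exact hl.mem_verts G hh (hl.mem_or_mem_of_base hK) hvK

theorem older_update {A : Set (Set Elem)} {D' : Set Elem} {M : ℕ}
    (h' : RedTree T₀ (update T A) D' M) {a b : Pt} (hab : Older T a b)
    (ha : a ∈ (update T A).nodes) (hb : b ∈ (update T A).nodes) : Older (update T A) a b :=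
  sublist_keepNodes hab ((h'.nodesOK.2 a).1 ha) ((h'.nodesOK.2 b).1 hb)

end RedTree

/-! ### The closure loop -/

theorem untilStable_subset {f : Set (Set Elem) → Set (Set Elem)} (hf : ∀ X, f X ⊆ X)
    (A : Set (Set Elem)) : untilStable f A ⊆ A := by
  unfold untilStable
  generalize sInf {n : ℕ | f^[n + 1] A = f^[n] A} = n
  induction n with
  | zero => exact subset_rfl
  | succ n ih =>
    rw [Function.iterate_succ_apply']
    exact (hf _).trans ih

theorem subset_untilStable {f : Set (Set Elem) → Set (Set Elem)} {B : Set (Set Elem)}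
    (hf : ∀ X, B ⊆ X → B ⊆ f X) {A : Set (Set Elem)} (hA : B ⊆ A) : B ⊆ untilStable f A := by
  unfold untilStable
  generalize sInf {n : ℕ | f^[n + 1] A = f^[n] A} = n
  induction n with
  | zero => exact hA
  | succ n ih =>
    rw [Function.iterate_succ_apply']
    exact hf _ ih

/-- A quartet on the highest level that contains a marked element passes the steps Mark and the
first part of Closure. -/
theorem RedTree.top_mem_unblocked {shape : Elem → Prop} {T₀ T : Mesh} {D : Set Elem} {k : ℕ}
    (G : Grid shape T₀.elems) (h : RedTree T₀ T D (k + 1)) {A : Set (Set Elem)} {marked : Set Elem}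
    (hA : ∀ P ∈ D, redChildren P ⊆ T.elems → redChildren P ∈ A)
    (hm : ∀ K ∈ T.elems, K ∈ level T₀.elems (k + 1) → K ∈ marked)
    {P : Elem} (hP : P ∈ D) (hk : P ∈ level T₀.elems k) :
    redChildren P ∈ unblocked T (markQuartets A marked) := by
  have hsub := h.leaves.children_subset G h.height hP hk
  have hl : ∀ K ∈ redChildren P, K ∈ level T₀.elems (k + 1) := fun K hK =>
    mem_level_succ.2 ⟨P, hk, hK⟩
  refine ⟨⟨hA P hP hsub, ?_⟩, fun K hK => not_hasIrregularEdge G (h.node_mem_verts G) (hl K hK)⟩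
  have sP := (G.level k).shape_mem P hk
  obtain ⟨v, hv⟩ := (G.redShape.convex sP).exists_mem
  obtain ⟨K, hK, -⟩ := G.redShape.vertex_child sP hv
  exact ⟨K, hm K (hsub hK) (hl K hK), hK⟩

/-- Different elements of a conforming family cannot touch each other in inner points of two
different edges. -/
theorem Grid.eq_of_two_edges {shape : Elem → Prop} {E : Set Elem} (G : Grid shape E) {K L : Elem}
    (hK : K ∈ E) (hL : L ∈ E) {a b c d x y : Pt} (h1 : HasEdge K a b) (h2 : HasEdge K c d)
    (hne : ¬ ((c = a ∧ d = b) ∨ (c = b ∧ d = a))) (hx : x ∈ openSegment ℝ a b)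
    (hy : y ∈ openSegment ℝ c d) (hxL : x ∈ hull L) (hyL : y ∈ hull L) : K = L := by
  by_contra hKL
  have mem : ∀ {p q z : Pt}, HasEdge K p q → z ∈ openSegment ℝ p q → z ∈ hull K := fun h hz =>
    segment_subset_hull (vertex_mem_hull h.left_mem) (vertex_mem_hull h.right_mem)
      (openSegment_subset_segment ℝ _ _ hz)
  have hx' : x ∈ hull K ∩ hull L := ⟨mem h1 hx, hxL⟩
  have hy' : y ∈ hull K ∩ hull L := ⟨mem h2 hy, hyL⟩
  have cK := G.convex hK
  rcases G.fits K hK L hL hKL with e | ⟨v, hv, -, e⟩ | ⟨p, q, h3, -, e⟩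
  · rw [e] at hx'; exact hx'
  · rw [e] at hx'
    obtain rfl : x = v := hx'
    exact cK.openEdge_not_mem h1 hx hv
  · rw [e] at hx' hy'
    have e1 := cK.edge_unique h1 h3 hx hx'
    have e2 := cK.edge_unique h2 h3 hy hy'
    rcases e1 with ⟨rfl, rfl⟩ | ⟨rfl, rfl⟩ <;> rcases e2 with ⟨h, h'⟩ | ⟨h, h'⟩ <;> simp_all

/-- A mesh different from the initial mesh has a refined element on its highest level. -/
theorem RedTree.exists_top {T₀ T : Mesh} {D : Set Elem} {N : ℕ} (h₀ : NodesOK T₀)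
    (h : RedTree T₀ T D N) (hne : T ≠ T₀) :
    ∃ k, RedTree T₀ T D (k + 1) ∧ ∃ P ∈ D, P ∈ level T₀.elems k := by
  induction N with
  | zero => exact absurd (h.eq_initial_of_elems_eq h₀ h.elems_eq) hne
  | succ N ih =>
    by_cases hP : ∃ P ∈ D, P ∈ level T₀.elems N
    · exact ⟨N, h, hP⟩
    · refine ih ⟨h.leaves, fun P hPD => ?_, h.nodesOK, h.initial_nodes⟩
      obtain ⟨k, hk, hl⟩ := h.height P hPD
      refine ⟨k, ?_, hl⟩
      by_contra hlt
      obtain rfl : k = N := by omega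
      exact hP ⟨P, hPD, hl⟩

/-! ### Admissible quartets of triangles -/

/-- The six points involved in the red refinement of a triangle are different. -/
theorem tri_points_ne {a b c : Pt} (h : 0 < cross a b c) :
    midpoint ℝ a b ≠ midpoint ℝ b c ∧ midpoint ℝ b c ≠ midpoint ℝ c a ∧
    midpoint ℝ c a ≠ midpoint ℝ a b ∧ a ≠ midpoint ℝ a b ∧ a ≠ midpoint ℝ b c ∧
    a ≠ midpoint ℝ c a ∧ b ≠ midpoint ℝ c a ∧ c ≠ midpoint ℝ a b := by
  have h1 : cross b c a = cross a b c := cross_rotate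
  have h2 : cross c a b = cross a b c := by rw [cross_rotate, cross_rotate]
  refine ⟨?_, ?_, ?_, ?_, ?_, ?_, ?_, ?_⟩ <;> intro e
  · have := congrArg (cross a b) e
    simp [cross_midpoint] at this; linarith
  · have := congrArg (cross b c) e
    simp [cross_midpoint] at this; linarith
  · have := congrArg (cross a b) e
    simp [cross_midpoint] at this; linarith
  · have := congrArg (cross c a) e
    simp [cross_midpoint] at this; linarith
  · have := congrArg (cross b c) e
    simp [cross_midpoint] at this; linarith
  · have := congrArg (cross a b) e
    simp [cross_midpoint] at this; linarith
  · have := congrArg (cross c a) e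
    simp [cross_midpoint] at this; linarith
  · have := congrArg (cross a b) e
    simp [cross_midpoint] at this; linarith

/-- The corner child at the vertex `a` of the triangle `a b c`. -/
noncomputable abbrev cornerTri (a b c : Pt) : Elem := tri a (midpoint ℝ a b) (midpoint ℝ c a)

/-- The middle child of the triangle `a b c`. -/
noncomputable abbrev middleTri (a b c : Pt) : Elem :=
  tri (midpoint ℝ a b) (midpoint ℝ b c) (midpoint ℝ c a)

theorem middleTri_rotate (a b c : Pt) : middleTri b c a = middleTri a b c := tri_rotate _ _ _

theorem mem_redChildren_tri {a b c : Pt} {K : Elem} : K ∈ redChildren (tri a b c) ↔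
    K = cornerTri a b c ∨ K = cornerTri b c a ∨ K = cornerTri c a b ∨ K = middleTri a b c := by
  rw [redChildren_tri]; rfl

/-- The vertices of a refined triangle are older than its edge midpoints. -/
def TriOrder (T : Mesh) (D : Set Elem) : Prop :=
  ∀ P ∈ D, ∀ p ∈ P, ∀ a b : Pt, HasEdge P a b → Older T p (midpoint ℝ a b)

section

variable {T₀ T : Mesh} {D : Set Elem} {N : ℕ}

/-- Only two children of a triangle have both edge midpoints next to `a` as vertices. -/
theorem eq_corner_or_middle {a b c : Pt} (hp : 0 < cross a b c) {L : Elem}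
    (hL : L ∈ redChildren (tri a b c)) (h1 : midpoint ℝ a b ∈ L) (h2 : midpoint ℝ c a ∈ L) :
    L = cornerTri a b c ∨ L = middleTri a b c := by
  obtain ⟨n1, n2, n3, n4, n5, n6, n7, n8⟩ := tri_points_ne hp
  rcases mem_redChildren_tri.1 hL with rfl | rfl | rfl | rfl
  · exact Or.inl rfl
  · rcases mem_tri.1 h2 with h | h | h
    · exact absurd h.symm n7
    · exact absurd h.symm n2
    · exact absurd h n3
  · rcases mem_tri.1 h1 with h | h | h
    · exact absurd h.symm n8
    · exact absurd h.symm n3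
    · exact absurd h n1
  · exact Or.inr rfl

theorem pos_of_level (G : Grid IsTriangle T₀.elems) {k : ℕ} {a b c : Pt}
    (hk : tri a b c ∈ level T₀.elems k) : 0 < cross a b c :=
  isTriangle_tri.1 ((G.level k).shape_mem _ hk)

theorem hasEdge_tri {a b c : Pt} : HasEdge (tri a b c) a b ∧ HasEdge (tri a b c) b c ∧
    HasEdge (tri a b c) c a :=
  ⟨Or.inl (hasSide_tri.2 (by simp)), Or.inl (hasSide_tri.2 (by simp)),
    Or.inl (hasSide_tri.2 (by simp))⟩

/-- The edge between a corner child and the middle child belongs to no other element of any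
uniform refinement. -/
theorem eq_of_inner_edge (G : Grid IsTriangle T₀.elems) {j k : ℕ} {a b c : Pt}
    (hk : tri a b c ∈ level T₀.elems k) {L : Elem} (hL : L ∈ level T₀.elems j)
    (he : HasEdge L (midpoint ℝ a b) (midpoint ℝ c a)) :
    L = cornerTri a b c ∨ L = middleTri a b c := by
  have hp := pos_of_level G hk
  obtain ⟨n1, n2, n3⟩ := ne_of_cross_pos hp
  have hM : cornerTri a b c ∈ level T₀.elems (k + 1) :=
    mem_level_succ.2 ⟨_, hk, mem_redChildren_tri.2 (Or.inl rfl)⟩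
  obtain rfl := G.level_eq_of_edge hM hL hasEdge_tri.2.1 he
  obtain ⟨P', hP', hc⟩ := mem_level_succ.1 hL
  have hsub := G.redShape.hull_child ((G.level k).shape_mem P' hP') hc
  have := (G.level k).eq_of_two_edges hk hP' hasEdge_tri.1 hasEdge_tri.2.2
    (by rintro (⟨h, -⟩ | ⟨h, -⟩); exacts [n3 h, n2 h.symm])
    midpoint_mem_openSegment midpoint_mem_openSegment
    (hsub (vertex_mem_hull he.left_mem)) (hsub (vertex_mem_hull he.right_mem))
  subst this
  exact eq_corner_or_middle hp hc he.left_mem he.right_mem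

/-- The child of a refined triangle at the vertex `p` has `p` as its oldest vertex. -/
theorem isOldest_corner (ord : TriOrder T D) {P K : Elem} (hP : P ∈ D) (sP : IsTriangle P)
    (hK : K ∈ redChildren P) {p : Pt} (hpP : p ∈ P) (hpK : p ∈ K) : IsOldest T K p := by
  refine ⟨hpK, fun v hv hvp => ?_⟩
  have hmid : ∀ x y, HasEdge P x y → p ≠ midpoint ℝ x y := fun x y h e =>
    sP.convex.openEdge_not_mem h midpoint_mem_openSegment (e ▸ hpP)
  have hP' := hP
  obtain ⟨a, b, c, rfl, hp⟩ := sP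
  obtain ⟨e1, e2, e3⟩ := hasEdge_tri (a := a) (b := b) (c := c)
  have m1 := hmid _ _ e1
  have m2 := hmid _ _ e2
  have m3 := hmid _ _ e3
  have o1 := ord _ hP p hpP _ _ e1
  have o2 := ord _ hP p hpP _ _ e2
  have o3 := ord _ hP p hpP _ _ e3
  rcases mem_redChildren_tri.1 hK with rfl | rfl | rfl | rfl <;>
    rcases mem_tri.1 hpK with h | h | h <;> try contradiction
  all_goals
    subst h
    rcases mem_tri.1 hv with rfl | rfl | rfl <;> first | contradiction | assumption

/-- All edges of a corner element are assigned the same node. -/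
theorem isEdgeOldest_corner (G : Grid IsTriangle T₀.elems) (h : RedTree T₀ T D N)
    (ord : TriOrder T D) {a b c : Pt} (hP : tri a b c ∈ D) (hK : cornerTri a b c ∈ T.elems) :
    ∀ x y : Pt, HasEdge (cornerTri a b c) x y → IsEdgeOldest T x y a := by
  obtain ⟨k, hk⟩ := h.leaves.exists_level _ hP
  have hp := pos_of_level G hk
  have hKc : cornerTri a b c ∈ redChildren (tri a b c) := mem_redChildren_tri.2 (Or.inl rfl)
  have hKl : cornerTri a b c ∈ level T₀.elems (k + 1) := mem_level_succ.2 ⟨_, hk, hKc⟩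
  have hold : IsOldest T (cornerTri a b c) a :=
    isOldest_corner ord hP (isTriangle_tri.2 hp) hKc (by simp) (by simp)
  intro x y hxy
  refine ⟨⟨_, hK, hxy, hold⟩, fun L hL hLxy w hw => ?_⟩
  obtain ⟨j, hj⟩ := h.leaves.level_of_mem hL
  have hsymm : ∀ p q, HasSide (cornerTri a b c) p q → HasEdge L p q →
      w = a ∨ Older T a w := by
    intro p q hpq hLpq
    obtain rfl := G.level_eq_of_edge hKl hj (Or.inl hpq) hLpq
    -- an edge on the boundary of the parent: the other element is a corner element at `a` as well
    have outer : ∀ z, HasEdge (tri a b c) a z → midpoint ℝ a z ∈ L → a ∈ L → w = a := by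
      intro z hz hm ha
      obtain ⟨P', hP', hl', hc'⟩ := h.leaves.parent_mem G hL hj
      have s' := (G.level k).shape_mem P' hl'
      have hez := (G.level k).edge_of_mem_hull hk hl' hz midpoint_mem_openSegment
        (G.redShape.hull_child s' hc' (vertex_mem_hull hm))
      exact hw.unique h.nodesOK (isOldest_corner ord hP' s' hc' hez.left_mem ha)
    rcases hasSide_tri.1 hpq with ⟨rfl, rfl⟩ | ⟨rfl, rfl⟩ | ⟨rfl, rfl⟩
    · exact Or.inl (outer b hasEdge_tri.1 hLpq.right_mem hLpq.left_mem)
    · rcases eq_of_inner_edge G hk hj hLpq with rfl | rfl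
      · exact Or.inl (hw.unique h.nodesOK hold)
      · right
        obtain ⟨e1, e2, e3⟩ := hasEdge_tri (a := a) (b := b) (c := c)
        rcases mem_tri.1 hw.1 with rfl | rfl | rfl
        · exact ord _ hP a (by simp) _ _ e1
        · exact ord _ hP a (by simp) _ _ e2
        · exact ord _ hP a (by simp) _ _ e3
    · refine Or.inl (outer c hasEdge_tri.2.2.symm ?_ hLpq.right_mem)
      rw [midpoint_comm]; exact hLpq.left_mem
  rcases hxy with hxy | hxy
  · exact hsymm x y hxy hLxy
  · exact hsymm y x hxy hLxy.symm

/-- The edge between a corner element and the middle element is assigned the corner. -/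
theorem eq_of_isEdgeOldest_inner (G : Grid IsTriangle T₀.elems) (h : RedTree T₀ T D N)
    (ord : TriOrder T D) {a b c : Pt} (hP : tri a b c ∈ D) (hK : cornerTri a b c ∈ T.elems) {v : Pt}
    (hv : IsEdgeOldest T (midpoint ℝ a b) (midpoint ℝ c a) v) : v = a := by
  obtain ⟨k, hk⟩ := h.leaves.exists_level _ hP
  have hp := pos_of_level G hk
  have hKc : cornerTri a b c ∈ redChildren (tri a b c) := mem_redChildren_tri.2 (Or.inl rfl)
  have hold : IsOldest T (cornerTri a b c) a :=
    isOldest_corner ord hP (isTriangle_tri.2 hp) hKc (by simp) (by simp)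
  obtain ⟨⟨L, hL, hLe, hLv⟩, h2⟩ := hv
  have h3 := h2 _ hK hasEdge_tri.2.1 a hold
  obtain ⟨j, hj⟩ := h.leaves.level_of_mem hL
  rcases eq_of_inner_edge G hk hj hLe with rfl | rfl
  · exact hLv.unique h.nodesOK hold
  · have : Older T a v := by
      obtain ⟨e1, e2, e3⟩ := hasEdge_tri (a := a) (b := b) (c := c)
      rcases mem_tri.1 hLv.1 with rfl | rfl | rfl
      · exact ord _ hP a (by simp) _ _ e1
      · exact ord _ hP a (by simp) _ _ e2
      · exact ord _ hP a (by simp) _ _ e3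
    rcases h3 with h3 | h3
    · exact h3.symm
    · exact (this.asymm h.nodesOK h3).elim

theorem corner_ne_middle {a b c : Pt} (hp : 0 < cross a b c) :
    cornerTri a b c ≠ middleTri a b c := by
  obtain ⟨n1, n2, n3, n4, n5, n6, n7, n8⟩ := tri_points_ne hp
  intro e
  have : a ∈ middleTri a b c := by rw [← e]; simp
  rcases mem_tri.1 this with h | h | h <;> contradiction

theorem hasEdge_middle (a b c : Pt) :
    HasEdge (middleTri a b c) (midpoint ℝ a b) (midpoint ℝ c a) :=
  hasEdge_tri.2.2.symm

/-- The direct neighbours of a middle element are the corner elements of the same quartet. -/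
theorem directNeighbors_middle (G : Grid IsTriangle T₀.elems) (h : RedTree T₀ T D N)
    {a b c : Pt} (hP : tri a b c ∈ D) :
    {L | L ∈ T.elems ∧ DirectNeighbor (middleTri a b c) L} =
      T.elems ∩ {cornerTri a b c, cornerTri b c a, cornerTri c a b} := by
  obtain ⟨k, hk⟩ := h.leaves.exists_level _ hP
  have hp := pos_of_level G hk
  have hk1 : tri b c a ∈ level T₀.elems k := by rwa [tri_rotate]
  have hk2 : tri c a b ∈ level T₀.elems k := by rwa [tri_rotate]
  have r1 := middleTri_rotate a b c
  have r2 : middleTri c a b = middleTri a b c := (middleTri_rotate b c a).trans r1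
  ext L
  simp only [Set.mem_ofPred_eq, Set.mem_inter_iff, Set.mem_insert_iff, Set.mem_singleton_iff]
  refine and_congr_right fun hL => ?_
  constructor
  · rintro ⟨hne, x, y, hx, hy⟩
    obtain ⟨j, hj⟩ := h.leaves.level_of_mem hL
    have key : ∀ x y, HasSide (middleTri a b c) x y → HasEdge L x y →
        L = cornerTri a b c ∨ L = cornerTri b c a ∨ L = cornerTri c a b := by
      intro x y hs he
      rcases hasSide_tri.1 hs with ⟨rfl, rfl⟩ | ⟨rfl, rfl⟩ | ⟨rfl, rfl⟩
      · rcases eq_of_inner_edge G hk1 hj he.symm with e | e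
        · exact Or.inr (Or.inl e)
        · exact absurd (e.trans r1).symm hne
      · rcases eq_of_inner_edge G hk2 hj he.symm with e | e
        · exact Or.inr (Or.inr e)
        · exact absurd (e.trans r2).symm hne
      · rcases eq_of_inner_edge G hk hj he.symm with e | e
        · exact Or.inl e
        · exact absurd e.symm hne
    rcases hx with hx | hx
    · exact key x y hx hy
    · exact key y x hx hy.symm
  · rintro (rfl | rfl | rfl)
    · exact ⟨(corner_ne_middle hp).symm, _, _, hasEdge_middle a b c, hasEdge_tri.2.1⟩
    · rw [← r1]
      exact ⟨(corner_ne_middle (pos_of_level G hk1)).symm, _, _, hasEdge_middle b c a,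
        hasEdge_tri.2.1⟩
    · rw [← r2]
      exact ⟨(corner_ne_middle (pos_of_level G hk2)).symm, _, _, hasEdge_middle c a b,
        hasEdge_tri.2.1⟩

theorem ncard_corners {a b c : Pt} (hp : 0 < cross a b c) :
    ({cornerTri a b c, cornerTri b c a, cornerTri c a b} : Set Elem).ncard = 3 := by
  have key : ∀ {a b c : Pt}, 0 < cross a b c → cornerTri a b c ≠ cornerTri b c a := by
    intro a b c hp e
    obtain ⟨n1, n2, n3, n4, n5, n6, n7, n8⟩ := tri_points_ne hp
    obtain ⟨n9, -, -⟩ := ne_of_cross_pos hp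
    have : a ∈ cornerTri b c a := by rw [← e]; simp
    rcases mem_tri.1 this with h | h | h <;> contradiction
  rw [Set.ncard_eq_three]
  refine ⟨_, _, _, key hp, (key ?_).symm, key ?_, rfl⟩
  · rwa [cross_rotate, cross_rotate]
  · rwa [cross_rotate]

/-- Exactly the quartets of leaves with a common parent are recognized as admissible. -/
theorem admissibleTri_eq (G : Grid IsTriangle T₀.elems) (h₀ : NodesOK T₀) (h : RedTree T₀ T D N)
    (ord : TriOrder T D) : admissibleTri {v | v ∈ T₀.nodes} T =
      {Q | ∃ P ∈ D, redChildren P ⊆ T.elems ∧ Q = redChildren P} := by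
  have union : ∀ a b c : Pt, ({middleTri a b c} : Set Elem) ∪
      {cornerTri a b c, cornerTri b c a, cornerTri c a b} = redChildren (tri a b c) := by
    intro a b c
    ext K
    simp only [Set.mem_union, Set.mem_insert_iff, Set.mem_singleton_iff]
    rw [mem_redChildren_tri]
    tauto
  ext Q
  constructor
  · rintro ⟨K, ⟨hK, hne, hN₀⟩, hcard, rfl⟩
    rcases (h.leaves.mem_iff.1 hK).1 with hE | ⟨P, hP, hKP⟩
    · obtain ⟨v, hv⟩ := (G.convex hE).exists_mem
      exact absurd ((h₀.2 v).2 ⟨K, hE, hv⟩) (hN₀ v hv)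
    · obtain ⟨k, hk⟩ := h.leaves.exists_level _ hP
      obtain ⟨a, b, c, rfl, hp⟩ := (G.level k).shape_mem P hk
      have hP1 : tri b c a ∈ D := by rwa [tri_rotate]
      have hP2 : tri c a b ∈ D := by rwa [tri_rotate]
      rcases mem_redChildren_tri.1 hKP with rfl | rfl | rfl | rfl
      · exact absurd ⟨a, isEdgeOldest_corner G h ord hP hK⟩ hne
      · exact absurd ⟨b, isEdgeOldest_corner G h ord hP1 hK⟩ hne
      · exact absurd ⟨c, isEdgeOldest_corner G h ord hP2 hK⟩ hne
      · rw [directNeighbors_middle G h hP] at hcard ⊢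
        have e := Set.eq_of_subset_of_ncard_le
          (show T.elems ∩ {cornerTri a b c, cornerTri b c a, cornerTri c a b} ⊆ _ from
            Set.inter_subset_right) (by rw [hcard, ncard_corners hp]) (Set.toFinite _)
        rw [e]
        refine ⟨_, hP, ?_, union a b c⟩
        rw [← union a b c]
        exact Set.union_subset (Set.singleton_subset_iff.2 hK) (Set.inter_eq_right.1 e)
  · rintro ⟨P, hP, hsub, rfl⟩
    obtain ⟨k, hk⟩ := h.leaves.exists_level _ hP
    obtain ⟨a, b, c, rfl, hp⟩ := (G.level k).shape_mem P hk
    have hcs : ({cornerTri a b c, cornerTri b c a, cornerTri c a b} : Set Elem) ⊆ T.elems := by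
      refine subset_trans ?_ hsub
      rw [← union]
      exact Set.subset_union_right
    have hM : middleTri a b c ∈ T.elems := hsub (mem_redChildren_tri.2 (by tauto))
    refine ⟨middleTri a b c, ⟨hM, ?_, ?_⟩, ?_, ?_⟩
    · rintro ⟨v, hv⟩
      have hP1 : tri b c a ∈ D := by rwa [tri_rotate]
      have e1 := eq_of_isEdgeOldest_inner G h ord hP (hcs (by simp))
        (hv _ _ (hasEdge_middle a b c))
      have e2 := eq_of_isEdgeOldest_inner G h ord hP1 (hcs (by simp))
        (hv _ _ (middleTri_rotate a b c ▸ hasEdge_middle b c a))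
      exact (ne_of_cross_pos hp).1 (e1.symm.trans e2)
    · have hnot : ∀ x y, HasEdge (tri a b c) x y → midpoint ℝ x y ∉ {v | v ∈ T₀.nodes} := by
        intro x y hxy hv
        exact G.midpoint_notMem_verts (Nat.zero_le k) hk hxy ((h₀.2 _).1 hv)
      intro v hv
      rcases mem_tri.1 hv with rfl | rfl | rfl
      · exact hnot _ _ hasEdge_tri.1
      · exact hnot _ _ hasEdge_tri.2.1
      · exact hnot _ _ hasEdge_tri.2.2
    · rw [directNeighbors_middle G h hP, Set.inter_eq_right.2 hcs, ncard_corners hp]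
    · rw [directNeighbors_middle G h hP, Set.inter_eq_right.2 hcs, union]

/-! ### Coarsening of triangular meshes -/

theorem stencilTri_redChildren {a b c : Pt} (hp : 0 < cross a b c) :
    stencilTri (redChildren (tri a b c)) = {v | v ∈ middleTri a b c} := by
  have hp1 : 0 < cross b c a := by rwa [cross_rotate]
  have hp2 : 0 < cross c a b := by rwa [cross_rotate]
  have r1 := middleTri_rotate a b c
  have r2 : middleTri c a b = middleTri a b c := (middleTri_rotate b c a).trans r1
  -- two corner elements have only one common vertex
  have key : ∀ {a b c : Pt}, 0 < cross a b c → ¬ DirectNeighbor (cornerTri a b c) (cornerTri b c a)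
      := by
    rintro a b c hp ⟨-, x, y, h1, h2⟩
    obtain ⟨n1, n2, n3, n4, n5, n6, n7, n8⟩ := tri_points_ne hp
    obtain ⟨n9, -, -⟩ := ne_of_cross_pos hp
    have only : ∀ v, v ∈ cornerTri a b c → v ∈ cornerTri b c a → v = midpoint ℝ a b := by
      intro v h1 h2
      rcases mem_tri.1 h1 with rfl | rfl | rfl
      · rcases mem_tri.1 h2 with h | h | h <;> contradiction
      · rfl
      · rcases mem_tri.1 h2 with h | h | h
        · exact absurd h.symm n7
        · exact absurd h.symm n2
        · exact h
    have hK : IsConvexElem (cornerTri a b c) := (cross_pos_of_child_tri hp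
      (mem_redChildren_tri.2 (Or.inl rfl))).convex
    exact hK.edge_ne h1 ((only x h1.left_mem h2.left_mem).trans
      (only y h1.right_mem h2.right_mem).symm)
  have ne : ∀ {a b c : Pt}, 0 < cross a b c → cornerTri b c a ≠ cornerTri a b c := by
    intro a b c hp e
    obtain ⟨n1, n2, n3, n4, n5, n6, n7, n8⟩ := tri_points_ne hp
    obtain ⟨n9, -, -⟩ := ne_of_cross_pos hp
    have : a ∈ cornerTri b c a := by rw [e]; simp
    rcases mem_tri.1 this with h | h | h <;> contradiction
  ext v
  constructor
  · rintro ⟨K, hK, hnb, hv⟩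
    rcases mem_redChildren_tri.1 hK with rfl | rfl | rfl | rfl
    · exact absurd (hnb _ (mem_redChildren_tri.2 (by tauto)) (ne hp)) (key hp)
    · exact absurd (hnb _ (mem_redChildren_tri.2 (by tauto)) (ne hp1)) (key hp1)
    · exact absurd (hnb _ (mem_redChildren_tri.2 (by tauto)) (ne hp2)) (key hp2)
    · exact hv
  · intro hv
    refine ⟨_, mem_redChildren_tri.2 (Or.inr (Or.inr (Or.inr rfl))), ?_, hv⟩
    intro L hL hne
    refine ⟨hne.symm, ?_⟩
    rcases mem_redChildren_tri.1 hL with rfl | rfl | rfl | rfl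
    · exact ⟨_, _, hasEdge_middle a b c, hasEdge_tri.2.1⟩
    · rw [← r1]
      exact ⟨_, _, hasEdge_middle b c a, hasEdge_tri.2.1⟩
    · rw [← r2]
      exact ⟨_, _, hasEdge_middle c a b, hasEdge_tri.2.1⟩
    · exact absurd rfl hne

theorem midpoint_mem_stencilTri {P : Elem} (sP : IsTriangle P) {x y : Pt} (h : HasEdge P x y) :
    midpoint ℝ x y ∈ stencilTri (redChildren P) := by
  obtain ⟨a, b, c, rfl, hp⟩ := sP
  rw [stencilTri_redChildren hp]
  have key : ∀ x y, HasSide (tri a b c) x y → midpoint ℝ x y ∈ middleTri a b c := by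
    intro x y h
    rcases hasSide_tri.1 h with ⟨rfl, rfl⟩ | ⟨rfl, rfl⟩ | ⟨rfl, rfl⟩ <;> simp
  rcases h with h | h
  · exact key x y h
  · rw [midpoint_comm]; exact key y x h

theorem quartetsTri_subset (rule : Bool) (N₀ : Set Pt) (T : Mesh) (marked : Set Elem) :
    quartetsTri rule N₀ T marked ⊆ admissibleTri N₀ T := by
  have h1 : unblocked T (markQuartets (admissibleTri N₀ T) marked) ⊆ admissibleTri N₀ T :=
    fun Q hQ => hQ.1.1
  unfold quartetsTri closureTri
  split
  · exact (untilStable_subset (fun X Q hQ => hQ.1) _).trans h1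
  · exact h1

/-- The quartets on the highest level survive the closure, because all weights are `2`. -/
theorem top_mem_quartetsTri (G : Grid IsTriangle T₀.elems) (h₀ : NodesOK T₀) {k : ℕ}
    (h : RedTree T₀ T D (k + 1)) (ord : TriOrder T D) (rule : Bool) {marked : Set Elem}
    (hm : ∀ K ∈ T.elems, K ∈ level T₀.elems (k + 1) → K ∈ marked)
    {P : Elem} (hP : P ∈ D) (hk : P ∈ level T₀.elems k) :
    redChildren P ∈ quartetsTri rule {v | v ∈ T₀.nodes} T marked := by
  have hun : ∀ P ∈ D, P ∈ level T₀.elems k → redChildren P ∈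
      unblocked T (markQuartets (admissibleTri {v | v ∈ T₀.nodes} T) marked) := fun P hP hk =>
    h.top_mem_unblocked G (fun P hP hsub => by
      rw [admissibleTri_eq G h₀ h ord]; exact ⟨P, hP, hsub, rfl⟩) hm hP hk
  unfold quartetsTri closureTri
  split
  swap
  · exact hun P hP hk
  set B : Set (Set Elem) := {Q | ∃ P ∈ D, P ∈ level T₀.elems k ∧ Q = redChildren P} with hB
  suffices B ⊆ untilStable (passTri T)
      (unblocked T (markQuartets (admissibleTri {v | v ∈ T₀.nodes} T) marked)) from
    this ⟨P, hP, hk, rfl⟩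
  refine subset_untilStable ?_ ?_
  · rintro X hX Q ⟨P, hP, hk, rfl⟩
    refine ⟨hX ⟨P, hP, hk, rfl⟩, ?_⟩
    have sP := (G.level k).shape_mem P hk
    have weight : ∀ x y, HasEdge P x y → weightTri T X (midpoint ℝ x y) = 2 := by
      intro x y hxy
      refine if_pos ?_
      rcases h.leaves.hanging_or_boundary_or_neighbor G h.nodesOK h.height hP hk hxy with
        h1 | h1 | ⟨P', hP', hk', hne, hxy'⟩
      · exact Or.inl h1
      · exact Or.inr (Or.inl h1)
      · refine Or.inr (Or.inr ⟨redChildren P, hX ⟨P, hP, hk, rfl⟩, redChildren P',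
          hX ⟨P', hP', hk', rfl⟩, fun e => hne (G.redShape.injective sP e.symm),
          midpoint_mem_stencilTri sP hxy,
          midpoint_mem_stencilTri ((G.level k).shape_mem P' hk') hxy'⟩)
    obtain ⟨a, b, c, rfl, hp⟩ := sP
    obtain ⟨n1, n2, n3, -⟩ := tri_points_ne hp
    have e : stencilTri (redChildren (tri a b c)) =
        (({midpoint ℝ a b, midpoint ℝ b c, midpoint ℝ c a} : Finset Pt) : Set Pt) := by
      rw [stencilTri_redChildren hp]
      ext v
      simp
    rw [e, finsum_mem_coe_finset, Finset.sum_insert (by simp [n1, n3.symm]),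
      Finset.sum_insert (by simpa using n2), Finset.sum_singleton, weight _ _ hasEdge_tri.1,
      weight _ _ hasEdge_tri.2.1, weight _ _ hasEdge_tri.2.2]
    norm_num
  · rintro Q ⟨P, hP, hk, rfl⟩
    exact hun P hP hk

theorem TriOrder.step {T' : Mesh} (ord : TriOrder T D) {R : Set Elem}
    (hR : RedRefineSet R T T')
    (hR' : ∀ P ∈ R, ∀ p ∈ P, ∀ a b : Pt, HasEdge P a b → Older T' p (midpoint ℝ a b)) :
    TriOrder T' (D ∪ R) := by
  rintro P (hP | hP) p hp a b hab
  · exact (ord P hP p hp a b hab).of_append hR.2.2.1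
  · exact hR' P hP p hp a b hab

/-- Every red refinement of a triangular mesh has a forest of refined elements. -/
theorem exists_redTree_tri (h₀ : IsInitialMesh IsTriangle T₀)
    (hT : RedRefinement TriStep T₀ T) : ∃ D N, RedTree T₀ T D N ∧ TriOrder T D := by
  have G := h₀.grid redShape_tri
  induction hT with
  | refl => exact ⟨∅, 0, RedTree.init h₀, fun P hP => absurd hP (Set.notMem_empty _)⟩
  | tail _ hstep ih =>
    obtain ⟨D, N, h, ord⟩ := ih
    obtain ⟨R, hR, hR'⟩ := hstep
    exact ⟨D ∪ R, N + 1, h.refine G hR, ord.step hR hR'⟩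

/-- CoarsenR reduces the highest level, provided that all elements on this level are marked. -/
theorem coarsenTri_redTree (G : Grid IsTriangle T₀.elems) (h₀ : NodesOK T₀)
    (h : RedTree T₀ T D N) (ord : TriOrder T D) (rule : Bool) {marked : Set Elem}
    (hm : ∀ K ∈ T.elems, K ∈ level T₀.elems N → K ∈ marked) :
    ∃ D', RedTree T₀ (coarsenTri rule {v | v ∈ T₀.nodes} T marked) D' (N - 1) ∧
      TriOrder (coarsenTri rule {v | v ∈ T₀.nodes} T marked) D' := by
  obtain ⟨D', hD', h'⟩ := h.coarsen G h₀
    (A := quartetsTri rule {v | v ∈ T₀.nodes} T marked)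
    (by rw [← admissibleTri_eq G h₀ h ord]; exact quartetsTri_subset _ _ _ _)
    (by rintro P hP k rfl hk; exact top_mem_quartetsTri G h₀ h ord rule hm hP hk)
  refine ⟨D', h', fun P hP p hp a b hab => ?_⟩
  obtain ⟨k, hk⟩ := h'.leaves.exists_level P hP
  obtain ⟨K, hK, hmK⟩ := G.redShape.midpoint_child ((G.level k).shape_mem P hk) hab
  exact h'.older_update (ord P (hD' hP) p hp a b hab)
    ((h'.nodesOK.2 _).2 (h'.leaves.mem_verts G h'.height (Or.inr hP) hp))
    ((h'.nodesOK.2 _).2 (h'.leaves.mem_verts G h'.height (h'.leaves.child_mem hP hK) hmK))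

end

/-! ### Admissible quartets of quadrilaterals -/

/-- The corner child at the vertex `a` of the quadrilateral `a b c d`. -/
noncomputable abbrev cornerQuad (a b c d : Pt) : Elem :=
  quad a (midpoint ℝ a b) (quadCenter a b c d) (midpoint ℝ d a)

theorem IsQuad.rotate {a b c d : Pt} (h : IsQuad (quad a b c d)) : IsQuad (quad b c d a) := by
  rwa [quad_rotate]

theorem mem_redChildren_quad {a b c d : Pt} {K : Elem} : K ∈ redChildren (quad a b c d) ↔
    K = cornerQuad a b c d ∨ K = cornerQuad b c d a ∨ K = cornerQuad c d a b ∨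
      K = cornerQuad d a b c := by
  have e1 := quadCenter_rotate a b c d
  have e2 := (quadCenter_rotate b c d a).trans e1
  have e3 := (quadCenter_rotate c d a b).trans e2
  rw [redChildren_quad]
  simp only [cornerQuad, e1, e2, e3, Set.mem_insert_iff, Set.mem_singleton_iff]

/-- Every child of a convex quadrilateral is a corner child, for a suitable numbering. -/
theorem exists_cornerQuad {P K : Elem} (hP : IsQuad P) (hK : K ∈ redChildren P) :
    ∃ a b c d, P = quad a b c d ∧ K = cornerQuad a b c d := by
  obtain ⟨a, b, c, d, rfl, -⟩ := hP
  rcases mem_redChildren_quad.1 hK with rfl | rfl | rfl | rfl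
  · exact ⟨_, _, _, _, rfl, rfl⟩
  · exact ⟨b, c, d, a, (quad_rotate _ _ _ _).symm, rfl⟩
  · exact ⟨c, d, a, b, quad_eq_iff.2 (by tauto), rfl⟩
  · exact ⟨d, a, b, c, quad_rotate _ _ _ _, rfl⟩

theorem cornerQuad_mem (a b c d : Pt) : cornerQuad a b c d ∈ redChildren (quad a b c d) :=
  mem_redChildren_quad.2 (Or.inl rfl)

theorem IsQuad.ne {a b c d : Pt} (h : IsQuad (quad a b c d)) :
    a ≠ b ∧ a ≠ c ∧ a ≠ d ∧ b ≠ c ∧ b ≠ d ∧ c ≠ d := by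
  obtain ⟨h1, h2, h3, h4⟩ := isQuad_quad.1 h
  obtain ⟨n1, n2, n3⟩ := ne_of_cross_pos h1
  obtain ⟨n4, n5, n6⟩ := ne_of_cross_pos h3
  obtain ⟨n7, n8, n9⟩ := ne_of_cross_pos h2
  exact ⟨n1, n3.symm, n5.symm, n2, n9.symm, n4⟩

theorem hasEdge_quad {a b c d : Pt} : HasEdge (quad a b c d) a b ∧ HasEdge (quad a b c d) b c ∧
    HasEdge (quad a b c d) c d ∧ HasEdge (quad a b c d) d a :=
  ⟨Or.inl (hasSide_quad.2 (by simp)), Or.inl (hasSide_quad.2 (by simp)),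
    Or.inl (hasSide_quad.2 (by simp)), Or.inl (hasSide_quad.2 (by simp))⟩

theorem cross_quadCenter_pos {a b c d : Pt} (h : IsQuad (quad a b c d)) {p q : Pt}
    (hs : HasSide (quad a b c d) p q) : 0 < cross p q (quadCenter a b c d) := by
  obtain ⟨h1, h2, h3, h4⟩ := isQuad_quad.1 h
  have key : 0 < cross p q a + cross p q b + cross p q c + cross p q d := by
    have hc := h.convex
    obtain ⟨v, hv, hvp, hvq⟩ := hc.exists_third hs
    have hpos := hc.side_pos hs v hv hvp hvq
    have n1 := hc.side_nonneg hs (v := a) (by simp)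
    have n2 := hc.side_nonneg hs (v := b) (by simp)
    have n3 := hc.side_nonneg hs (v := c) (by simp)
    have n4 := hc.side_nonneg hs (v := d) (by simp)
    rcases mem_quad.1 hv with rfl | rfl | rfl | rfl <;> linarith
  rw [cross_quadCenter]
  linarith

theorem quadCenter_notMem_segment {a b c d : Pt} (h : IsQuad (quad a b c d)) {p q : Pt}
    (he : HasEdge (quad a b c d) p q) : quadCenter a b c d ∉ segment ℝ p q := by
  intro hm
  rcases he with he | he
  · exact absurd (cross_segment hm) (cross_quadCenter_pos h he).ne'
  · rw [segment_symm] at hm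
    exact absurd (cross_segment hm) (cross_quadCenter_pos h he).ne'

theorem quadCenter_notMem {a b c d : Pt} (h : IsQuad (quad a b c d)) :
    quadCenter a b c d ∉ quad a b c d := by
  intro hm
  obtain ⟨q, hq⟩ := h.convex.exists_edge hm
  exact quadCenter_notMem_segment h hq (left_mem_segment ℝ _ _)

theorem quadCenter_mem_corner (a b c d : Pt) : quadCenter a b c d ∈ cornerQuad a b c d := by simp

theorem quadCenter_mem_child {a b c d : Pt} {K : Elem} (hK : K ∈ redChildren (quad a b c d)) :
    quadCenter a b c d ∈ K := by
  rw [redChildren_quad] at hK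
  rcases hK with rfl | rfl | rfl | rfl <;> simp

namespace Grid

variable {E : Set Elem}

/-- The center of a quadrilateral lies in no other element of the same level. -/
theorem eq_of_center_mem (G : Grid IsQuad E) {a b c d : Pt} {L : Elem} (hP : quad a b c d ∈ E)
    (hL : L ∈ E) (h : quadCenter a b c d ∈ hull L) : L = quad a b c d := by
  by_contra hne
  have hQ := G.shape_mem _ hP
  have hmem : quadCenter a b c d ∈ hull (quad a b c d) ∩ hull L := ⟨quadCenter_mem_hull a b c d, h⟩
  rcases G.fits _ hP L hL (Ne.symm hne) with e | ⟨v, hv, -, e⟩ | ⟨p, q, h1, -, e⟩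
  · rw [e] at hmem; exact hmem
  · rw [e] at hmem
    obtain rfl : quadCenter a b c d = v := hmem
    exact quadCenter_notMem hQ hv
  · rw [e] at hmem
    exact quadCenter_notMem_segment hQ h1 hmem

theorem center_notMem_verts (G : Grid IsQuad E) {j k : ℕ} (hjk : j ≤ k) {a b c d : Pt}
    (hP : quad a b c d ∈ AdaptMesh.level E k) :
    quadCenter a b c d ∉ verts (AdaptMesh.level E j) := by
  intro h
  obtain ⟨L, hL, hv⟩ := G.verts_mono hjk h
  have := (G.level k).eq_of_center_mem hP hL (vertex_mem_hull hv)
  subst this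
  exact quadCenter_notMem ((G.level k).shape_mem _ hP) hv

theorem center_mem_verts {k : ℕ} {a b c d : Pt}
    (hP : quad a b c d ∈ AdaptMesh.level E k) :
    quadCenter a b c d ∈ verts (AdaptMesh.level E (k + 1)) :=
  ⟨_, mem_level_succ.2 ⟨_, hP, cornerQuad_mem a b c d⟩, quadCenter_mem_corner a b c d⟩

theorem eq_of_center_eq (G : Grid IsQuad E) {i j : ℕ} {a b c d x y z w : Pt}
    (hP : quad a b c d ∈ AdaptMesh.level E i) (hP' : quad x y z w ∈ AdaptMesh.level E j)
    (e : quadCenter a b c d = quadCenter x y z w) : quad x y z w = quad a b c d := by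
  have m1 := center_mem_verts hP
  have m2 := center_mem_verts hP'
  obtain rfl : i = j := by
    rcases lt_trichotomy i j with h | h | h
    · rw [e] at m1
      exact absurd m1 (G.center_notMem_verts (by omega) hP')
    · exact h
    · rw [← e] at m2
      exact absurd m2 (G.center_notMem_verts (by omega) hP)
  refine (G.level i).eq_of_center_mem hP hP' ?_
  rw [e]
  exact quadCenter_mem_hull x y z w

end Grid

namespace Leaves

variable {E D S : Set Elem}

/-- A leaf that has the center of `P` as a vertex descends from `P`. -/
theorem mem_of_center_mem (G : Grid IsQuad E) (h : Leaves E D S) {k : ℕ} {a b c d : Pt}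
    (hk : quad a b c d ∈ level E k) {L : Elem} (hL : L ∈ S) (hz : quadCenter a b c d ∈ L) :
    quad a b c d ∈ D ∧ (L ∈ redChildren (quad a b c d) ∨
      ∃ K ∈ redChildren (quad a b c d), K ∈ D) := by
  obtain ⟨j, hj⟩ := h.level_of_mem hL
  have hkj : k < j := by
    by_contra! hle
    exact G.center_notMem_verts hle hk ⟨L, hj, hz⟩
  obtain ⟨i, rfl⟩ : ∃ i, j = i + 1 := ⟨j - 1, by omega⟩
  obtain ⟨Q, hQ, hQl, hLQ⟩ := h.parent_mem G hL hj
  have hsub := G.redShape.hull_child ((G.level i).shape_mem Q hQl) hLQ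
  rcases (by omega : k = i ∨ k + 1 ≤ i) with rfl | hki
  · have := (G.level k).eq_of_center_mem hk hQl (hsub (vertex_mem_hull hz))
    subst this
    exact ⟨hQ, Or.inl hLQ⟩
  · obtain ⟨A, hA, hAl, hsub'⟩ := h.ancestor G hki hQ hQl
    obtain ⟨B, hB, hBl, hAB⟩ := h.closed A hA k hAl
    have hsub'' := G.redShape.hull_child ((G.level k).shape_mem B hBl) hAB
    have := (G.level k).eq_of_center_mem hk hBl (hsub'' (hsub' (hsub (vertex_mem_hull hz))))
    subst this
    exact ⟨hB, Or.inr ⟨A, hAB, hA⟩⟩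

/-- If a midpoint or the center that belongs to the corner child at `a` is a vertex of a leaf, then
some refined element has the vertex `a`. -/
theorem exists_refined_of_corner (G : Grid IsQuad E) (h : Leaves E D S) {k : ℕ} {a b c d v : Pt}
    (hk : quad a b c d ∈ level E k) (hv : v ∈ cornerQuad a b c d) (hva : v ≠ a)
    (hvS : v ∈ verts S) : ∃ A ∈ D, a ∈ A := by
  obtain ⟨L, hL, hvL⟩ := hvS
  obtain ⟨e1, e2, e3, e4⟩ := hasEdge_quad (a := a) (b := b) (c := c) (d := d)
  rcases mem_quad.1 hv with rfl | rfl | rfl | rfl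
  · exact absurd rfl hva
  · obtain ⟨A, hA, -, he⟩ := h.edge_of_midpoint_mem G hk e1 hL hvL
    exact ⟨A, hA, he.left_mem⟩
  · exact ⟨_, (h.mem_of_center_mem G hk hL hvL).1, by simp⟩
  · obtain ⟨A, hA, -, he⟩ := h.edge_of_midpoint_mem G hk e4 hL hvL
    exact ⟨A, hA, he.right_mem⟩

end Leaves

/-- Every vertex of a (possible) quadrilateral is older than the new nodes of the child at this
vertex. This refers to all elements of the uniform refinements, as midpoints may occur in blue
patterns of elements that are not red-refined. -/
def QuadOrder (E : Set Elem) (l : List Pt) : Prop :=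
  ∀ k, ∀ a b c d : Pt, quad a b c d ∈ level E k →
    ∀ v ∈ cornerQuad a b c d, v ≠ a → v ∈ l → List.Sublist [a, v] l

theorem QuadOrder.append {E : Set Elem} {l l' : List Pt} (h : QuadOrder E l) (hp : l <+: l')
    (hnew : ∀ v ∈ l', v ∉ l → ∀ k, ∀ a b c d : Pt, quad a b c d ∈ level E k →
      v ∈ cornerQuad a b c d → v ≠ a → a ∈ l) : QuadOrder E l' := by
  intro k a b c d hk v hv hva hvl
  by_cases hl : v ∈ l
  · exact (h k a b c d hk v hv hva hl).trans hp.sublist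
  · exact sublist_pair_of_prefix hp (hnew v hvl hl k a b c d hk hv hva) hvl hl

theorem QuadOrder.keepNodes {E D S : Set Elem} {l : List Pt} (G : Grid IsQuad E)
    (h : QuadOrder E l) (hS : Leaves E D S) {N : ℕ} (hN : HeightLE E D N) :
    QuadOrder E (keepNodes l S) := by
  intro k a b c d hk v hv hva hvl
  obtain ⟨h1, h2⟩ := mem_keepNodes.1 hvl
  obtain ⟨A, hA, haA⟩ := hS.exists_refined_of_corner G hk hv hva h2
  exact sublist_keepNodes (h k a b c d hk v hv hva h1) (hS.mem_verts G hN (Or.inr hA) haA) h2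

section

variable {T₀ T : Mesh} {D : Set Elem} {N : ℕ}

theorem quad_of_level (G : Grid IsQuad T₀.elems) {k : ℕ} {P : Elem}
    (hk : P ∈ level T₀.elems k) : IsQuad P := (G.level k).shape_mem _ hk

/-- The third vertex of a corner child is the center of its parent. -/
theorem isThird_corner (h : NodesOK T) (ord : QuadOrder T₀.elems T.nodes) {k : ℕ} {a b c d : Pt}
    (hQ : IsQuad (quad a b c d))
    (hk : quad a b c d ∈ level T₀.elems k) (hK : cornerQuad a b c d ∈ T.elems) {v : Pt} :
    IsThird T (cornerQuad a b c d) v ↔ v = quadCenter a b c d := by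
  have hold : IsOldest T (cornerQuad a b c d) a :=
    ⟨by simp, fun w hw hwa => ord k a b c d hk w hw hwa ((h.2 w).2 ⟨_, hK, hw⟩)⟩
  obtain ⟨n1, n2, n3, -⟩ := (isQuad_child hQ (cornerQuad_mem a b c d)).ne
  constructor
  · rintro ⟨x, y, w, e, hx⟩
    obtain rfl := hx.unique h hold
    rcases quad_eq_iff.1 e with ⟨-, -, e, -⟩ | ⟨e, -⟩ | ⟨e, -⟩ | ⟨e, -⟩
    · exact e
    · exact absurd e n1
    · exact absurd e n2
    · exact absurd e n3
  · rintro rfl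
    exact ⟨_, _, _, rfl, hold⟩

theorem midpoint_ne_vertex {P : Elem} (hP : IsConvexElem P) {x y v : Pt} (h : HasEdge P x y)
    (hv : v ∈ P) : v ≠ midpoint ℝ x y := fun e =>
  hP.openEdge_not_mem h midpoint_mem_openSegment (e ▸ hv)

/-- The only vertex that a corner child has in common with its parent is the corner. -/
theorem eq_of_mem_cornerQuad {a b c d v : Pt} (hQ : IsQuad (quad a b c d)) (hv : v ∈ quad a b c d)
    (h : v ∈ cornerQuad a b c d) : v = a := by
  obtain ⟨e1, e2, e3, e4⟩ := hasEdge_quad (a := a) (b := b) (c := c) (d := d)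
  rcases mem_quad.1 h with h | h | h | h
  · exact h
  · exact absurd h (midpoint_ne_vertex hQ.convex e1 hv)
  · exact absurd (h ▸ hv) (quadCenter_notMem hQ)
  · exact absurd h (midpoint_ne_vertex hQ.convex e4 hv)

theorem ncard_redChildren_quad {a b c d : Pt} (hQ : IsQuad (quad a b c d)) :
    (redChildren (quad a b c d)).ncard = 4 := by
  have h1 := hQ.rotate
  have h2 := h1.rotate
  have h3 := h2.rotate
  obtain ⟨n1, n2, n3, n4, n5, n6⟩ := hQ.ne
  have key : ∀ {a b c d p x y z : Pt}, IsQuad (quad p x y z) → a ≠ p → a ∈ quad p x y z →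
      cornerQuad a b c d ≠ cornerQuad p x y z := fun hQ hne hm e =>
    hne (eq_of_mem_cornerQuad hQ hm (by rw [← e]; simp))
  have e : redChildren (quad a b c d) = insert (cornerQuad a b c d)
      {cornerQuad b c d a, cornerQuad c d a b, cornerQuad d a b c} := by
    ext K
    simp only [mem_redChildren_quad, Set.mem_insert_iff, Set.mem_singleton_iff]
  rw [e, Set.ncard_insert_of_notMem, Set.ncard_eq_three.2]
  · exact ⟨_, _, _, key h2 n4 (by simp), key h3 n5 (by simp), key h3 n6 (by simp), rfl⟩
  · simp only [Set.mem_insert_iff, Set.mem_singleton_iff, not_or]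
    exact ⟨key h1 n1 (by simp), key h2 n2 (by simp), key h3 n3 (by simp)⟩

/-- Exactly the quartets of leaves with a common parent are recognized as admissible. -/
theorem admissibleQuad_eq (G : Grid IsQuad T₀.elems) (h₀ : NodesOK T₀) (h : RedTree T₀ T D N)
    (ord : QuadOrder T₀.elems T.nodes) : admissibleQuad {v | v ∈ T₀.nodes} T =
      {Q | ∃ P ∈ D, redChildren P ⊆ T.elems ∧ Q = redChildren P} := by
  have third : ∀ K ∈ T.elems, ∀ v, v ∉ {v | v ∈ T₀.nodes} → IsThird T K v →
      ∃ a b c d, quad a b c d ∈ D ∧ K ∈ redChildren (quad a b c d) ∧ v = quadCenter a b c d := by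
    intro K hK v hv ht
    rcases (h.leaves.mem_iff.1 hK).1 with hE | ⟨P, hP, hKP⟩
    · obtain ⟨a, b, d, rfl, -⟩ := ht
      exact absurd ((h₀.2 v).2 ⟨_, hE, by simp⟩) hv
    · obtain ⟨k, hk⟩ := h.leaves.exists_level _ hP
      obtain ⟨a, b, c, d, rfl, rfl⟩ := exists_cornerQuad (quad_of_level G hk) hKP
      exact ⟨a, b, c, d, hP, hKP, (isThird_corner h.nodesOK ord (quad_of_level G hk) hk hK).1 ht⟩
  have all : ∀ a b c d, quad a b c d ∈ D → redChildren (quad a b c d) ⊆ T.elems →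
      {K | K ∈ T.elems ∧ quadCenter a b c d ∈ K} = redChildren (quad a b c d) := by
    intro a b c d hP hsub
    obtain ⟨k, hk⟩ := h.leaves.exists_level _ hP
    ext L
    refine ⟨fun hL => ?_, fun hL => ⟨hsub hL, quadCenter_mem_child hL⟩⟩
    rcases (h.leaves.mem_of_center_mem G hk hL.1 hL.2).2 with h' | ⟨K, hK, hKD⟩
    · exact h'
    · exact absurd hKD (h.leaves.notMem (hsub hK))
  ext Q
  constructor
  · rintro ⟨v, ⟨K, hK, hKv⟩, hcard, hv, rfl⟩
    obtain ⟨a, b, c, d, hP, -, rfl⟩ := third K hK v hv hKv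
    obtain ⟨k, hk⟩ := h.leaves.exists_level _ hP
    have hsub : {K | K ∈ T.elems ∧ IsThird T K (quadCenter a b c d)} ⊆
        redChildren (quad a b c d) := by
      rintro L ⟨hL, hLv⟩
      obtain ⟨x, y, z, w, hP', hLP', e⟩ := third L hL _ hv hLv
      obtain ⟨j, hj⟩ := h.leaves.exists_level _ hP'
      rwa [G.eq_of_center_eq hk hj e] at hLP'
    have e := Set.eq_of_subset_of_ncard_le hsub
      (by rw [hcard, ncard_redChildren_quad (quad_of_level G hk)])
      (G.redShape.finite_children (quad_of_level G hk))
    have hsub' : redChildren (quad a b c d) ⊆ T.elems := by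
      rw [← e]; exact fun L hL => hL.1
    exact ⟨_, hP, hsub', all a b c d hP hsub'⟩
  · rintro ⟨P, hP, hsub, rfl⟩
    obtain ⟨k, hk⟩ := h.leaves.exists_level _ hP
    have hQ := quad_of_level G hk
    have hQ' := hQ
    obtain ⟨a, b, c, d, rfl, -⟩ := hQ'
    have ht : ∀ K ∈ redChildren (quad a b c d), IsThird T K (quadCenter a b c d) := by
      intro K hK
      obtain ⟨x, y, z, w, e, rfl⟩ := exists_cornerQuad hQ hK
      rw [e] at hk hQ
      have hc : quadCenter a b c d = quadCenter x y z w := by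
        rcases quad_eq_iff.1 e with ⟨rfl, rfl, rfl, rfl⟩ | ⟨rfl, rfl, rfl, rfl⟩ |
          ⟨rfl, rfl, rfl, rfl⟩ | ⟨rfl, rfl, rfl, rfl⟩ <;> ext <;> simp <;> ring
      exact (isThird_corner h.nodesOK ord hQ hk (hsub hK)).2 hc
    refine ⟨quadCenter a b c d, ⟨_, hsub (cornerQuad_mem a b c d), ht _ (cornerQuad_mem a b c d)⟩,
      ?_, ?_, (all a b c d hP hsub).symm⟩
    · rw [← ncard_redChildren_quad hQ]
      congr 1
      ext L
      refine ⟨fun hL => ?_, fun hL => ⟨hsub hL, ht L hL⟩⟩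
      rw [← all a b c d hP hsub]
      obtain ⟨x, y, w, e, -⟩ := hL.2
      exact ⟨hL.1, by rw [e]; simp⟩
    · intro hv
      exact G.center_notMem_verts (Nat.zero_le k) hk ((h₀.2 _).1 hv)

/-! ### Coarsening of quadrilateral meshes -/

theorem quad_midpoints_ne {a b c d : Pt} (hQ : IsQuad (quad a b c d)) :
    midpoint ℝ a b ≠ midpoint ℝ b c ∧ midpoint ℝ a b ≠ midpoint ℝ c d ∧
    midpoint ℝ a b ≠ midpoint ℝ d a ∧ midpoint ℝ b c ≠ midpoint ℝ c d ∧
    midpoint ℝ b c ≠ midpoint ℝ d a ∧ midpoint ℝ c d ≠ midpoint ℝ d a := by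
  obtain ⟨h1, h2, h3, h4⟩ := isQuad_quad.1 hQ
  have e1 : cross a b d = cross d a b := cross_rotate
  have e2 : cross b c a = cross a b c := cross_rotate
  have e3 : cross c d b = cross b c d := cross_rotate
  refine ⟨?_, ?_, ?_, ?_, ?_, ?_⟩ <;> intro e
  · have := congrArg (cross a b) e
    simp [cross_midpoint] at this; linarith
  · have := congrArg (cross a b) e
    simp [cross_midpoint] at this; linarith
  · have := congrArg (cross a b) e
    simp [cross_midpoint] at this; linarith
  · have := congrArg (cross b c) e
    simp [cross_midpoint] at this; linarith
  · have := congrArg (cross b c) e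
    simp [cross_midpoint] at this; linarith
  · have := congrArg (cross c d) e
    simp [cross_midpoint] at this; linarith

theorem quadCenter_ne_midpoint {a b c d x y : Pt} (hQ : IsQuad (quad a b c d))
    (h : HasEdge (quad a b c d) x y) : quadCenter a b c d ≠ midpoint ℝ x y := fun e =>
  quadCenter_notMem_segment hQ h
    (e ▸ openSegment_subset_segment ℝ _ _ midpoint_mem_openSegment)

theorem isMiddleNode_redChildren {a b c d : Pt} (hQ : IsQuad (quad a b c d)) {v : Pt} :
    IsMiddleNode (redChildren (quad a b c d)) v ↔ v = quadCenter a b c d := by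
  constructor
  · intro hv
    have h1 := hv _ (mem_redChildren_quad.2 (Or.inl rfl))
    have h2 := hv _ (mem_redChildren_quad.2 (Or.inr (Or.inr (Or.inl rfl))))
    have e : quadCenter c d a b = quadCenter a b c d :=
      (quadCenter_rotate b c d a).trans (quadCenter_rotate a b c d)
    obtain ⟨n1, n2, n3, n4, n5, n6⟩ := quad_midpoints_ne hQ
    obtain ⟨-, n8, -⟩ := hQ.ne
    obtain ⟨e1, e2, e3, e4⟩ := hasEdge_quad (a := a) (b := b) (c := c) (d := d)
    rcases mem_quad.1 h2 with h | h | h | h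
    · subst h
      exact absurd (eq_of_mem_cornerQuad hQ (by simp) h1).symm n8
    · subst h
      rcases mem_quad.1 h1 with h | h | h | h
      · exact absurd h.symm (midpoint_ne_vertex hQ.convex e3 (by simp))
      · exact absurd h.symm n2
      · exact h
      · exact absurd h n6
    · exact h.trans e
    · subst h
      rcases mem_quad.1 h1 with h | h | h | h
      · exact absurd h.symm (midpoint_ne_vertex hQ.convex e2 (by simp))
      · exact absurd h.symm n1
      · exact h
      · exact absurd h n5
  · rintro rfl K hK
    exact quadCenter_mem_child hK

theorem hasEdge_opposite {a b c d v : Pt} (hQ : IsQuad (quad a b c d)) :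
    HasEdge (quad a b c d) c v ↔ v = b ∨ v = d := by
  obtain ⟨n1, n2, n3, n4, n5, n6⟩ := hQ.ne
  constructor
  · rintro (h | h)
    · rcases hasSide_quad.1 h with ⟨h, -⟩ | ⟨h, -⟩ | ⟨-, rfl⟩ | ⟨h, -⟩
      · exact absurd h.symm n2
      · exact absurd h.symm n4
      · exact Or.inr rfl
      · exact absurd h n6
    · rcases hasSide_quad.1 h with ⟨-, h⟩ | ⟨rfl, -⟩ | ⟨-, h⟩ | ⟨-, h⟩
      · exact absurd h.symm n4
      · exact Or.inl rfl
      · exact absurd h n6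
      · exact absurd h.symm n2
  · rintro (rfl | rfl)
    · exact hasEdge_quad.2.1.symm
    · exact hasEdge_quad.2.2.1

theorem stencilQuad_redChildren {a b c d : Pt} (hQ : IsQuad (quad a b c d)) :
    stencilQuad (redChildren (quad a b c d)) = {quadCenter a b c d, midpoint ℝ a b,
      midpoint ℝ b c, midpoint ℝ c d, midpoint ℝ d a} := by
  have e1 := quadCenter_rotate a b c d
  have e2 := (quadCenter_rotate b c d a).trans e1
  have e3 := (quadCenter_rotate c d a b).trans e2
  have k : ∀ {K}, K ∈ redChildren (quad a b c d) → IsQuad K := isQuad_child hQ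
  ext v
  simp only [stencilQuad, isMiddleNode_redChildren hQ, Set.mem_ofPred_eq, exists_eq_left,
    Set.mem_insert_iff, Set.mem_singleton_iff]
  refine or_congr_right ?_
  constructor
  · rintro ⟨K, hK, he⟩
    have hKQ := k hK
    rcases mem_redChildren_quad.1 hK with rfl | rfl | rfl | rfl
    · have := (hasEdge_opposite hKQ).1 he; tauto
    · have := (hasEdge_opposite hKQ).1 (e1.symm ▸ he); tauto
    · have := (hasEdge_opposite hKQ).1 (e2.symm ▸ he); tauto
    · have := (hasEdge_opposite hKQ).1 (e3.symm ▸ he); tauto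
  · have m1 : cornerQuad a b c d ∈ redChildren (quad a b c d) :=
      mem_redChildren_quad.2 (Or.inl rfl)
    have m3 : cornerQuad c d a b ∈ redChildren (quad a b c d) :=
      mem_redChildren_quad.2 (Or.inr (Or.inr (Or.inl rfl)))
    have o1 := fun v => hasEdge_opposite (v := v) (k m1)
    have o3 := fun v => hasEdge_opposite (v := v) (k m3)
    rw [e2] at o3
    rintro (h | h | h | h)
    · exact ⟨_, m1, (o1 v).2 (Or.inl h)⟩
    · exact ⟨_, m3, by simpa only [cornerQuad, e2] using (o3 v).2 (Or.inr h)⟩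
    · exact ⟨_, m3, by simpa only [cornerQuad, e2] using (o3 v).2 (Or.inl h)⟩
    · exact ⟨_, m1, (o1 v).2 (Or.inr h)⟩

theorem midpoint_mem_stencilQuad {P : Elem} (sP : IsQuad P) {x y : Pt} (h : HasEdge P x y) :
    midpoint ℝ x y ∈ stencilQuad (redChildren P) := by
  have sP' := sP
  obtain ⟨a, b, c, d, rfl, -⟩ := sP'
  rw [stencilQuad_redChildren sP]
  have key : ∀ x y, HasSide (quad a b c d) x y → midpoint ℝ x y ∈ ({quadCenter a b c d,
      midpoint ℝ a b, midpoint ℝ b c, midpoint ℝ c d, midpoint ℝ d a} : Set Pt) := by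
    intro x y h
    rcases hasSide_quad.1 h with ⟨rfl, rfl⟩ | ⟨rfl, rfl⟩ | ⟨rfl, rfl⟩ | ⟨rfl, rfl⟩ <;>
      simp only [Set.mem_insert_iff, Set.mem_singleton_iff, true_or, or_true]
  rcases h with h | h
  · exact key x y h
  · have e : midpoint ℝ x y = midpoint ℝ y x := midpoint_comm ..
    rw [e]; exact key y x h

theorem quartetsQuad_subset (N₀ : Set Pt) (T : Mesh) (marked : Set Elem) :
    quartetsQuad N₀ T marked ⊆ admissibleQuad N₀ T :=
  (untilStable_subset (fun _ _ hQ => hQ.1) _).trans fun _ hQ => hQ.1.1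

/-- The quartets on the highest level survive the closure, because all weights except that of the
middle node are `2`. -/
theorem top_mem_quartetsQuad (G : Grid IsQuad T₀.elems) (h₀ : NodesOK T₀) {k : ℕ}
    (h : RedTree T₀ T D (k + 1)) (ord : QuadOrder T₀.elems T.nodes) {marked : Set Elem}
    (hm : ∀ K ∈ T.elems, K ∈ level T₀.elems (k + 1) → K ∈ marked)
    {P : Elem} (hP : P ∈ D) (hk : P ∈ level T₀.elems k) :
    redChildren P ∈ quartetsQuad {v | v ∈ T₀.nodes} T marked := by
  have hun : ∀ P ∈ D, P ∈ level T₀.elems k → redChildren P ∈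
      unblocked T (markQuartets (admissibleQuad {v | v ∈ T₀.nodes} T) marked) := fun P hP hk =>
    h.top_mem_unblocked G (fun P hP hsub => by
      rw [admissibleQuad_eq G h₀ h ord]; exact ⟨P, hP, hsub, rfl⟩) hm hP hk
  set B : Set (Set Elem) := {Q | ∃ P ∈ D, P ∈ level T₀.elems k ∧ Q = redChildren P} with hB
  suffices B ⊆ untilStable (passQuad T)
      (unblocked T (markQuartets (admissibleQuad {v | v ∈ T₀.nodes} T) marked)) from
    this ⟨P, hP, hk, rfl⟩
  refine subset_untilStable ?_ ?_
  · rintro X hX Q ⟨P, hP, hk, rfl⟩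
    refine ⟨hX ⟨P, hP, hk, rfl⟩, ?_⟩
    have sP := quad_of_level G hk
    have sP' := sP
    obtain ⟨a, b, c, d, rfl, -⟩ := sP'
    have weight : ∀ x y, HasEdge (quad a b c d) x y →
        weightQuad T X (redChildren (quad a b c d)) (midpoint ℝ x y) = 2 := by
      intro x y hxy
      unfold weightQuad
      rw [if_neg, if_pos]
      · rcases h.leaves.hanging_or_boundary_or_neighbor G h.nodesOK h.height hP hk hxy with
          h1 | h1 | ⟨P', hP', hk', hne, hxy'⟩
        · exact Or.inl h1
        · exact Or.inr (Or.inl h1)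
        · exact Or.inr (Or.inr ⟨_, hX ⟨_, hP, hk, rfl⟩, redChildren P',
            hX ⟨P', hP', hk', rfl⟩, fun e => hne (G.redShape.injective sP e.symm),
            midpoint_mem_stencilQuad sP hxy,
            midpoint_mem_stencilQuad (quad_of_level G hk') hxy'⟩)
      · rw [isMiddleNode_redChildren sP]
        exact (quadCenter_ne_midpoint sP hxy).symm
    have weight0 : weightQuad T X (redChildren (quad a b c d)) (quadCenter a b c d) = 0 :=
      if_pos ((isMiddleNode_redChildren sP).2 rfl)
    obtain ⟨n1, n2, n3, n4, n5, n6⟩ := quad_midpoints_ne sP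
    obtain ⟨e1, e2, e3, e4⟩ := hasEdge_quad (a := a) (b := b) (c := c) (d := d)
    have z1 := quadCenter_ne_midpoint sP e1
    have z2 := quadCenter_ne_midpoint sP e2
    have z3 := quadCenter_ne_midpoint sP e3
    have z4 := quadCenter_ne_midpoint sP e4
    have e : stencilQuad (redChildren (quad a b c d)) =
        (({quadCenter a b c d, midpoint ℝ a b, midpoint ℝ b c, midpoint ℝ c d,
          midpoint ℝ d a} : Finset Pt) : Set Pt) := by
      rw [stencilQuad_redChildren sP]
      simp only [Finset.coe_insert, Finset.coe_singleton]
    rw [e, finsum_mem_coe_finset,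
      Finset.sum_insert (by simp only [Finset.mem_insert, Finset.mem_singleton]; tauto),
      Finset.sum_insert (by simp only [Finset.mem_insert, Finset.mem_singleton]; tauto),
      Finset.sum_insert (by simp only [Finset.mem_insert, Finset.mem_singleton]; tauto),
      Finset.sum_insert (by simp only [Finset.mem_singleton]; tauto),
      Finset.sum_singleton, weight0, weight _ _ e1, weight _ _ e2, weight _ _ e3, weight _ _ e4]
    norm_num
  · rintro Q ⟨P, hP, hk, rfl⟩
    exact hun P hP hk

theorem QuadOrder.init (G : Grid IsQuad T₀.elems) (h₀ : NodesOK T₀) :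
    QuadOrder T₀.elems T₀.nodes := by
  intro k a b c d hk v hv hva hvl
  obtain ⟨A, hA, -⟩ := (Leaves.init T₀.elems).exists_refined_of_corner G hk hv hva ((h₀.2 v).1 hvl)
  exact absurd hA (Set.notMem_empty _)

theorem QuadOrder.step {T' : Mesh} (G : Grid IsQuad T₀.elems) (h : RedTree T₀ T D N)
    (ord : QuadOrder T₀.elems T.nodes) {R : Set Elem} (hR : RedRefineSet R T T') :
    QuadOrder T₀.elems T'.nodes := by
  refine ord.append hR.2.2.1 fun v hv _ k a b c d hk hvc hva => ?_
  obtain ⟨A, hA, haA⟩ := (h.refine G hR).leaves.exists_refined_of_corner G hk hvc hva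
    ((hR.2.2.2.2 v).1 hv)
  refine (h.nodesOK.2 a).2 (h.leaves.mem_verts G h.height ?_ haA)
  exact hA.elim Or.inr fun hA => Or.inl (hR.1 hA)

/-- Red refinement of a mesh with a forest of refined elements. -/
theorem exists_redTree_of_redRefinement_quad (G : Grid IsQuad T₀.elems) {S : Mesh}
    (h : RedTree T₀ S D N) (ord : QuadOrder T₀.elems S.nodes) (hT : RedRefinement QuadStep S T) :
    ∃ D N, RedTree T₀ T D N ∧ QuadOrder T₀.elems T.nodes := by
  induction hT with
  | refl => exact ⟨D, N, h, ord⟩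
  | tail _ hstep ih =>
    obtain ⟨D, N, h, ord⟩ := ih
    obtain ⟨R, hR⟩ := hstep
    exact ⟨D ∪ R, N + 1, h.refine G hR, ord.step G h hR⟩

/-- CoarsenR reduces the highest level, provided that all elements on this level are marked. -/
theorem coarsenQuad_redTree (G : Grid IsQuad T₀.elems) (h₀ : NodesOK T₀)
    (h : RedTree T₀ T D N) (ord : QuadOrder T₀.elems T.nodes) {marked : Set Elem}
    (hm : ∀ K ∈ T.elems, K ∈ level T₀.elems N → K ∈ marked) :
    ∃ D', RedTree T₀ (coarsenQuad {v | v ∈ T₀.nodes} T marked) D' (N - 1) ∧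
      QuadOrder T₀.elems (coarsenQuad {v | v ∈ T₀.nodes} T marked).nodes := by
  obtain ⟨D', hD', h'⟩ := h.coarsen G h₀
    (A := quartetsQuad {v | v ∈ T₀.nodes} T marked)
    (by rw [← admissibleQuad_eq G h₀ h ord]; exact quartetsQuad_subset _ _ _)
    (by rintro P hP k rfl hk; exact top_mem_quartetsQuad G h₀ h ord hm hP hk)
  exact ⟨D', h', ord.keepNodes G h'.leaves h'.height⟩

end

/-! ### Patterns and their parent elements -/

/-- A family of elements that subdivides `P`, as far as vertices are concerned. -/
structure Subdivides (G : Set Elem) (P : Elem) : Prop where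
  mem_hull : ∀ K ∈ G, ∀ v ∈ K, v ∈ hull P
  exists_mem : ∀ v ∈ P, ∃ K ∈ G, v ∈ K

/-- The elements of a pattern have the orientation of triangles or quadrilaterals. -/
def Positive (G : Set Elem) : Prop := ∀ K ∈ G, IsTriangle K ∨ IsQuad K

theorem Positive.tri {G : Set Elem} (h : Positive G) {a b c : Pt} (hm : tri a b c ∈ G) :
    0 < cross a b c := by
  rcases h _ hm with h | ⟨x, y, z, w, h, -⟩
  · exact isTriangle_tri.1 h
  · exact absurd h tri_ne_quad

theorem Positive.quad {G : Set Elem} (h : Positive G) {a b c d : Pt} (hm : quad a b c d ∈ G) :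
    IsQuad (quad a b c d) := by
  rcases h _ hm with ⟨x, y, z, h, -⟩ | h
  · exact absurd h.symm tri_ne_quad
  · exact h

theorem Subdivides.hull_eq {G : Set Elem} {P P' : Elem} (h : Subdivides G P)
    (h' : Subdivides G P') : ∀ v ∈ P', v ∈ hull P := fun v hv => by
  obtain ⟨K, hK, hvK⟩ := h'.exists_mem v hv
  exact h.mem_hull K hK v hvK

theorem isGreenTri_subdivides {P : Elem} {H : Set Pt} {G : Set Elem} (h : IsGreenTri P H G) :
    Subdivides G P := by
  obtain ⟨a, b, c, m, rfl, rfl, -, rfl⟩ := h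
  have ha : a ∈ hull (tri a b c) := vertex_mem_hull (by simp)
  have hb : b ∈ hull (tri a b c) := vertex_mem_hull (by simp)
  have hc : c ∈ hull (tri a b c) := vertex_mem_hull (by simp)
  have hm := midpoint_mem_hull ha hb
  constructor
  · rintro K (rfl | rfl) v hv <;> rcases mem_tri.1 hv with rfl | rfl | rfl <;> assumption
  · intro v hv
    rcases mem_tri.1 hv with rfl | rfl | rfl
    · exact ⟨_, Or.inl rfl, by simp⟩
    · exact ⟨_, Or.inr rfl, by simp⟩
    · exact ⟨_, Or.inr rfl, by simp⟩

theorem isGreenTri_parent_unique {P P' : Elem} {H H' : Set Pt} {G : Set Elem}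
    (hP : IsTriangle P) (h : IsGreenTri P H G) (h' : IsGreenTri P' H' G) : P' = P := by
  have s := isGreenTri_subdivides h
  have s' := isGreenTri_subdivides h'
  obtain ⟨a, b, c, m, rfl, rfl, -, rfl⟩ := h
  obtain ⟨x, y, z, n, rfl, rfl, -, hG⟩ := h'
  have hp := isTriangle_tri.1 hP
  have pos : Positive {tri a (midpoint ℝ a b) c, tri (midpoint ℝ a b) b c} := by
    rintro K (rfl | rfl) <;> left <;> rw [isTriangle_tri] <;> simp [cross] at hp ⊢ <;> linarith
  have h1 : 0 < cross x (midpoint ℝ x y) z := pos.tri (hG ▸ Or.inl rfl)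
  refine tri_eq_of_hull hp ?_ (s.hull_eq s') (s'.hull_eq s)
  simp [cross] at h1 ⊢
  linarith

theorem isGreenQuad_subdivides {P : Elem} {H : Set Pt} {G : Set Elem} (h : IsGreenQuad P H G) :
    Subdivides G P := by
  obtain ⟨a, b, c, d, m, rfl, rfl, h⟩ := h
  have ha : a ∈ hull (quad a b c d) := vertex_mem_hull (by simp)
  have hb : b ∈ hull (quad a b c d) := vertex_mem_hull (by simp)
  have hc : c ∈ hull (quad a b c d) := vertex_mem_hull (by simp)
  have hd : d ∈ hull (quad a b c d) := vertex_mem_hull (by simp)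
  have hm := midpoint_mem_hull ha hb
  have hn := midpoint_mem_hull hb hc
  have hn' := midpoint_mem_hull hc hd
  rcases h with ⟨-, rfl⟩ | ⟨n, rfl, -, rfl⟩ | ⟨n, rfl, -, rfl⟩
  · constructor
    · rintro K (rfl | rfl | rfl) v hv <;> rcases mem_tri.1 hv with rfl | rfl | rfl <;> assumption
    · intro v hv
      rcases mem_quad.1 hv with rfl | rfl | rfl | rfl
      · exact ⟨_, Or.inl rfl, by simp⟩
      · exact ⟨_, Or.inr (Or.inl rfl), by simp⟩
      · exact ⟨_, Or.inr (Or.inl rfl), by simp⟩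
      · exact ⟨_, Or.inl rfl, by simp⟩
  · constructor
    · rintro K (rfl | rfl | rfl | rfl) v hv <;> rcases mem_tri.1 hv with rfl | rfl | rfl <;>
        assumption
    · intro v hv
      rcases mem_quad.1 hv with rfl | rfl | rfl | rfl
      · exact ⟨_, Or.inr (Or.inl rfl), by simp⟩
      · exact ⟨_, Or.inl rfl, by simp⟩
      · exact ⟨_, Or.inr (Or.inr (Or.inl rfl)), by simp⟩
      · exact ⟨_, Or.inr (Or.inl rfl), by simp⟩
  · constructor
    · rintro K (rfl | rfl) v hv <;> rcases mem_quad.1 hv with rfl | rfl | rfl | rfl <;> assumption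
    · intro v hv
      rcases mem_quad.1 hv with rfl | rfl | rfl | rfl
      · exact ⟨_, Or.inl rfl, by simp⟩
      · exact ⟨_, Or.inr rfl, by simp⟩
      · exact ⟨_, Or.inr rfl, by simp⟩
      · exact ⟨_, Or.inl rfl, by simp⟩

theorem isGreenQuad_positive {P : Elem} {H : Set Pt} {G : Set Elem} (hP : IsQuad P)
    (h : IsGreenQuad P H G) : Positive G := by
  obtain ⟨a, b, c, d, m, rfl, rfl, h⟩ := h
  obtain ⟨h1, h2, h3, h4⟩ := isQuad_quad.1 hP
  simp only [cross] at h1 h2 h3 h4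
  rcases h with ⟨-, rfl⟩ | ⟨n, rfl, -, rfl⟩ | ⟨n, rfl, -, rfl⟩
  · rintro K (rfl | rfl | rfl) <;> left <;> rw [isTriangle_tri] <;> simp [cross] <;> linarith
  · rintro K (rfl | rfl | rfl | rfl) <;> left <;> rw [isTriangle_tri] <;> simp [cross] <;> linarith
  · rintro K (rfl | rfl) <;> right <;> rw [isQuad_quad] <;> refine ⟨?_, ?_, ?_, ?_⟩ <;>
      simp [cross] <;> linarith

theorem isGreenQuad_parent_unique {P P' : Elem} {H H' : Set Pt} {G : Set Elem}
    (hP : IsQuad P) (h : IsGreenQuad P H G) (h' : IsGreenQuad P' H' G) : P' = P := by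
  have s := isGreenQuad_subdivides h
  have s' := isGreenQuad_subdivides h'
  have pos := isGreenQuad_positive hP h
  obtain ⟨a, b, c, d, -, rfl, -⟩ := h
  obtain ⟨x, y, z, w, m, rfl, rfl, h'⟩ := h'
  have e := fun g1 g2 g3 => quad_eq_of_hull (x := x) (y := y) (z := z) (w := w) hP g1 g2 g3
    (s.hull_eq s') (s'.hull_eq s)
  clear s s'
  rcases h' with ⟨-, rfl⟩ | ⟨n, rfl, -, rfl⟩ | ⟨n, rfl, -, rfl⟩
  · have p1 := pos.tri (a := x) (Or.inl rfl)
    have p2 := pos.tri (b := y) (Or.inr (Or.inl rfl))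
    have p3 := pos.tri (b := z) (Or.inr (Or.inr rfl))
    simp [cross] at p1 p2 p3
    refine e ?_ (Or.inr ?_) ?_ <;> simp only [cross] <;> linarith
  · have p1 := pos.tri (b := y) (Or.inl rfl)
    have p2 := pos.tri (a := x) (Or.inr (Or.inl rfl))
    have p3 := pos.tri (b := z) (Or.inr (Or.inr (Or.inl rfl)))
    simp [cross] at p1 p2 p3
    refine e ?_ (Or.inl ?_) ?_ <;> simp only [cross] <;> linarith
  · obtain ⟨-, -, -, p1⟩ := isQuad_quad.1 (pos.quad (a := x) (Or.inl rfl))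
    obtain ⟨p2, p3, -, -⟩ := isQuad_quad.1 (pos.quad (b := y) (Or.inr rfl))
    simp [cross] at p1 p2 p3
    refine e ?_ (Or.inl ?_) ?_ <;> simp only [cross] <;> linarith

theorem isBlue_subdivides {P : Elem} {G : Set Elem} (h : IsBlue P G) : Subdivides G P := by
  obtain ⟨a, b, c, d, m, n, z, rfl, rfl, rfl, rfl, rfl⟩ := h
  have ha : a ∈ hull (quad a b c d) := vertex_mem_hull (by simp)
  have hb : b ∈ hull (quad a b c d) := vertex_mem_hull (by simp)
  have hc : c ∈ hull (quad a b c d) := vertex_mem_hull (by simp)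
  have hd : d ∈ hull (quad a b c d) := vertex_mem_hull (by simp)
  have hm := midpoint_mem_hull ha hb
  have hn := midpoint_mem_hull hb hc
  have hz := quadCenter_mem_hull a b c d
  constructor
  · rintro K (rfl | rfl | rfl) v hv <;> rcases mem_quad.1 hv with rfl | rfl | rfl | rfl <;>
      assumption
  · intro v hv
    rcases mem_quad.1 hv with rfl | rfl | rfl | rfl
    · exact ⟨_, Or.inr (Or.inr rfl), by simp⟩
    · exact ⟨_, Or.inl rfl, by simp⟩
    · exact ⟨_, Or.inr (Or.inl rfl), by simp⟩
    · exact ⟨_, Or.inr (Or.inl rfl), by simp⟩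

theorem isBlue_positive {P : Elem} {G : Set Elem} (hP : IsQuad P) (h : IsBlue P G) :
    Positive G := by
  obtain ⟨a, b, c, d, m, n, z, rfl, rfl, rfl, rfl, rfl⟩ := h
  obtain ⟨h1, h2, h3, h4⟩ := isQuad_quad.1 hP
  simp only [cross] at h1 h2 h3 h4
  rintro K (rfl | rfl | rfl) <;> right <;> rw [isQuad_quad] <;> refine ⟨?_, ?_, ?_, ?_⟩ <;>
    simp [cross] <;> linarith

theorem isBlue_parent_unique {P P' : Elem} {G : Set Elem} (hP : IsQuad P) (h : IsBlue P G)
    (h' : IsBlue P' G) : P' = P := by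
  have s := isBlue_subdivides h
  have s' := isBlue_subdivides h'
  have pos := isBlue_positive hP h
  obtain ⟨a, b, c, d, -, -, -, rfl, -⟩ := h
  obtain ⟨x, y, z, w, m, n, o, rfl, rfl, rfl, rfl, rfl⟩ := h'
  obtain ⟨p1, -, -, -⟩ := isQuad_quad.1 (pos.quad (b := y) (Or.inl rfl))
  obtain ⟨p2, -, -, -⟩ := isQuad_quad.1 (pos.quad (b := z) (Or.inr (Or.inl rfl)))
  obtain ⟨-, -, -, p3⟩ := isQuad_quad.1 (pos.quad (a := x) (Or.inr (Or.inr rfl)))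
  refine quad_eq_of_hull hP ?_ (Or.inl ?_) ?_ (s.hull_eq s') (s'.hull_eq s)
  · simp [cross] at p1 ⊢; linarith
  · simp [cross] at p2 ⊢; linarith
  · simp [cross] at p3 ⊢; linarith

/-! ### Red-green refinement -/

/-- Green patterns use at least one midpoint and determine their parent element. -/
structure GreenRule (shape : Elem → Prop) (green : Elem → Set Pt → Set Elem → Prop) : Prop where
  nonempty : ∀ {P H G}, green P H G → H.Nonempty
  parent_unique : ∀ {P P' H H' G}, shape P → green P H G → green P' H' G → P' = P

theorem greenRule_tri : GreenRule IsTriangle IsGreenTri where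
  nonempty := by
    rintro P H G ⟨a, b, c, m, -, -, rfl, -⟩
    exact ⟨m, rfl⟩
  parent_unique := isGreenTri_parent_unique

theorem greenRule_quad : GreenRule IsQuad IsGreenQuad where
  nonempty := by
    rintro P H G ⟨a, b, c, d, m, -, -, ⟨rfl, -⟩ | ⟨n, -, rfl, -⟩ | ⟨n, -, rfl, -⟩⟩
    · exact ⟨m, rfl⟩
    · exact ⟨m, Or.inl rfl⟩
    · exact ⟨m, Or.inl rfl⟩
  parent_unique := isGreenQuad_parent_unique

namespace GreenRule

variable {shape : Elem → Prop} {green : Elem → Set Pt → Set Elem → Prop}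

/-- Recoarsen undoes the green closure. -/
theorem recoarsen_regularizeGreen (R : GreenRule shape green) {S : Mesh} (hS : NodesOK S)
    (hs : ∀ K ∈ S.elems, shape K) :
    recoarsen (fun P G => ∃ H : Set Pt, green P H G) (regularizeGreen green S) = S := by
  have e : (regularizeGreen green S).red ∪
      {P | ∃ G ∈ (regularizeGreen green S).patterns, ∃ H : Set Pt, green P H G} = S.elems := by
    ext K
    constructor
    · rintro (hK | ⟨G, ⟨L, hL, hLG⟩, H, hKG⟩)
      · exact hK.1
      · rwa [R.parent_unique (hs L hL) hLG hKG]
    · intro hK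
      by_cases h : ∃ G : Set Elem, green K (hangingOn S K) G
      · obtain ⟨G, hG⟩ := h
        exact Or.inr ⟨G, ⟨K, hK, hG⟩, _, hG⟩
      · exact Or.inl ⟨hK, h⟩
  refine Mesh.ext ?_ e
  change keepNodes S.nodes _ = S.nodes
  rw [e]
  exact keepNodes_eq_self hS

theorem mem_red (R : GreenRule shape green) {S : Mesh} {K : Elem} (hK : K ∈ S.elems)
    (h : ¬ HasIrregularEdge S K) : K ∈ (regularizeGreen green S).red := by
  refine ⟨hK, ?_⟩
  rintro ⟨G, hG⟩
  obtain ⟨v, hv, a, b, hab, hvo⟩ := R.nonempty hG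
  exact h ⟨a, b, hab, v, hv, hvo⟩

theorem regularizeGreen_eq_toBlock (R : GreenRule shape green) {S : Mesh}
    (h : ∀ K ∈ S.elems, ¬ HasIrregularEdge S K) : regularizeGreen green S = S.toBlock := by
  refine BlockMesh.ext rfl ?_ ?_
  · ext K
    exact ⟨fun hK => hK.1, fun hK => R.mem_red hK (h K hK)⟩
  · ext G
    refine ⟨?_, fun hG => absurd hG (Set.notMem_empty _)⟩
    rintro ⟨K, hK, hG⟩
    obtain ⟨v, hv, a, b, hab, hvo⟩ := R.nonempty hG
    exact absurd ⟨a, b, hab, v, hv, hvo⟩ (h K hK)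

end GreenRule

theorem not_hasIrregularEdge_initial {shape : Elem → Prop} {T₀ : Mesh} (G : Grid shape T₀.elems)
    (h₀ : NodesOK T₀) : ∀ K ∈ T₀.elems, ¬ HasIrregularEdge T₀ K := fun _ hK =>
  not_hasIrregularEdge (N := 0) G (fun v hv => (h₀.2 v).1 hv) hK

/-- Every red-green mesh is the green closure of a red refinement of the initial mesh. -/
theorem GreenRefinement.exists_red {shape : Elem → Prop}
    {green : Elem → Set Pt → Set Elem → Prop} (R : GreenRule shape green) {T₀ : Mesh}
    (G : Grid shape T₀.elems) (h₀ : NodesOK T₀) {step : Mesh → Mesh → Prop}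
    (hstep : ∀ S, RedRefinement step T₀ S → NodesOK S ∧ ∀ K ∈ S.elems, shape K) {T : BlockMesh}
    (hT : GreenRefinement step green T₀ T) :
    ∃ S, RedRefinement step T₀ S ∧ T = regularizeGreen green S := by
  induction hT with
  | init =>
    exact ⟨T₀, Relation.ReflTransGen.refl,
      (R.regularizeGreen_eq_toBlock (not_hasIrregularEdge_initial G h₀)).symm⟩
  | refine T S T' _ hS hreg _ ih =>
    obtain ⟨S', hS', rfl⟩ := ih
    rw [R.recoarsen_regularizeGreen (hstep S' hS').1 (hstep S' hS').2] at hS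
    exact ⟨S, hS'.trans hS, hreg⟩

/-- If `coarsen` reduces the highest level `N` of a mesh with `Inv S N`, then iterated CoarsenRG
reaches the initial mesh. -/
theorem green_reaches {shape : Elem → Prop} {green : Elem → Set Pt → Set Elem → Prop}
    (R : GreenRule shape green) {T₀ : Mesh} (G : Grid shape T₀.elems) (h₀ : NodesOK T₀)
    {Inv : Mesh → ℕ → Prop} {coarsen : Mesh → Set Elem → Mesh}
    (hInv : ∀ S N, Inv S N → ∃ D, RedTree T₀ S D N)
    (hcoarsen : ∀ S N marked, Inv S N → (∀ K ∈ S.elems, K ∈ level T₀.elems N → K ∈ marked) →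
      Inv (coarsen S marked) (N - 1))
    {S : Mesh} {N : ℕ} (hS : Inv S N) {seq : ℕ → BlockMesh} (h0 : seq 0 = regularizeGreen green S)
    (hseq : ∀ i, seq (i + 1) = coarsenGreen green coarsen (seq i) (seq i).toMesh.elems) :
    ∃ M, seq M = T₀.toBlock := by
  have key : ∀ i, ∃ S, Inv S (N - i) ∧ seq i = regularizeGreen green S := by
    intro i
    induction i with
    | zero => exact ⟨S, hS, h0⟩
    | succ i ih =>
      obtain ⟨S, hS, e⟩ := ih
      obtain ⟨D, h⟩ := hInv S _ hS
      have hs : ∀ K ∈ S.elems, shape K := fun K hK => by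
        obtain ⟨k, hk⟩ := h.leaves.level_of_mem hK
        exact (G.level k).shape_mem K hk
      refine ⟨_, ?_, by rw [hseq i, coarsenGreen]⟩
      rw [e, R.recoarsen_regularizeGreen h.nodesOK hs]
      refine hcoarsen S _ _ hS fun K hK hKl => ?_
      have := R.mem_red hK (not_hasIrregularEdge G (h.node_mem_verts G) hKl)
      exact ⟨Or.inl this, this⟩
  obtain ⟨S', hS', e⟩ := key N
  rw [Nat.sub_self] at hS'
  obtain ⟨D, h⟩ := hInv S' _ hS'
  refine ⟨N, ?_⟩
  rw [e, h.eq_initial_of_elems_eq h₀ h.elems_eq]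
  exact R.regularizeGreen_eq_toBlock (not_hasIrregularEdge_initial G h₀)

/-- If `coarsen` reduces the highest level `N` of a mesh with `Inv S N`, then its iteration reaches
the initial mesh. -/
theorem red_reaches {T₀ : Mesh} (h₀ : NodesOK T₀)
    {Inv : Mesh → ℕ → Prop} {coarsen : Mesh → Mesh}
    (hInv : ∀ S N, Inv S N → ∃ D, RedTree T₀ S D N)
    (hcoarsen : ∀ S N, Inv S N → Inv (coarsen S) (N - 1))
    {S : Mesh} {N : ℕ} (hS : Inv S N) {seq : ℕ → Mesh} (h0 : seq 0 = S)
    (hseq : ∀ i, seq (i + 1) = coarsen (seq i)) : ∃ M, seq M = T₀ := by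
  have key : ∀ i, Inv (seq i) (N - i) := by
    intro i
    induction i with
    | zero => rw [h0]; exact hS
    | succ i ih =>
      rw [hseq i]
      exact hcoarsen _ _ ih
  have hN := key N
  rw [Nat.sub_self] at hN
  obtain ⟨D, h⟩ := hInv _ _ hN
  exact ⟨N, h.eq_initial_of_elems_eq h₀ h.elems_eq⟩

/-! ### Red-blue refinement -/

/-- The vertices of a blue pattern are vertices of the red refinement of its parent. -/
theorem isBlue_vertex_child {P : Elem} {G : Set Elem} (h : IsBlue P G) :
    ∀ K ∈ G, ∀ v ∈ K, v ∈ verts (redChildren P) := by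
  obtain ⟨a, b, c, d, m, n, z, rfl, rfl, rfl, rfl, rfl⟩ := h
  have hv : ∀ v ∈ quad a b c d, v ∈ verts (redChildren (quad a b c d)) := fun v hv =>
    vertex_child_quad hv
  have ha := hv a (by simp)
  have hb := hv b (by simp)
  have hc := hv c (by simp)
  have hd := hv d (by simp)
  have hm : midpoint ℝ a b ∈ verts (redChildren (quad a b c d)) :=
    ⟨_, cornerQuad_mem a b c d, by simp⟩
  have hn : midpoint ℝ b c ∈ verts (redChildren (quad a b c d)) :=
    ⟨_, mem_redChildren_quad.2 (Or.inr (Or.inl rfl)), by simp⟩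
  have hz : quadCenter a b c d ∈ verts (redChildren (quad a b c d)) :=
    ⟨_, cornerQuad_mem a b c d, by simp⟩
  rintro K (rfl | rfl | rfl) v hv <;> rcases mem_quad.1 hv with rfl | rfl | rfl | rfl <;>
    assumption

/-- The red elements and the parents of the blue patterns. -/
def blueLeaves (B : BlockMesh) : Set Elem := B.red ∪ {P | ∃ G ∈ B.patterns, IsBlue P G}

/-- `B` arises by blue patterns from a red refinement of `T₀` with the set `D` of refined elements,
where all refined elements and all parents of patterns have levels less than `N`. -/
structure BlueTree (T₀ : Mesh) (B : BlockMesh) (D : Set Elem) (N : ℕ) : Prop where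
  leaves : Leaves T₀.elems D (blueLeaves B)
  height : HeightLE T₀.elems D N
  exists_parent : ∀ G ∈ B.patterns, ∃ P, IsBlue P G
  parent : ∀ G ∈ B.patterns, ∀ P, IsBlue P G → P ∉ B.red ∧ ∃ k < N, P ∈ level T₀.elems k
  pattern_unique : ∀ G ∈ B.patterns, ∀ G' ∈ B.patterns, ∀ P, IsBlue P G → IsBlue P G' → G = G'
  nodesOK : NodesOK B.toMesh
  initial_nodes : T₀.nodes <+: B.nodes
  order : QuadOrder T₀.elems B.nodes

theorem Leaves.notMem_children {shape : Elem → Prop} {E D S : Set Elem} (G : Grid shape E)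
    (h : Leaves E D S) {K L : Elem} (hK : K ∈ S) (hL : L ∈ S) : L ∉ redChildren K := by
  intro hLK
  obtain ⟨k, hk⟩ := h.level_of_mem hK
  obtain ⟨P, hP, hPl, hLP⟩ := h.parent_mem G hL (mem_level_succ.2 ⟨K, hk, hLK⟩)
  exact h.notMem hK (G.parent_unique hPl hk hLP hLK ▸ hP)

namespace BlueTree

variable {T₀ : Mesh} {B B' : BlockMesh} {D : Set Elem} {N : ℕ}

theorem verts_subset_nodes (h : BlueTree T₀ B D N) : ∀ v ∈ verts (blueLeaves B), v ∈ B.nodes := by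
  rintro v ⟨K, hK | ⟨G, hG, hK⟩, hv⟩
  · exact (h.nodesOK.2 v).2 ⟨K, Or.inl hK, hv⟩
  · obtain ⟨L, hL, hvL⟩ := (isBlue_subdivides hK).exists_mem v hv
    exact (h.nodesOK.2 v).2 ⟨L, Or.inr ⟨G, hG, hL⟩, hvL⟩

theorem node_mem_verts (G : Grid IsQuad T₀.elems) (h : BlueTree T₀ B D N) :
    ∀ v ∈ B.toMesh.nodes, v ∈ verts (level T₀.elems N) := by
  intro v hv
  obtain ⟨K, hK | ⟨G', hG', hK⟩, hvK⟩ := (h.nodesOK.2 v).1 hv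
  · exact h.leaves.verts_subset G h.height ⟨K, Or.inl hK, hvK⟩
  · obtain ⟨P, hP⟩ := h.exists_parent G' hG'
    obtain ⟨-, k, hk, hl⟩ := h.parent G' hG' P hP
    obtain ⟨L, hL, hvL⟩ := isBlue_vertex_child hP K hK v hvK
    exact G.verts_mono (by omega : k + 1 ≤ N) ⟨L, mem_level_succ.2 ⟨P, hl, hL⟩, hvL⟩

/-- Elements with an irregular edge are not on the highest level. -/
theorem level_lt (G : Grid IsQuad T₀.elems) (h : BlueTree T₀ B D N) {K : Elem}
    (hK : K ∈ blueLeaves B) (hirr : HasIrregularEdge B.toMesh K) :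
    ∃ k < N, K ∈ level T₀.elems k := by
  obtain ⟨k, hk, hl⟩ := h.leaves.level_le G h.height hK
  refine ⟨k, lt_of_le_of_ne hk ?_, hl⟩
  rintro rfl
  exact not_hasIrregularEdge G (h.node_mem_verts G) hl hirr

theorem isQuad (G : Grid IsQuad T₀.elems) (h : BlueTree T₀ B D N) {K : Elem}
    (hK : K ∈ blueLeaves B) : IsQuad K := by
  obtain ⟨k, hk⟩ := h.leaves.level_of_mem hK
  exact quad_of_level G hk

/-- If all new nodes stem from the red refinement of one element, then the order of the nodes is as
required. -/
theorem order_append (G : Grid IsQuad T₀.elems) (h : BlueTree T₀ B D N) {K : Elem}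
    (hK : K ∈ blueLeaves B) (hp : B.nodes <+: B'.nodes)
    (hnew : ∀ v ∈ B'.nodes, v ∉ B.nodes → v ∈ verts (redChildren K)) :
    QuadOrder T₀.elems B'.nodes := by
  refine h.order.append hp fun v hv hvB k a b c d hk hvc hva => ?_
  have hl := h.leaves.refine G (Set.singleton_subset_iff.2 hK)
  obtain ⟨L, hL, hvL⟩ := hnew v hv hvB
  obtain ⟨A, hA, haA⟩ := hl.exists_refined_of_corner G hk hvc hva
    ⟨L, Or.inr (Set.mem_biUnion rfl hL), hvL⟩
  refine h.verts_subset_nodes a (h.leaves.mem_verts G h.height ?_ haA)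
  rcases hA with hA | rfl
  · exact Or.inr hA
  · exact Or.inl hK

/-- Red refinement of a red element or of the parent of a blue pattern. -/
theorem refine (G : Grid IsQuad T₀.elems) (h : BlueTree T₀ B D N) {K : Elem}
    (hK : K ∈ blueLeaves B) (hlev : ∃ k < N, K ∈ level T₀.elems k) (hB' : AppendsNodes B B')
    (hred : B'.red = (B.red \ {K}) ∪ redChildren K)
    (hpat : B'.patterns = B.patterns \ {G | IsBlue K G}) :
    BlueTree T₀ B' (D ∪ {K}) N := by
  have hleaf : ∀ G ∈ B.patterns, ∀ P, IsBlue P G → P ∈ blueLeaves B := fun G hG P hP =>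
    Or.inr ⟨G, hG, hP⟩
  have e : blueLeaves B' = (blueLeaves B \ {K}) ∪ ⋃ P ∈ ({K} : Set Elem), redChildren P := by
    rw [Set.biUnion_singleton]
    ext L
    simp only [blueLeaves, hred, hpat, Set.mem_union, Set.mem_sdiff, Set.mem_singleton_iff,
      Set.mem_ofPred_eq]
    constructor
    · rintro ((⟨h1, h2⟩ | h1) | ⟨G', ⟨h1, h2⟩, h3⟩)
      · exact Or.inl ⟨Or.inl h1, h2⟩
      · exact Or.inr h1
      · refine Or.inl ⟨Or.inr ⟨G', h1, h3⟩, ?_⟩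
        rintro rfl
        exact h2 h3
    · rintro (⟨h1 | ⟨G', h1, h3⟩, h2⟩ | h1)
      · exact Or.inl (Or.inl ⟨h1, h2⟩)
      · refine Or.inr ⟨G', ⟨h1, fun hKG => h2 ?_⟩, h3⟩
        exact isBlue_parent_unique (h.isQuad G hK) hKG h3
      · exact Or.inl (Or.inr h1)
  refine ⟨?_, ?_, ?_, ?_, ?_, hB'.2, h.initial_nodes.trans hB'.1, ?_⟩
  · rw [e]
    exact h.leaves.refine G (Set.singleton_subset_iff.2 hK)
  · rintro P (hP | rfl)
    · exact h.height P hP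
    · exact hlev
  · rw [hpat]
    exact fun G' hG' => h.exists_parent G' hG'.1
  · rw [hpat, hred]
    rintro G' ⟨hG', -⟩ P hP
    obtain ⟨h1, h2⟩ := h.parent G' hG' P hP
    refine ⟨?_, h2⟩
    rintro (h3 | h3)
    · exact h1 h3.1
    · exact h.leaves.notMem_children G hK (hleaf G' hG' P hP) h3
  · rw [hpat]
    exact fun G₁ h1 G₂ h2 => h.pattern_unique G₁ h1.1 G₂ h2.1
  · refine h.order_append G hK hB'.1 fun v hv hvB => ?_
    obtain ⟨L, hL, hvL⟩ := (hB'.2.2 v).1 hv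
    have hL' : L ∈ B'.red ∪ ⋃₀ B'.patterns := hL
    rw [hred, hpat] at hL'
    rcases hL' with (hL' | hL') | ⟨G', hG', hL'⟩
    · exact absurd ((h.nodesOK.2 v).2 ⟨L, Or.inl hL'.1, hvL⟩) hvB
    · exact ⟨L, hL', hvL⟩
    · exact absurd ((h.nodesOK.2 v).2 ⟨L, Or.inr ⟨G', hG'.1, hL'⟩, hvL⟩) hvB

/-- Division of a red element by a blue pattern. -/
theorem divide (Gr : Grid IsQuad T₀.elems) (h : BlueTree T₀ B D N) {K : Elem} {G : Set Elem}
    (hK : K ∈ B.red) (hlev : ∃ k < N, K ∈ level T₀.elems k) (hB' : AppendsNodes B B')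
    (hG : IsBlue K G) (hred : B'.red = B.red \ {K}) (hpat : B'.patterns = B.patterns ∪ {G}) :
    BlueTree T₀ B' D N := by
  have hKl : K ∈ blueLeaves B := Or.inl hK
  have huniq : ∀ P, IsBlue P G → P = K := fun P hP =>
    isBlue_parent_unique (h.isQuad Gr hKl) hG hP
  have hnot : ∀ G' ∈ B.patterns, ¬ IsBlue K G' := fun G' hG' hKG => (h.parent G' hG' K hKG).1 hK
  have e : blueLeaves B' = blueLeaves B := by
    ext L
    simp only [blueLeaves, hred, hpat, Set.mem_union, Set.mem_sdiff, Set.mem_singleton_iff,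
      Set.mem_ofPred_eq]
    constructor
    · rintro (h1 | ⟨G', h1 | rfl, h2⟩)
      · exact Or.inl h1.1
      · exact Or.inr ⟨G', h1, h2⟩
      · exact Or.inl (huniq L h2 ▸ hK)
    · rintro (h1 | ⟨G', h1, h2⟩)
      · by_cases hLK : L = K
        · exact Or.inr ⟨G, Or.inr rfl, hLK ▸ hG⟩
        · exact Or.inl ⟨h1, hLK⟩
      · exact Or.inr ⟨G', Or.inl h1, h2⟩
  refine ⟨e ▸ h.leaves, h.height, ?_, ?_, ?_, hB'.2, h.initial_nodes.trans hB'.1, ?_⟩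
  · rw [hpat]
    rintro G' (hG' | rfl)
    · exact h.exists_parent G' hG'
    · exact ⟨K, hG⟩
  · rw [hpat, hred]
    rintro G' (hG' | rfl) P hP
    · exact ⟨fun h1 => (h.parent G' hG' P hP).1 h1.1, (h.parent G' hG' P hP).2⟩
    · obtain rfl := huniq P hP
      exact ⟨fun h1 => h1.2 rfl, hlev⟩
  · rw [hpat]
    rintro G₁ (h1 | rfl) G₂ (h2 | rfl) P hP₁ hP₂
    · exact h.pattern_unique G₁ h1 G₂ h2 P hP₁ hP₂
    · obtain rfl := huniq P hP₂
      exact absurd hP₁ (hnot G₁ h1)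
    · obtain rfl := huniq P hP₁
      exact absurd hP₂ (hnot G₂ h2)
    · rfl
  · refine h.order_append Gr hKl hB'.1 fun v hv hvB => ?_
    obtain ⟨L, hL, hvL⟩ := (hB'.2.2 v).1 hv
    have hL' : L ∈ B'.red ∪ ⋃₀ B'.patterns := hL
    rw [hred, hpat] at hL'
    rcases hL' with hL' | ⟨G', hG' | rfl, hL'⟩
    · exact absurd ((h.nodesOK.2 v).2 ⟨L, Or.inl hL'.1, hvL⟩) hvB
    · exact absurd ((h.nodesOK.2 v).2 ⟨L, Or.inr ⟨G', hG', hL'⟩, hvL⟩) hvB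
    · exact isBlue_vertex_child hG L hL' v hvL

/-- In the red-blue closure, the highest level does not grow. -/
theorem step (Gr : Grid IsQuad T₀.elems) (h : BlueTree T₀ B D N) (hs : BlueStep B B') :
    ∃ D', BlueTree T₀ B' D' N := by
  obtain ⟨hB', ⟨K, hK, hirr, ⟨G, hG, hred, hpat⟩ | ⟨hred, hpat⟩⟩ |
    ⟨G, hG, P, hP, -, hred, hpat⟩⟩ := hs
  · exact ⟨D, h.divide Gr hK (h.level_lt Gr (Or.inl hK) hirr) hB' hG hred hpat⟩
  · refine ⟨_, h.refine Gr (Or.inl hK) (h.level_lt Gr (Or.inl hK) hirr) hB' hred ?_⟩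
    rw [hpat]
    ext G
    exact ⟨fun hG => ⟨hG, fun hKG => (h.parent G hG K hKG).1 hK⟩, fun hG => hG.1⟩
  · obtain ⟨h1, h2⟩ := h.parent G hG P hP
    refine ⟨_, h.refine Gr (Or.inr ⟨G, hG, hP⟩) h2 hB' ?_ ?_⟩
    · rw [hred, Set.sdiff_singleton_eq_self h1]
    · rw [hpat]
      ext G'
      refine and_congr_right fun hG' => not_congr ⟨?_, ?_⟩
      · rintro rfl; exact hP
      · intro hPG'; exact h.pattern_unique G' hG' G hG P hPG' hP

/-- A red refinement as a mesh without patterns. -/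
theorem of_redTree {S : Mesh} (h : RedTree T₀ S D N) (ord : QuadOrder T₀.elems S.nodes) :
    BlueTree T₀ S.toBlock D N := by
  have e : blueLeaves S.toBlock = S.elems := by simp [blueLeaves, Mesh.toBlock]
  have e' : S.toBlock.toMesh = S := by simp [BlockMesh.toMesh, Mesh.toBlock]
  refine ⟨e ▸ h.leaves, h.height, ?_, ?_, ?_, by rw [e']; exact h.nodesOK, h.initial_nodes, ord⟩
  · exact fun G hG => absurd hG (Set.notMem_empty _)
  · exact fun G hG => absurd hG (Set.notMem_empty _)
  · exact fun G hG => absurd hG (Set.notMem_empty _)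

/-- The red-blue closure of a red refinement. -/
theorem of_regularizeBlue (Gr : Grid IsQuad T₀.elems) {S : Mesh} (h : RedTree T₀ S D N)
    (ord : QuadOrder T₀.elems S.nodes) (hB : RegularizeBlue S B) : ∃ D', BlueTree T₀ B D' N := by
  obtain ⟨hB, -⟩ := hB
  induction hB with
  | refl => exact ⟨D, of_redTree h ord⟩
  | tail _ hs ih =>
    obtain ⟨D', h'⟩ := ih
    exact h'.step Gr hs

theorem recoarsen (Gr : Grid IsQuad T₀.elems) (h₀ : NodesOK T₀) (h : BlueTree T₀ B D N) :
    RedTree T₀ (recoarsen IsBlue B) D N ∧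
      QuadOrder T₀.elems (AdaptMesh.recoarsen IsBlue B).nodes := by
  refine ⟨⟨h.leaves, h.height, nodesOK_keepNodes h.nodesOK.1 h.verts_subset_nodes,
    prefix_keepNodes h.initial_nodes fun v hv => ?_⟩, h.order.keepNodes Gr h.leaves h.height⟩
  obtain ⟨K, hK, hvK⟩ := (h₀.2 v).1 hv
  exact h.leaves.mem_verts Gr h.height (h.leaves.mem_or_mem_of_base hK) hvK

/-- Recoarsen and CoarsenR reduce the highest level, because its elements are red and hence keep
their markings. -/
theorem coarsenQuad_recoarsen (Gr : Grid IsQuad T₀.elems) (h₀ : NodesOK T₀)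
    (h : BlueTree T₀ B D N) : ∃ D',
      RedTree T₀ (coarsenQuad {v | v ∈ T₀.nodes} (AdaptMesh.recoarsen IsBlue B)
        (B.toMesh.elems ∩ B.red)) D' (N - 1) ∧
      QuadOrder T₀.elems (coarsenQuad {v | v ∈ T₀.nodes} (AdaptMesh.recoarsen IsBlue B)
        (B.toMesh.elems ∩ B.red)).nodes := by
  obtain ⟨hS, ordS⟩ := h.recoarsen Gr h₀
  refine coarsenQuad_redTree Gr h₀ hS ordS ?_
  rintro K (hK | ⟨G, hG, hKG⟩) hl
  · exact ⟨Or.inl hK, hK⟩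
  · obtain ⟨-, k, hk, hl'⟩ := h.parent G hG K hKG
    have := Gr.level_unique hl hl'
    omega

/-- CoarsenRB reduces the highest level, which the closure does not increase. -/
theorem coarsen (Gr : Grid IsQuad T₀.elems) (h₀ : NodesOK T₀) (h : BlueTree T₀ B D N)
    (hB' : CoarsenBlue {v | v ∈ T₀.nodes} B B.toMesh.elems B') :
    ∃ D', BlueTree T₀ B' D' (N - 1) := by
  obtain ⟨D', h', ord'⟩ := h.coarsenQuad_recoarsen Gr h₀
  exact of_regularizeBlue Gr h' ord' hB'

theorem eq_initial (h₀ : NodesOK T₀) (h : BlueTree T₀ B D 0) : B = T₀.toBlock := by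
  have hpat : B.patterns = ∅ := Set.eq_empty_of_forall_notMem fun G hG => by
    obtain ⟨P, hP⟩ := h.exists_parent G hG
    obtain ⟨-, k, hk, -⟩ := h.parent G hG P hP
    omega
  have e : blueLeaves B = B.toMesh.elems := by simp [blueLeaves, BlockMesh.toMesh, hpat]
  have h' : RedTree T₀ B.toMesh D 0 := ⟨e ▸ h.leaves, h.height, h.nodesOK, h.initial_nodes⟩
  have e' := h'.eq_initial_of_elems_eq h₀ h'.elems_eq
  refine BlockMesh.ext (congrArg Mesh.nodes e') ?_ hpat
  have := congrArg Mesh.elems e'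
  change B.red = T₀.elems
  simpa [BlockMesh.toMesh, hpat] using this

/-- Red refinement of an element with an irregular edge is a possible step of the closure. -/
theorem exists_refine_step (Gr : Grid IsQuad T₀.elems) (h : BlueTree T₀ B D N)
    (hpat : B.patterns = ∅) {K : Elem} (hK : K ∈ B.red) (hirr : HasIrregularEdge B.toMesh K) :
    ∃ B', BlueStep B B' ∧ B'.patterns = ∅ ∧ BlueTree T₀ B' (D ∪ {K}) N := by
  have hKl : K ∈ blueLeaves B := Or.inl hK
  have hQ := h.isQuad Gr hKl
  have hfin : {v | v ∈ verts (redChildren K) ∧ v ∉ B.nodes}.Finite := by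
    have : (⋃ L ∈ redChildren K, {v | v ∈ L}).Finite :=
      (redShape_quad.finite_children hQ).biUnion fun L _ => finite_vertices L
    refine this.subset ?_
    rintro v ⟨⟨L, hL, hv⟩, -⟩
    exact Set.mem_biUnion hL hv
  set l := hfin.toFinset.toList with hl
  have hmem : ∀ v, v ∈ l ↔ v ∈ verts (redChildren K) ∧ v ∉ B.nodes := by
    intro v; simp [hl]
  set B' : BlockMesh := ⟨B.nodes ++ l, (B.red \ {K}) ∪ redChildren K, ∅⟩ with hB'
  have happ : AppendsNodes B B' := by
    refine ⟨List.prefix_append _ _, ?_, fun v => ?_⟩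
    · change (B.nodes ++ l).Nodup
      rw [List.nodup_append]
      refine ⟨h.nodesOK.1, Finset.nodup_toList _, ?_⟩
      rintro v hv w hw rfl
      exact ((hmem v).1 hw).2 hv
    · change v ∈ B.nodes ++ l ↔ ∃ L ∈ ((B.red \ {K}) ∪ redChildren K) ∪ ⋃₀ ∅, v ∈ L
      rw [Set.sUnion_empty, Set.union_empty, List.mem_append, hmem]
      constructor
      · rintro (hv | ⟨⟨L, hL, hv⟩, -⟩)
        · obtain ⟨L, hL, hvL⟩ := (h.nodesOK.2 v).1 hv
          have hL' : L ∈ B.red := by simpa [BlockMesh.toMesh, hpat] using hL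
          by_cases hLK : L = K
          · obtain ⟨M, hM, hvM⟩ := redShape_quad.vertex_child hQ (hLK ▸ hvL)
            exact ⟨M, Or.inr hM, hvM⟩
          · exact ⟨L, Or.inl ⟨hL', hLK⟩, hvL⟩
        · exact ⟨L, Or.inr hL, hv⟩
      · rintro ⟨L, hL | hL, hv⟩
        · exact Or.inl ((h.nodesOK.2 v).2 ⟨L, Or.inl hL.1, hv⟩)
        · by_cases hvB : v ∈ B.nodes
          · exact Or.inl hvB
          · exact Or.inr ⟨⟨L, hL, hv⟩, hvB⟩
  refine ⟨B', ⟨happ, Or.inl ⟨K, hK, hirr, Or.inr ⟨rfl, hpat.symm⟩⟩⟩, rfl,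
    h.refine Gr hKl (h.level_lt Gr hKl hirr) happ rfl ?_⟩
  rw [hpat, Set.empty_sdiff]

/-- Red refinement of elements with irregular edges terminates, as the highest level does not
grow. -/
theorem exists_regular (Gr : Grid IsQuad T₀.elems) (h : BlueTree T₀ B D N)
    (hpat : B.patterns = ∅) :
    ∃ B', Relation.ReflTransGen BlueStep B B' ∧ IsRegular B'.toMesh := by
  set U : Set Elem := ⋃ k ∈ Set.Iio N, level T₀.elems k with hU
  have hfin : U.Finite := (Set.finite_Iio N).biUnion fun k _ => (Gr.level k).finite
  generalize hn : (U \ D).ncard = n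
  induction n using Nat.strong_induction_on generalizing B D with
  | _ n ih =>
    by_cases hreg : IsRegular B.toMesh
    · exact ⟨B, Relation.ReflTransGen.refl, hreg⟩
    obtain ⟨v, hv⟩ := not_forall.1 hreg
    obtain ⟨hvn, K, hK, a, b, hab, hvo⟩ := not_not.1 hv
    have hKr : K ∈ B.red := by simpa [BlockMesh.toMesh, hpat] using hK
    have hirr : HasIrregularEdge B.toMesh K := ⟨a, b, hab, v, hvn, hvo⟩
    obtain ⟨B', hs, hpat', h'⟩ := h.exists_refine_step Gr hpat hKr hirr
    have hlt : (U \ (D ∪ {K})).ncard < n := by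
      rw [← hn]
      refine Set.ncard_lt_ncard ?_ hfin.sdiff
      obtain ⟨k, hk, hl⟩ := h.level_lt Gr (Or.inl hKr) hirr
      refine ⟨Set.sdiff_subset_sdiff_right Set.subset_union_left, fun hsub => ?_⟩
      exact (hsub ⟨Set.mem_biUnion hk hl, h.leaves.notMem (Or.inl hKr)⟩).2 (Or.inr rfl)
    obtain ⟨B'', hs', hreg'⟩ := ih _ hlt h' hpat' rfl
    exact ⟨B'', hs'.head hs, hreg'⟩

theorem exists_coarsenBlue (Gr : Grid IsQuad T₀.elems) (h₀ : NodesOK T₀)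
    (h : BlueTree T₀ B D N) :
    ∃ B', CoarsenBlue {v | v ∈ T₀.nodes} B B.toMesh.elems B' := by
  obtain ⟨D', h', ord'⟩ := h.coarsenQuad_recoarsen Gr h₀
  exact (of_redTree h' ord').exists_regular Gr rfl

end BlueTree

theorem exists_blueTree {T₀ : Mesh} (h₀ : IsInitialMesh IsQuad T₀) {B : BlockMesh}
    (hB : BlueRefinement T₀ B) : ∃ D N, BlueTree T₀ B D N := by
  have Gr := h₀.grid redShape_quad
  have ord₀ := QuadOrder.init Gr h₀.2.1
  induction hB with
  | init => exact ⟨∅, 0, BlueTree.of_redTree (RedTree.init h₀) ord₀⟩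
  | refine T S T' _ hS hreg _ ih =>
    obtain ⟨D, N, h⟩ := ih
    obtain ⟨hr, ordr⟩ := h.recoarsen Gr h₀.2.1
    obtain ⟨D', N', h', ord'⟩ := exists_redTree_of_redRefinement_quad Gr hr ordr hS
    obtain ⟨D'', h''⟩ := BlueTree.of_regularizeBlue Gr h' ord' hreg
    exact ⟨D'', N', h''⟩

/-- There are sequences of outputs of CoarsenRB. -/
theorem exists_coarsenBlue_seq {T₀ : Mesh} (h₀ : IsInitialMesh IsQuad T₀) {B : BlockMesh}
    {D : Set Elem} {N : ℕ} (h : BlueTree T₀ B D N) :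
    ∃ seq : ℕ → BlockMesh, seq 0 = B ∧
      ∀ i, CoarsenBlue {v | v ∈ T₀.nodes} (seq i) (seq i).toMesh.elems (seq (i + 1)) := by
  have Gr := h₀.grid redShape_quad
  have hex : ∀ B : {B : BlockMesh // ∃ D N, BlueTree T₀ B D N},
      ∃ B' : {B : BlockMesh // ∃ D N, BlueTree T₀ B D N},
        CoarsenBlue {v | v ∈ T₀.nodes} B.1 B.1.toMesh.elems B'.1 := by
    rintro ⟨B, D, N, h⟩
    obtain ⟨B', hB'⟩ := h.exists_coarsenBlue Gr h₀.2.1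
    obtain ⟨D', h'⟩ := h.coarsen Gr h₀.2.1 hB'
    exact ⟨⟨B', D', _, h'⟩, hB'⟩
  choose f hf using hex
  refine ⟨fun i => (f^[i] ⟨B, D, N, h⟩).1, rfl, fun i => ?_⟩
  simp only [Function.iterate_succ_apply']
  exact hf _

/-- Every sequence of outputs of CoarsenRB reaches the initial mesh. -/
theorem blue_reaches {T₀ : Mesh} (h₀ : IsInitialMesh IsQuad T₀) {B : BlockMesh}
    {D : Set Elem} {N : ℕ} (h : BlueTree T₀ B D N) {seq : ℕ → BlockMesh} (h0 : seq 0 = B)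
    (hseq : ∀ i, CoarsenBlue {v | v ∈ T₀.nodes} (seq i) (seq i).toMesh.elems (seq (i + 1))) :
    ∃ M, seq M = T₀.toBlock := by
  have Gr := h₀.grid redShape_quad
  have key : ∀ i, ∃ D, BlueTree T₀ (seq i) D (N - i) := by
    intro i
    induction i with
    | zero => exact ⟨D, by rw [h0]; exact h⟩
    | succ i ih =>
      obtain ⟨D, hi⟩ := ih
      exact hi.coarsen Gr h₀.2.1 (hseq i)
  obtain ⟨D, hN⟩ := key N
  rw [Nat.sub_self] at hN
  exact ⟨N, hN.eq_initial h₀.2.1⟩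

end AdaptMesh

theorem theorem2 (T₀ : Mesh) (N₀ : Set Pt) (hN₀ : N₀ = {v | v ∈ T₀.nodes}) :
    -- triangles: CoarsenR (with and without the 2-Neighbor Rule) and CoarsenRG
    (IsInitialMesh IsTriangle T₀ →
      (∀ (rule : Bool) (T : Mesh), RedRefinement TriStep T₀ T →
        (T ≠ T₀ → (quartetsTri rule N₀ T T.elems).Nonempty) ∧
        ∀ seq : ℕ → Mesh, seq 0 = T →
          (∀ i, seq (i + 1) = coarsenTri rule N₀ (seq i) (seq i).elems) →
          ∃ M : ℕ, seq M = T₀) ∧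
      (∀ T : BlockMesh, GreenRefinement TriStep IsGreenTri T₀ T →
        ∀ seq : ℕ → BlockMesh, seq 0 = T →
          (∀ i, seq (i + 1) =
            coarsenGreen IsGreenTri (coarsenTri true N₀) (seq i) (seq i).toMesh.elems) →
          ∃ M : ℕ, seq M = T₀.toBlock)) ∧
    -- quadrilaterals: CoarsenR, CoarsenRG and CoarsenRB
    (IsInitialMesh IsQuad T₀ →
      (∀ T : Mesh, RedRefinement QuadStep T₀ T →
        (T ≠ T₀ → (quartetsQuad N₀ T T.elems).Nonempty) ∧
        ∀ seq : ℕ → Mesh, seq 0 = T →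
          (∀ i, seq (i + 1) = coarsenQuad N₀ (seq i) (seq i).elems) →
          ∃ M : ℕ, seq M = T₀) ∧
      (∀ T : BlockMesh, GreenRefinement QuadStep IsGreenQuad T₀ T →
        ∀ seq : ℕ → BlockMesh, seq 0 = T →
          (∀ i, seq (i + 1) =
            coarsenGreen IsGreenQuad (coarsenQuad N₀) (seq i) (seq i).toMesh.elems) →
          ∃ M : ℕ, seq M = T₀.toBlock) ∧
      (∀ T : BlockMesh, BlueRefinement T₀ T →
        (∃ seq : ℕ → BlockMesh, seq 0 = T ∧
          ∀ i, CoarsenBlue N₀ (seq i) (seq i).toMesh.elems (seq (i + 1))) ∧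
        ∀ seq : ℕ → BlockMesh, seq 0 = T →
          (∀ i, CoarsenBlue N₀ (seq i) (seq i).toMesh.elems (seq (i + 1))) →
          ∃ M : ℕ, seq M = T₀.toBlock)) := by
  subst hN₀
  refine ⟨fun h₀ => ?_, fun h₀ => ?_⟩
  · have G := h₀.grid redShape_tri
    let Inv : Mesh → ℕ → Prop := fun S N => ∃ D, RedTree T₀ S D N ∧ TriOrder S D
    have hInv : ∀ S N, Inv S N → ∃ D, RedTree T₀ S D N := fun S N ⟨D, h, _⟩ => ⟨D, h⟩
    have hcoarsen : ∀ rule S N marked, Inv S N →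
        (∀ K ∈ S.elems, K ∈ level T₀.elems N → K ∈ marked) →
        Inv (coarsenTri rule {v | v ∈ T₀.nodes} S marked) (N - 1) :=
      fun rule S N marked ⟨D, h, ord⟩ hm => coarsenTri_redTree G h₀.2.1 h ord rule hm
    refine ⟨fun rule T hT => ?_, fun T hT seq h0 hseq => ?_⟩
    · obtain ⟨D, N, h, ord⟩ := exists_redTree_tri h₀ hT
      refine ⟨fun hne => ?_, fun seq h0 hseq => ?_⟩
      · obtain ⟨k, h, P, hP, hk⟩ := h.exists_top h₀.2.1 hne
        exact ⟨_, top_mem_quartetsTri G h₀.2.1 h ord rule (fun K hK _ => hK) hP hk⟩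
      · exact red_reaches (Inv := Inv)
          (coarsen := fun S => coarsenTri rule {v | v ∈ T₀.nodes} S S.elems) h₀.2.1 hInv
          (fun S N hS => hcoarsen rule S N _ hS fun K hK _ => hK) ⟨D, h, ord⟩ h0 hseq
    · obtain ⟨S, hS, rfl⟩ := hT.exists_red greenRule_tri G h₀.2.1 fun S hS => by
        obtain ⟨D, N, h, -⟩ := exists_redTree_tri h₀ hS
        exact ⟨h.nodesOK, fun K hK =>
          (h.leaves.level_of_mem hK).elim fun k hk => (G.level k).shape_mem K hk⟩
      obtain ⟨D, N, h, ord⟩ := exists_redTree_tri h₀ hS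
      exact green_reaches greenRule_tri G h₀.2.1 (Inv := Inv) hInv (hcoarsen true) ⟨D, h, ord⟩
        h0 hseq
  · have G := h₀.grid redShape_quad
    have hred : ∀ T, RedRefinement QuadStep T₀ T →
        ∃ D N, RedTree T₀ T D N ∧ QuadOrder T₀.elems T.nodes := fun T hT =>
      exists_redTree_of_redRefinement_quad G (RedTree.init h₀) (QuadOrder.init G h₀.2.1) hT
    let Inv : Mesh → ℕ → Prop := fun S N => ∃ D, RedTree T₀ S D N ∧ QuadOrder T₀.elems S.nodes
    have hInv : ∀ S N, Inv S N → ∃ D, RedTree T₀ S D N := fun S N ⟨D, h, _⟩ => ⟨D, h⟩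
    have hcoarsen : ∀ S N marked, Inv S N →
        (∀ K ∈ S.elems, K ∈ level T₀.elems N → K ∈ marked) →
        Inv (coarsenQuad {v | v ∈ T₀.nodes} S marked) (N - 1) :=
      fun S N marked ⟨D, h, ord⟩ hm => coarsenQuad_redTree G h₀.2.1 h ord hm
    refine ⟨fun T hT => ?_, fun T hT seq h0 hseq => ?_, fun T hT => ?_⟩
    · obtain ⟨D, N, h, ord⟩ := hred T hT
      refine ⟨fun hne => ?_, fun seq h0 hseq => ?_⟩
      · obtain ⟨k, h, P, hP, hk⟩ := h.exists_top h₀.2.1 hne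
        exact ⟨_, top_mem_quartetsQuad G h₀.2.1 h ord (fun K hK _ => hK) hP hk⟩
      · exact red_reaches (Inv := Inv)
          (coarsen := fun S => coarsenQuad {v | v ∈ T₀.nodes} S S.elems) h₀.2.1 hInv
          (fun S N hS => hcoarsen S N _ hS fun K hK _ => hK) ⟨D, h, ord⟩ h0 hseq
    · obtain ⟨S, hS, rfl⟩ := hT.exists_red greenRule_quad G h₀.2.1 fun S hS => by
        obtain ⟨D, N, h, -⟩ := hred S hS
        exact ⟨h.nodesOK, fun K hK =>
          (h.leaves.level_of_mem hK).elim fun k hk => (G.level k).shape_mem K hk⟩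
      obtain ⟨D, N, h, ord⟩ := hred S hS
      exact green_reaches greenRule_quad G h₀.2.1 (Inv := Inv) hInv hcoarsen ⟨D, h, ord⟩ h0 hseq
    · obtain ⟨D, N, h⟩ := exists_blueTree h₀ hT
      exact ⟨exists_coarsenBlue_seq h₀ h, fun seq h0 hseq => blue_reaches h₀ h h0 hseq⟩
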